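/- Let $\mathbb K=\mathbb R$ (real case) or $\mathbb K=\mathbb C$ (complex, i.e. holomorphic, case). Let $G$ be a simply connected solvable Lie group over $\mathbb K$ (in the complex case a complex Lie group), $\mathfrak g$ its Lie algebra over $\mathbb K$, and $N$ its nilradical, i.e. the maximal connected nilpotent normal subgroup of $G$. Let $\mathcal A$ be the set of all smooth (in the complex case: holomorphic) homomorphisms $\alpha:G\to\mathbb C^{*}$ with $\alpha|_N=1$, and write $V_\alpha$ for the one-dimensional representation given by $\alpha$. Let $\rho:G\to GL(V_\rho)$ be a smooth (in the complex case: holomorphic) representation on a finite-dimensional complex vector space such that $\rho|_N$ is unipotent. Put $\bigwedge^p\mathfrak g^*:=\bigwedge^p\mathfrak g_{\mathbb C}^*$ (complex-valued alternating forms) in the real case, and let it denote the $\mathbb C$-multilinear alternating forms in the complex case. Consider the direct sum of Lie algebra (Chevalley–Eilenberg) cochain complexes $$K^*=\bigoplus_{\alpha\in\mathcal A}\bigwedge\nolimits^{*}\mathfrak g^{*}\otimes V_\alpha\otimes V_\rho .$$ For $c\in G$ let $$\Phi(c)=\bigoplus_{\alpha\in\mathcal A}(\mathrm{Ad}_c)_s\otimes\alpha(c)\otimes(\rho(c))_s$$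 act on $K^*$, where the subscript $s$ denotes the semisimple part in the Jordan decomposition and $(\mathrm{Ad}_c)_s$ acts on $\bigwedge\mathfrak g^*$ by the contragredient action, and for a subgroup $C\subset G$ let $(K^*)^{\Phi(C)}$ be the graded subspace of elements fixed by $\Phi(c)$ for all $c\in C$. Then, in both the real and the complex case: 1. There is a subcomplex $A^*\subset K^*$ (written $B^*$ in the complex case) of finite total dimension whose inclusion induces an isomorphism in cohomology in every degree. 2. Such a subcomplex is given by invariants: there is a connected nilpotent subgroup $C\subset G$ with $G=C\cdot N$, and for every connected (in particular, for every simply connected) nilpotent subgroup $C\subset G$ with $G=C\cdot N$, the space $(K^*)^{\Phi(C)}$ is a subcomplex of $K^*$ of finite total dimension and the inclusion $(K^*)^{\Phi(C)}\subset K^*$ induces an isomorphism in cohomology in every degree. -/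

import Mathlib

open scoped Manifold ContDiff DirectSum

universe u v w

noncomputable section

namespace SolvCoh

/-! ### Cohomology of cochain complexes of complex vector spaces, and of subcomplexes -/

section Complexes

variable {K : ℕ → Type*} [∀ p, AddCommGroup (K p)] [∀ p, Module ℂ (K p)]

/-- Coboundaries of degree `p`. -/
def coboundaries (d : ∀ p, K p →ₗ[ℂ] K (p + 1)) : ∀ p, Submodule ℂ (K p)
  | 0 => ⊥
  | p + 1 => LinearMap.range (d p)

/-- The `p`-th cohomology: cocycles modulo coboundaries. -/
abbrev Cohomology (d : ∀ p, K p →ₗ[ℂ] K (p + 1)) (p : ℕ) : Type _ :=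
  LinearMap.ker (d p) ⧸ (coboundaries d p).submoduleOf (LinearMap.ker (d p))

/-- A graded subspace is a subcomplex if it is stable under the differential. -/
def IsSubcomplex (d : ∀ p, K p →ₗ[ℂ] K (p + 1)) (A : ∀ p, Submodule ℂ (K p)) : Prop :=
  ∀ p, ∀ x ∈ A p, d p x ∈ A (p + 1)

/-- The differential of a subcomplex. -/
def subDifferential {d : ∀ p, K p →ₗ[ℂ] K (p + 1)} {A : ∀ p, Submodule ℂ (K p)}
    (hA : IsSubcomplex d A) (p : ℕ) : A p →ₗ[ℂ] A (p + 1) :=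
  (d p).restrict (hA p)

/-- The inclusion of a subcomplex, on cocycles. -/
def cocycleInclusion {d : ∀ p, K p →ₗ[ℂ] K (p + 1)} {A : ∀ p, Submodule ℂ (K p)}
    (hA : IsSubcomplex d A) (p : ℕ) :
    LinearMap.ker (subDifferential hA p) →ₗ[ℂ] LinearMap.ker (d p) :=
  (A p).subtype.restrict fun _ hx => congrArg Subtype.val (LinearMap.mem_ker.1 hx)

/-- The map induced in cohomology by the inclusion of a subcomplex. -/
def cohomologyInclusion {d : ∀ p, K p →ₗ[ℂ] K (p + 1)} {A : ∀ p, Submodule ℂ (K p)}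
    (hA : IsSubcomplex d A) (p : ℕ) :
    Cohomology (subDifferential hA) p →ₗ[ℂ] Cohomology d p :=
  Submodule.mapQ _ _ (cocycleInclusion hA p) (by
    rintro ⟨x, hx⟩ h
    cases p with
    | zero =>
      have h' : x = 0 := h
      subst h'
      exact Submodule.zero_mem _
    | succ p =>
      obtain ⟨y, hy⟩ := h
      exact ⟨(y : K p), congrArg Subtype.val hy⟩)

/-- `A` is a finite-dimensional subcomplex (its total space is finite-dimensional) whose inclusion
induces an isomorphism in cohomology in every degree. -/
structure IsFiniteQuasiIsoSubcomplex (d : ∀ p, K p →ₗ[ℂ] K (p + 1))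
    (A : ∀ p, Submodule ℂ (K p)) : Prop where
  isSubcomplex : IsSubcomplex d A
  finite : Module.Finite ℂ (⨁ p, A p)
  bijective : ∀ p, Function.Bijective (cohomologyInclusion isSubcomplex p)

end Complexes

/-! ### The Chevalley–Eilenberg differential

For a Lie algebra `L` over `𝕜` and a complex vector space `V`, the `𝕜`-multilinear alternating maps
`L^p → V` are the `p`-cochains `⋀^p L^* ⊗ V`; for `𝕜 = ℝ` they are `⋀^p L_ℂ^* ⊗_ℂ V`. -/

section ChevalleyEilenberg

variable {𝕜 : Type*} [RCLike 𝕜] [NormedAlgebra 𝕜 ℂ]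
  {L : Type*} [AddCommGroup L] [Module 𝕜 L]
  {V : Type*} [AddCommGroup V] [Module ℂ V] [Module 𝕜 V] [IsScalarTower 𝕜 ℂ V]

/-- `x ↦ θ x ∘ φ`. -/
def coeffAction (θ : L →ₗ[𝕜] V →ₗ[ℂ] V) {p : ℕ} (φ : L [⋀^Fin p]→ₗ[𝕜] V) :
    L →ₗ[𝕜] L [⋀^Fin p]→ₗ[𝕜] V where
  toFun x := ((θ x).restrictScalars 𝕜).compAlternatingMap φ
  map_add' x y := by ext; simp
  map_smul' c x := by ext; simp

/-- `(x, y) ↦ φ([x, y], ·, …, ·)`, for a bilinear map `b = [·, ·]`. -/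
def bracketInsert (b : L →ₗ[𝕜] L →ₗ[𝕜] L) {p : ℕ} (φ : L [⋀^Fin (p + 1)]→ₗ[𝕜] V) :
    L →ₗ[𝕜] L →ₗ[𝕜] L [⋀^Fin p]→ₗ[𝕜] V :=
  b.compr₂ φ.curryLeft

/-- The cochain map underlying the Chevalley–Eilenberg differential of `L`, with bracket `b` and
coefficients in `V` on which `L` acts by `θ`.  The textbook formula is
`ceDifferential_zero_apply` and `ceDifferential_succ_apply`. -/
def ceDifferentialFun (b : L →ₗ[𝕜] L →ₗ[𝕜] L) (θ : L →ₗ[𝕜] V →ₗ[ℂ] V) :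
    ∀ p : ℕ, L [⋀^Fin p]→ₗ[𝕜] V → L [⋀^Fin (p + 1)]→ₗ[𝕜] V
  | 0, φ => AlternatingMap.alternatizeUncurryFin (coeffAction θ φ)
  | p + 1, φ => AlternatingMap.alternatizeUncurryFin (coeffAction θ φ) -
      (2⁻¹ : ℂ) • AlternatingMap.alternatizeUncurryFin
        (AlternatingMap.alternatizeUncurryFinLM ∘ₗ bracketInsert b φ)

/-- The Chevalley–Eilenberg differential. -/
def ceDifferential (b : L →ₗ[𝕜] L →ₗ[𝕜] L) (θ : L →ₗ[𝕜] V →ₗ[ℂ] V) (p : ℕ) :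
    L [⋀^Fin p]→ₗ[𝕜] V →ₗ[ℂ] L [⋀^Fin (p + 1)]→ₗ[𝕜] V where
  toFun := ceDifferentialFun b θ p
  map_add' φ η := by
    cases p <;> ext v <;>
      simp [ceDifferentialFun, coeffAction, bracketInsert, AlternatingMap.alternatizeUncurryFin_apply,
        Finset.sum_add_distrib]
    abel
  map_smul' c φ := by
    cases p <;> ext v <;>
      simp [ceDifferentialFun, coeffAction, bracketInsert, AlternatingMap.alternatizeUncurryFin_apply,
        Finset.smul_sum, smul_sub, smul_comm _ c]

theorem ceDifferential_zero_apply (b : L →ₗ[𝕜] L →ₗ[𝕜] L) (θ : L →ₗ[𝕜] V →ₗ[ℂ] V)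
    (φ : L [⋀^Fin 0]→ₗ[𝕜] V) (x : Fin 1 → L) :
    ceDifferential b θ 0 φ x = θ (x 0) (φ ![]) := by
  have h : (0 : Fin 1).removeNth x = ![] := Subsingleton.elim _ _
  simp [ceDifferential, ceDifferentialFun, coeffAction,
    AlternatingMap.alternatizeUncurryFin_apply, h]

/-- `dφ(x₀, …, x_{p+1}) = ∑ᵢ (-1)^i θ(xᵢ) φ(…, x̂ᵢ, …)
  + ∑_{i < j} (-1)^(i+j) φ([xᵢ, xⱼ], …, x̂ᵢ, …, x̂ⱼ, …)`; in the second sum the pairs `i < j` of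
`Fin (p + 2)` are written as `(i.castSucc, j.succ)` with `i ≤ j` in `Fin (p + 1)`, which changes
the sign. -/
theorem ceDifferential_succ_apply (b : L →ₗ[𝕜] L →ₗ[𝕜] L) (hb : ∀ x, b x x = 0)
    (θ : L →ₗ[𝕜] V →ₗ[ℂ] V) (p : ℕ) (φ : L [⋀^Fin (p + 1)]→ₗ[𝕜] V) (x : Fin (p + 2) → L) :
    ceDifferential b θ (p + 1) φ x =
      (∑ i : Fin (p + 2), (-1 : ℤ) ^ (i : ℕ) • θ (x i) (φ (i.removeNth x))) -
        ∑ i : Fin (p + 1), ∑ j ≥ i, (-1 : ℤ) ^ (i + j : ℕ) •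
          φ (Matrix.vecCons (b (x i.castSucc) (x j.succ))
            (j.removeNth (i.castSucc.removeNth x))) := by
  have hs : ∀ y z, b y z = -b z y := by
    intro y z
    have h := hb (y + z)
    simp only [map_add, LinearMap.add_apply, hb, zero_add, add_zero] at h
    exact eq_neg_of_add_eq_zero_right h
  have h2 : ∀ y : V, (2⁻¹ : ℂ) • (y + y) = y := fun y => by
    rw [← two_smul ℂ y, smul_smul]; norm_num
  have h3 : ∀ (y z : L) (t : Fin p → L),
      φ (Matrix.vecCons (b z y) t) = -φ (Matrix.vecCons (b y z) t) := fun y z t => by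
    rw [hs z y, ← AlternatingMap.curryLeft_apply_apply, ← AlternatingMap.curryLeft_apply_apply,
      map_neg]
    rfl
  change (AlternatingMap.alternatizeUncurryFin (coeffAction θ φ) -
      (2⁻¹ : ℂ) • AlternatingMap.alternatizeUncurryFin
        (AlternatingMap.alternatizeUncurryFinLM ∘ₗ bracketInsert b φ)) x = _
  rw [AlternatingMap.sub_apply, AlternatingMap.smul_apply,
    AlternatingMap.alternatizeUncurryFin_alternatizeUncurryFinLM_comp_apply,
    AlternatingMap.alternatizeUncurryFin_apply, Finset.smul_sum]
  congr 1
  · refine Finset.sum_congr rfl fun i _ => ?_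
    rw [Finset.smul_sum]
    refine Finset.sum_congr rfl fun j _ => ?_
    rw [smul_comm]
    congr 1
    simp only [bracketInsert, LinearMap.compr₂_apply, AlternatingMap.curryLeft_apply_apply]
    rw [h3 (x i.castSucc) (x j.succ), sub_neg_eq_add, h2]

end ChevalleyEilenberg

/-! ### The semisimple part of an endomorphism -/

/-- The semisimple part of an endomorphism in its Jordan decomposition.  (For an invertible
endomorphism the additive and the multiplicative decompositions have the same semisimple part.) -/
def semisimplePart {F W : Type*} [Field F] [PerfectField F] [AddCommGroup W] [Module F W]
    [FiniteDimensional F W] (f : Module.End F W) : Module.End F W :=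
  f.exists_isNilpotent_isSemisimple.choose_spec.2.choose

theorem semisimplePart_spec {F W : Type*} [Field F] [PerfectField F] [AddCommGroup W] [Module F W]
    [FiniteDimensional F W] (f : Module.End F W) :
    (semisimplePart f).IsSemisimple ∧ IsNilpotent (f - semisimplePart f) ∧
      Commute (semisimplePart f) (f - semisimplePart f) := by
  have hn := f.exists_isNilpotent_isSemisimple.choose_spec.1
  have h := f.exists_isNilpotent_isSemisimple.choose_spec.2.choose_spec
  obtain ⟨hs, hnil, hss, hf⟩ := h
  change semisimplePart f ∈ _ at hs
  change (semisimplePart f).IsSemisimple at hss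
  have hf' : f = f.exists_isNilpotent_isSemisimple.choose + semisimplePart f := hf
  have e : f - semisimplePart f = f.exists_isNilpotent_isSemisimple.choose :=
    sub_eq_iff_eq_add.2 hf'
  refine ⟨hss, e ▸ hnil, ?_⟩
  have hc : Commute f (semisimplePart f) :=
    Algebra.commute_of_mem_adjoin_self hs
  exact (hc.symm.sub_right (Commute.refl _))

/-! ### Lie groups -/

/-- The nilradical of a topological group: the subgroup generated by all connected nilpotent normal
subgroups.  In a connected Lie group it is the maximal connected nilpotent normal subgroup. -/
def nilradical (G : Type*) [TopologicalSpace G] [Group G] : Subgroup G :=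
  sSup {H | H.Normal ∧ Group.IsNilpotent H ∧ IsConnected (H : Set G)}

/-- `C` is a connected nilpotent subgroup with `G = C · N`, where `N` is the nilradical. -/
structure IsNilpotentSupplement {G : Type*} [TopologicalSpace G] [Group G] (C : Subgroup G) :
    Prop where
  nilpotent : Group.IsNilpotent C
  connected : IsConnected (C : Set G)
  mul_eq : ∀ g : G, ∃ c ∈ C, ∃ n ∈ nilradical G, g = c * n

section LieGroups

variable (𝕜 : Type*) [RCLike 𝕜] [NormedAlgebra 𝕜 ℂ]
  (E : Type*) [NormedAddCommGroup E] [NormedSpace 𝕜 E]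
  (G : Type*) [TopologicalSpace G] [ChartedSpace E G] [Group G]

/-- The Lie algebra of `G`, a Lie algebra over `𝕜`. -/
abbrev 𝔤 : Type _ := GroupLieAlgebra 𝓘(𝕜, E) G

instance [FiniteDimensional 𝕜 E] : FiniteDimensional 𝕜 (𝔤 𝕜 E G) :=
  inferInstanceAs (FiniteDimensional 𝕜 E)

/-- The bracket of the Lie algebra of `G`, as a bilinear map. -/
def lieBilin [FiniteDimensional 𝕜 E] [LieGroup 𝓘(𝕜, E) ∞ G] :
    𝔤 𝕜 E G →ₗ[𝕜] 𝔤 𝕜 E G →ₗ[𝕜] 𝔤 𝕜 E G :=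
  haveI : CompleteSpace E := FiniteDimensional.complete 𝕜 E
  haveI : LieGroup 𝓘(𝕜, E) (minSmoothness 𝕜 3) G := by
    rw [minSmoothness_of_isRCLikeNormedField]; infer_instance
  LinearMap.mk₂ 𝕜 (fun x y => ⁅x, y⁆) add_lie smul_lie lie_add (fun c x y => lie_smul c x y)

variable {G}

/-- The adjoint representation: `Ad g` is the derivative at `1` of conjugation by `g`. -/
def Ad (g : G) : Module.End 𝕜 (𝔤 𝕜 E G) :=
  ContinuousLinearMap.toLinearMap
    (mfderiv 𝓘(𝕜, E) 𝓘(𝕜, E) (fun x : G => g * x * g⁻¹) (1 : G) :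
      𝔤 𝕜 E G →L[𝕜] 𝔤 𝕜 E G)

variable (G)

/-- The characters `α : G → ℂ^*` (smooth for `𝕜 = ℝ`, holomorphic for `𝕜 = ℂ`) which are trivial on
the nilradical. -/
def Characters : Type _ :=
  {α : G →* ℂˣ // ContMDiff 𝓘(𝕜, E) 𝓘(𝕜, ℂ) ∞ (fun g => (α g : ℂ)) ∧
    ∀ n ∈ nilradical G, α n = 1}

variable {G}
variable {V : Type*} [NormedAddCommGroup V] [NormedSpace ℂ V] [NormedSpace 𝕜 V]
  [IsScalarTower 𝕜 ℂ V]

/-- The representation `V_α ⊗ V_ρ`, realised on the space of `ρ`. -/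
def twist (α : G →* ℂˣ) (ρ : G →* (V →L[ℂ] V)) : G →* (V →L[ℂ] V) where
  toFun g := (α g : ℂ) • ρ g
  map_one' := by simp
  map_mul' g h := by
    rw [map_mul, map_mul, Units.val_mul, smul_mul_smul_comm]

/-- The derivative `dρ(x)` at `1` of a representation `ρ`, in the direction `x`. -/
def derivedEnd (ρ : G →* (V →L[ℂ] V)) (x : 𝔤 𝕜 E G) : V →L[ℂ] V :=
  mfderiv 𝓘(𝕜, E) 𝓘(𝕜, V →L[ℂ] V) (fun g : G => ρ g) (1 : G) x

/-- The action `x ↦ dρ(x)` of the Lie algebra of `G` on `V`. -/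
def derivedRep (ρ : G →* (V →L[ℂ] V)) : 𝔤 𝕜 E G →ₗ[𝕜] V →ₗ[ℂ] V where
  toFun x := (derivedEnd 𝕜 E ρ x : V →ₗ[ℂ] V)
  map_add' x y := by
    simp only [derivedEnd, map_add]; rfl
  map_smul' c x := by
    simp only [derivedEnd, map_smul]; rfl

variable (G V)

/-- The degree `p` part of `⨁_α ⋀ 𝔤^* ⊗ V_α ⊗ V_ρ`. -/
abbrev TotalCochains (p : ℕ) : Type _ :=
  ⨁ _α : Characters 𝕜 E G, (𝔤 𝕜 E G) [⋀^Fin p]→ₗ[𝕜] V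

variable {G V}

/-- The differential of `⨁_α ⋀ 𝔤^* ⊗ V_α ⊗ V_ρ`: on the summand `α` it is the Chevalley–Eilenberg
differential with coefficients in `V_α ⊗ V_ρ`. -/
def totalDifferential [FiniteDimensional 𝕜 E] [LieGroup 𝓘(𝕜, E) ∞ G]
    (ρ : G →* (V →L[ℂ] V)) (p : ℕ) :
    TotalCochains 𝕜 E G V p →ₗ[ℂ] TotalCochains 𝕜 E G V (p + 1) :=
  DirectSum.lmap fun α =>
    ceDifferential (lieBilin 𝕜 E G) (derivedRep 𝕜 E (twist α.1 ρ)) p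

/-- The action `Φ(c) = ⨁_α (Ad_c)_s ⊗ α(c) ⊗ (ρ(c))_s` on cochains of degree `p`, where `Ad_c` acts
on `⋀ 𝔤^*` through the dual of `𝔤`, that is, by composition with `Ad_{c⁻¹}`. -/
def Phi [FiniteDimensional 𝕜 E] [FiniteDimensional ℂ V]
    (ρ : G →* (V →L[ℂ] V)) (c : G) (p : ℕ) :
    TotalCochains 𝕜 E G V p →ₗ[ℂ] TotalCochains 𝕜 E G V p :=
  DirectSum.lmap fun α =>
    { toFun := fun φ => (α.1 c : ℂ) •
        ((semisimplePart ((ρ c : V →L[ℂ] V) : Module.End ℂ V)).restrictScalars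
          𝕜).compAlternatingMap (φ.compLinearMap (semisimplePart (Ad 𝕜 E c⁻¹)))
      map_add' := fun φ η => by ext; simp
      map_smul' := fun a φ => by ext; simp [smul_comm _ a] }

/-- The invariants `(⨁_α ⋀^p 𝔤^* ⊗ V_α ⊗ V_ρ)^{Φ(C)}`. -/
def invariants [FiniteDimensional 𝕜 E] [FiniteDimensional ℂ V]
    (ρ : G →* (V →L[ℂ] V)) (C : Subgroup G) (p : ℕ) :
    Submodule ℂ (TotalCochains 𝕜 E G V p) where
  carrier := {x | ∀ c ∈ C, Phi 𝕜 E ρ c p x = x}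
  add_mem' hx hy c hc := by rw [map_add, hx c hc, hy c hc]
  zero_mem' c _ := map_zero _
  smul_mem' a x hx c hc := by rw [map_smul, hx c hc]

end LieGroups

end SolvCoh

end

set_option linter.unusedSectionVars false

noncomputable section
namespace SolvCoh

/-! ### Connected topological groups and the Lie-Kolchin theorem. -/

section ConnectedGroups

open Module Filter Topology
open scoped commutatorElement

/-! The complex is a direct sum over characters, so one works on the summand of α, with coefficients
in π = α ⊗ ρ. There G acts on cochains through π and Ad. This action commutes with the differential
d, and its derivative at 1 is the Lie derivative, which by Cartan's formula equals d i_x + i_x d and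
so sends cocycles to coboundaries. Since G is connected, it acts trivially on cohomology
(`cochainRep_sub_mem_coboundaries`).

Φ(c) is the semisimple part of the action of c, so its fixed vectors are the generalised eigenspace
of c for the eigenvalue 1 (`maxGenEigenspace_pullPush`, `mem_invariants_iff`). For C connected and
nilpotent these generalised eigenspaces are C-stable (`mem_maxGenEigenspace_of_isNilpotent`). On
each summand, finitely many elements of C already cut out the invariants. Fitting's decomposition,
for one of them after another, moves a cocycle to an invariant one in its class and makes an
invariant coboundary the differential of an invariant cochain (`exists_genInvariant_sub_mem`,
`exists_genInvariant_map_eq`).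

Finiteness: a nonzero invariant in the summand of α makes α⁻¹ restricted to C a weight of C on the
finite-dimensional space of ρ-valued cochains. There are finitely many weights, and α is determined
on C because it is trivial on N and G = CN (`finite_setOf_genInvariants_ne_bot`).

The C-stability uses no Lie structure on C, which need not be closed. C acts by conjugation on the
matrix coefficients of a representation; this action kills one more step of the lower central
series, and a Lie-Kolchin argument shows that 1 is its only generalised eigenvalue.

Existence of C: some Engel subalgebra of 𝔤 is a Cartan subalgebra; it is nilpotent and spans 𝔤
together with [𝔤, 𝔤]. Lie-Kolchin for the coadjoint representation makes [𝔤, 𝔤] act nilpotently, so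
its one-parameter subgroups generate a connected nilpotent normal subgroup, which lies in N. The two
subgroups generated in this way contain a neighbourhood of 1 in their join, which is therefore G. -/

theorem isPreconnected_subgroup_closure {H : Type*} [Group H] [TopologicalSpace H]
    [IsTopologicalGroup H] (S : Set H)
    (hS : ∀ s ∈ S, ∃ T ⊆ (Subgroup.closure S : Set H), IsPreconnected T ∧ (1 : H) ∈ T ∧ s ∈ T) :
    IsPreconnected (Subgroup.closure S : Set H) := by
  refine isPreconnected_of_forall 1 fun y hy => ?_
  suffices ∃ T ⊆ (Subgroup.closure S : Set H), IsPreconnected T ∧ (1 : H) ∈ T ∧ y ∈ T by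
    obtain ⟨T, h1, h2, h3, h4⟩ := this
    exact ⟨T, h1, h3, h4, h2⟩
  induction hy using Subgroup.closure_induction with
  | mem x hx => exact hS x hx
  | one => exact ⟨{1}, by simp, isPreconnected_singleton, rfl, rfl⟩
  | mul x y hx hy ihx ihy =>
    obtain ⟨T, h1, h2, h3, h4⟩ := ihx
    obtain ⟨U, k1, k2, k3, k4⟩ := ihy
    -- `T` leads from 1 to x, and the translate of `U` by x leads on from x to xy.
    refine ⟨T ∪ (fun z => x * z) '' U, ?_, ?_, Or.inl h3, Or.inr ⟨y, k4, rfl⟩⟩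
    · rintro z (hz | ⟨z, hz, rfl⟩)
      · exact h1 hz
      · exact Subgroup.mul_mem _ hx (k1 hz)
    · exact h2.union x h4 ⟨1, k3, mul_one x⟩
        (k2.image _ (continuous_const_mul x).continuousOn)
  | inv x hx ih =>
    obtain ⟨T, h1, h2, h3, h4⟩ := ih
    refine ⟨(fun z => z⁻¹) '' T, ?_, h2.image _ continuous_inv.continuousOn, ⟨1, h3, inv_one⟩,
      ⟨x, h4, rfl⟩⟩
    rintro z ⟨z, hz, rfl⟩
    exact Subgroup.inv_mem _ (h1 hz)

variable {H : Type*} [Group H] [TopologicalSpace H] [IsTopologicalGroup H]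

theorem isPreconnected_commutator {K : Subgroup H} (hK : IsPreconnected (K : Set H)) :
    IsPreconnected ((⁅K, K⁆ : Subgroup H) : Set H) := by
  rw [Subgroup.commutator_def]
  refine isPreconnected_subgroup_closure _ ?_
  rintro _ ⟨a, ha, b, hb, rfl⟩
  refine ⟨(fun x => ⁅x, b⁆) '' (K : Set H), ?_, hK.image _ ?_, ⟨1, K.one_mem, by simp⟩, ⟨a, ha, rfl⟩⟩
  · rintro _ ⟨x, hx, rfl⟩
    exact Subgroup.subset_closure ⟨x, hx, b, hb, rfl⟩
  · simp only [commutatorElement_def]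
    fun_prop

theorem isPreconnected_derivedSeries [PreconnectedSpace H] (n : ℕ) :
    IsPreconnected (derivedSeries H n : Set H) := by
  induction n with
  | zero => exact isPreconnected_univ
  | succ n ih => exact isPreconnected_commutator ih

variable {V : Type*} [AddCommGroup V] [Module ℂ V]

/-- A representation all of whose matrix coefficients are continuous. -/
def CoeffContinuous (ψ : H →* End ℂ V) : Prop :=
  ∀ (l : Dual ℂ V) (v : V), Continuous fun g => l (ψ g v)

/-- A finite subset of ℂ is totally disconnected. In the applications the values are eigenvalues of
one fixed endomorphism (up to a factor), and connectedness forces them to be constant. -/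
theorem eq_of_isPreconnected_of_finite {X : Type*} [TopologicalSpace X] {K : Set X}
    (hK : IsPreconnected K) {f : X → ℂ} (hf : Continuous f) {S : Set ℂ} (hS : S.Finite)
    (hfS : ∀ x ∈ K, f x ∈ S) {x y : X} (hx : x ∈ K) (hy : y ∈ K) : f x = f y :=
  hS.countable.isTotallyDisconnected _ (by rintro _ ⟨z, hz, rfl⟩; exact hfS z hz)
    (hK.image f hf.continuousOn) ⟨x, hx, rfl⟩ ⟨y, hy, rfl⟩

variable [FiniteDimensional ℂ V]

/-- The inductive step of the Lie-Kolchin theorem. -/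
theorem exists_common_eigenvector_of_commutator {ψ : H →* End ℂ V} (hc : CoeffContinuous ψ)
    {K : Subgroup H} (hK : IsPreconnected (K : Set H))
    (ih : ∀ W : Submodule ℂ V, W ≠ ⊥ → (∀ g ∈ ⁅K, K⁆, ∀ w ∈ W, ψ g w ∈ W) →
      ∃ w ∈ W, w ≠ 0 ∧ ∀ g ∈ ⁅K, K⁆, ∃ c : ℂ, ψ g w = c • w)
    (W₀ : Submodule ℂ V) (hW₀ : W₀ ≠ ⊥) (hs₀ : ∀ g ∈ K, ∀ w ∈ W₀, ψ g w ∈ W₀) :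
    ∃ w ∈ W₀, w ≠ 0 ∧ ∀ g ∈ K, ∃ c : ℂ, ψ g w = c • w := by
  -- A minimal nonzero stable subspace is irreducible; on it every element of `K` will turn out to
  -- be a scalar.
  obtain ⟨W, ⟨hWle, hW, hs⟩, hmin⟩ := WellFounded.has_min (wellFounded_lt (α := Submodule ℂ V))
    {W | W ≤ W₀ ∧ W ≠ ⊥ ∧ ∀ g ∈ K, ∀ w ∈ W, ψ g w ∈ W} ⟨W₀, le_rfl, hW₀, hs₀⟩
  have hirr : ∀ U : Submodule ℂ V, U ≤ W → U ≠ ⊥ → (∀ g ∈ K, ∀ w ∈ U, ψ g w ∈ U) → U = W := by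
    intro U h1 h2 h3
    by_contra h
    exact hmin U ⟨h1.trans hWle, h2, h3⟩ (lt_of_le_of_ne h1 h)
  have hDK : ⁅K, K⁆ ≤ K := Subgroup.commutator_le_self K
  obtain ⟨w, hwW, hw0, hw⟩ := ih W hW fun g hg => hs g (hDK hg)
  choose! χ hχ using hw
  obtain ⟨l, hl⟩ := Module.Projective.exists_dual_eq_one ℂ hw0
  have hlχ : ∀ d ∈ ⁅K, K⁆, l (ψ d w) = χ d := fun d hd => by rw [hχ d hd, map_smul, hl]; simp
  have hne : ∀ g : H, ∀ v : V, v ≠ 0 → ψ g v ≠ 0 := fun g v hv h => hv (by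
    have : ψ (g⁻¹ * g) v = ψ g⁻¹ (ψ g v) := by rw [map_mul]; rfl
    rw [h, map_zero, inv_mul_cancel, map_one] at this
    exact this)
  have hconj : ∀ h ∈ K, ∀ d ∈ ⁅K, K⁆, h⁻¹ * d * h ∈ ⁅K, K⁆ := by
    intro h hh d hd
    have : h⁻¹ * d * h = ⁅h⁻¹, d⁆ * d := by simp [commutatorElement_def]
    rw [this]
    exact Subgroup.mul_mem _ (Subgroup.commutator_mem_commutator (K.inv_mem hh) (hDK hd)) hd
  have hswap : ∀ h d : H, ∀ v : V, ψ d (ψ h v) = ψ h (ψ (h⁻¹ * d * h) v) := by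
    intro h d v
    rw [← Module.End.mul_apply, ← Module.End.mul_apply, ← map_mul, ← map_mul]
    congr 2; group
  -- χ(h⁻¹dh) is an eigenvalue of ψ(d), with eigenvector ψ(h)w, and it depends continuously on h.
  have hχc : ∀ h ∈ K, ∀ d ∈ ⁅K, K⁆, χ (h⁻¹ * d * h) = χ d := by
    intro h hh d hd
    have key := eq_of_isPreconnected_of_finite hK (f := fun h => l (ψ (h⁻¹ * d * h) w))
      ((hc l w).comp (by fun_prop)) (Module.End.finite_hasEigenvalue (ψ d)) (fun x hx => by
        rw [hlχ _ (hconj x hx d hd)]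
        refine Module.End.hasEigenvalue_of_hasEigenvector (x := ψ x w) ⟨?_, hne x w hw0⟩
        rw [Module.End.mem_eigenspace_iff, hswap, hχ _ (hconj x hx d hd), map_smul]) hh K.one_mem
    simp only [inv_one, one_mul, mul_one] at key
    rwa [hlχ _ (hconj h hh d hd), hlχ _ hd] at key
  -- the commutator subgroup acts by scalars
  let U : Submodule ℂ V :=
    { carrier := {v | v ∈ W ∧ ∀ d ∈ ⁅K, K⁆, ψ d v = χ d • v}
      add_mem' := fun {a b} ha hb => ⟨W.add_mem ha.1 hb.1, fun d hd => by
        rw [map_add, ha.2 d hd, hb.2 d hd, smul_add]⟩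
      zero_mem' := ⟨W.zero_mem, fun d _ => by simp⟩
      smul_mem' := fun c a ha => ⟨W.smul_mem c ha.1, fun d hd => by
        rw [map_smul, ha.2 d hd, smul_comm]⟩ }
  have hU : U = W := hirr U (fun v hv => hv.1)
    (fun h => hw0 ((Submodule.mem_bot ℂ).1 (h ▸ (show w ∈ U from ⟨hwW, hχ⟩))))
    (fun g hg v hv => ⟨hs g hg v hv.1, fun d hd => by
      rw [hswap, hv.2 _ (hconj g hg d hd), map_smul, hχc g hg d hd]⟩)
  have hscal : ∀ d ∈ ⁅K, K⁆, ∀ v ∈ W, ψ d v = χ d • v := fun d hd v hv => by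
    rw [← hU] at hv; exact hv.2 d hd
  refine ⟨w, hWle hwW, hw0, fun a ha => ?_⟩
  -- `ψ a` has an eigenvector in `W`
  have : Nontrivial W := Submodule.nontrivial_iff_ne_bot.2 hW
  obtain ⟨μ, hμ⟩ := Module.End.exists_eigenvalue ((ψ a).restrict (hs a ha))
  obtain ⟨⟨v, hvW⟩, hv⟩ := hμ.exists_hasEigenvector
  have hv0 : v ≠ 0 := fun h => hv.2 (Subtype.ext h)
  have hva : ψ a v = μ • v := congrArg Subtype.val (Module.End.mem_eigenspace_iff.1 hv.1)
  have hμ0 : μ ≠ 0 := fun h => hne a v hv0 (by rw [hva, h, zero_smul])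
  have hab : ∀ b ∈ K, ∀ v ∈ W, ψ a (ψ b v) = χ ⁅a, b⁆ • ψ b (ψ a v) := by
    intro b hb v hv
    rw [← hscal _ (Subgroup.commutator_mem_commutator ha hb) _ (hs b hb _ (hs a ha _ hv))]
    simp only [← Module.End.mul_apply, ← map_mul]
    congr 2
    simp [commutatorElement_def]
  -- ψ(b)v is an eigenvector of ψ(a) with eigenvalue χ([a, b])μ. Connectedness makes χ([a, b])
  -- independent of b, and b = 1 gives 1. So ψ(a) commutes with ψ(b) on `W` and its μ-eigenspace is
  -- stable.
  have hχ1 : ∀ b ∈ K, χ ⁅a, b⁆ = 1 := by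
    intro b hb
    have hcb : Continuous fun b : H => ⁅a, b⁆ := by
      simp only [commutatorElement_def]; fun_prop
    have key := eq_of_isPreconnected_of_finite hK (f := fun b => l (ψ ⁅a, b⁆ w))
      ((hc l w).comp hcb)
      ((Module.End.finite_hasEigenvalue (ψ a)).image fun x => x * μ⁻¹) (fun x hx => by
        rw [hlχ _ (Subgroup.commutator_mem_commutator ha hx)]
        refine ⟨χ ⁅a, x⁆ * μ, ?_, by field_simp⟩
        refine Module.End.hasEigenvalue_of_hasEigenvector (x := ψ x v) ⟨?_, hne x v hv0⟩
        rw [Module.End.mem_eigenspace_iff, hab x hx v hvW, hva, map_smul, smul_smul]) hb K.one_mem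
    rw [hlχ _ (Subgroup.commutator_mem_commutator ha hb)] at key
    rw [key]
    simp [hl]
  let U' : Submodule ℂ V := W ⊓ Module.End.eigenspace (ψ a) μ
  have hU' : U' = W := hirr U' inf_le_left
    (fun h => hv0 ((Submodule.mem_bot ℂ).1
      (h ▸ (show v ∈ U' from ⟨hvW, Module.End.mem_eigenspace_iff.2 hva⟩))))
    (fun g hg u hu => ⟨hs g hg u hu.1, by
      have h2 := Module.End.mem_eigenspace_iff.1 hu.2
      exact Module.End.mem_eigenspace_iff.2 (by
        rw [hab g hg u hu.1, hχ1 g hg, one_smul, h2, map_smul])⟩)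
  have hw' : w ∈ U' := hU' ▸ hwW
  exact ⟨μ, Module.End.mem_eigenspace_iff.1 hw'.2⟩

/-- The Lie-Kolchin theorem for a connected solvable group acting on a stable subspace. -/
theorem exists_common_eigenvector [PreconnectedSpace H] {ψ : H →* End ℂ V}
    (hc : CoeffContinuous ψ) {n : ℕ} (hn : ∀ g ∈ derivedSeries H n, ψ g = 1)
    (W : Submodule ℂ V) (hW : W ≠ ⊥) (hs : ∀ g, ∀ w ∈ W, ψ g w ∈ W) :
    ∃ w ∈ W, w ≠ 0 ∧ ∀ g, ∃ c : ℂ, ψ g w = c • w := by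
  -- Climbing the derived series from its `n`-th term, which acts trivially, to the whole group.
  have key : ∀ k ≤ n, ∀ W : Submodule ℂ V, W ≠ ⊥ →
      (∀ g ∈ derivedSeries H (n - k), ∀ w ∈ W, ψ g w ∈ W) →
      ∃ w ∈ W, w ≠ 0 ∧ ∀ g ∈ derivedSeries H (n - k), ∃ c : ℂ, ψ g w = c • w := by
    intro k
    induction k with
    | zero =>
      intro _ W hW _
      obtain ⟨w, hw, hw0⟩ := Submodule.exists_mem_ne_zero_of_ne_bot hW
      exact ⟨w, hw, hw0, fun g hg => ⟨1, by rw [hn g hg, one_smul]; rfl⟩⟩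
    | succ k ih =>
      intro hk W hW hs
      have e : n - k = n - (k + 1) + 1 := by omega
      have ih' := ih (by omega)
      rw [e, derivedSeries_succ] at ih'
      exact exists_common_eigenvector_of_commutator hc (isPreconnected_derivedSeries _) ih' W hW hs
  have := key n le_rfl W hW
  simp only [Nat.sub_self, derivedSeries_zero, Subgroup.mem_top, true_imp_iff] at this
  exact this hs

end ConnectedGroups

/-! ### Conjugation on matrix coefficients, and generalised eigenspaces for connected nilpotent
groups. -/

section ConnectedGroups

open Module Topology
open scoped commutatorElement

/-- In finite dimension a separating set of functionals spans the dual. Statements linear in a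
functional need then be checked only on evaluations. -/
theorem span_eq_top_of_separating {K M : Type*} [Field K] [AddCommGroup M] [Module K M]
    [FiniteDimensional K M] {S : Set (Dual K M)} (hS : ∀ m : M, (∀ s ∈ S, s m = 0) → m = 0) :
    Submodule.span K S = ⊤ := by
  have h : (Submodule.span K S).dualCoannihilator = ⊥ := by
    rw [Submodule.eq_bot_iff]
    intro m hm
    exact hS m fun s hs => (Submodule.mem_dualCoannihilator m).1 hm s (Submodule.subset_span hs)
  rw [← Subspace.dualCoannihilator_dualAnnihilator_eq (W := Submodule.span K S), h,
    Submodule.dualAnnihilator_bot]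

variable {H : Type u} [Group H] [TopologicalSpace H] [IsTopologicalGroup H]

theorem CoeffContinuous.of_separating {V : Type*} [AddCommGroup V] [Module ℂ V]
    [FiniteDimensional ℂ V] {ψ : H →* End ℂ V} {S : Set (Dual ℂ V)}
    (hS : ∀ v : V, (∀ s ∈ S, s v = 0) → v = 0)
    (hc : ∀ s ∈ S, ∀ v, Continuous fun g => s (ψ g v)) : CoeffContinuous ψ := by
  intro l v
  have hl : l ∈ Submodule.span ℂ S := by rw [span_eq_top_of_separating hS]; trivial
  induction hl using Submodule.span_induction with
  | mem x h => exact hc x h v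
  | zero => simpa using continuous_const
  | add x y _ _ hx hy => exact hx.add hy
  | smul a x _ hx => exact hx.const_smul a

/-- The action of a group on the functions on it by conjugation. -/
def conjFun (H : Type*) [Group H] : H →* End ℂ (H → ℂ) where
  toFun z :=
    { toFun := fun f g => f (z⁻¹ * g * z)
      map_add' := fun _ _ => rfl
      map_smul' := fun _ _ => rfl }
  map_one' := by ext; simp
  map_mul' y z := by
    ext f g
    change f ((y * z)⁻¹ * g * (y * z)) = f (z⁻¹ * (y⁻¹ * g * y) * z)
    congr 1; group

variable {V : Type v} [AddCommGroup V] [Module ℂ V]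

/-- The functions `g ↦ L (ψ g)` for linear functionals `L` on endomorphisms. -/
def coeffMap (ψ : H →* End ℂ V) : Dual ℂ (End ℂ V) →ₗ[ℂ] (H → ℂ) where
  toFun L g := L (ψ g)
  map_add' _ _ := rfl
  map_smul' _ _ := rfl

/-- The space of matrix coefficients of a representation. -/
def coeffSpace (ψ : H →* End ℂ V) : Submodule ℂ (H → ℂ) := LinearMap.range (coeffMap ψ)

/-- Conjugation of endomorphisms: `X ↦ M' X M`. -/
def conjEnd (M' M : End ℂ V) : End ℂ (End ℂ V) :=
  LinearMap.mulLeft ℂ M' * LinearMap.mulRight ℂ M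

theorem conjFun_coeffMap (ψ : H →* End ℂ V) (z : H) (L : Dual ℂ (End ℂ V)) :
    conjFun H z (coeffMap ψ L) = coeffMap ψ (L ∘ₗ conjEnd (ψ z⁻¹) (ψ z)) := by
  ext g
  change L (ψ (z⁻¹ * g * z)) = L (ψ z⁻¹ * (ψ g * ψ z))
  rw [map_mul ψ, map_mul ψ, mul_assoc]

theorem conjFun_mem (ψ : H →* End ℂ V) (z : H) {f : H → ℂ} (hf : f ∈ coeffSpace ψ) :
    conjFun H z f ∈ coeffSpace ψ := by
  obtain ⟨L, rfl⟩ := hf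
  exact ⟨_, (conjFun_coeffMap ψ z L).symm⟩

/-- The action by conjugation on the space of matrix coefficients. -/
def conjCoeff (ψ : H →* End ℂ V) : H →* End ℂ (coeffSpace ψ) where
  toFun z := (conjFun H z).restrict fun _ hf => conjFun_mem ψ z hf
  map_one' := by
    ext f g
    exact congrFun (LinearMap.congr_fun (map_one (conjFun H)) f.1) g
  map_mul' y z := by
    ext f g
    exact congrFun (LinearMap.congr_fun (map_mul (conjFun H) y z) f.1) g

theorem conjCoeff_apply (ψ : H →* End ℂ V) (z : H) (f : coeffSpace ψ) (g : H) :
    (conjCoeff ψ z f : H → ℂ) g = (f : H → ℂ) (z⁻¹ * g * z) := rfl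

variable [FiniteDimensional ℂ V]

instance (ψ : H →* End ℂ V) : FiniteDimensional ℂ (coeffSpace ψ) :=
  inferInstanceAs (FiniteDimensional ℂ (LinearMap.range (coeffMap ψ)))

theorem continuous_of_mem_coeffSpace {ψ : H →* End ℂ V} (hc : CoeffContinuous ψ) {f : H → ℂ}
    (hf : f ∈ coeffSpace ψ) : Continuous f := by
  obtain ⟨L, rfl⟩ := hf
  have hL : L ∈ Submodule.span ℂ
      {L : Dual ℂ (End ℂ V) | ∃ (l : Dual ℂ V) (v : V), L = l ∘ₗ LinearMap.applyₗ v} := by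
    rw [span_eq_top_of_separating]
    · trivial
    · intro X hX
      ext v
      refine (Module.forall_dual_apply_eq_zero_iff ℂ _).1 fun l => ?_
      exact hX _ ⟨l, v, rfl⟩
  induction hL using Submodule.span_induction with
  | mem L h => obtain ⟨l, v, rfl⟩ := h; exact hc l v
  | zero => exact continuous_const
  | add x y _ _ hx hy => exact hx.add hy
  | smul a x _ hx => exact hx.const_smul a

theorem coeffContinuous_conjCoeff {ψ : H →* End ℂ V} (hc : CoeffContinuous ψ) :
    CoeffContinuous (conjCoeff ψ) := by
  refine CoeffContinuous.of_separating
    (S := Set.range fun x : H => (LinearMap.proj x : (H → ℂ) →ₗ[ℂ] ℂ) ∘ₗ (coeffSpace ψ).subtype) ?_ ?_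
  · intro f hf
    ext x
    exact hf _ ⟨x, rfl⟩
  · rintro _ ⟨x, rfl⟩ f
    exact (continuous_of_mem_coeffSpace hc f.2).comp (by fun_prop : Continuous fun z => z⁻¹ * x * z)

/-- The identity g⁻¹xg = [g⁻¹, x]x moves g one step down the lower central series, where ψ is
trivial. This is the gain that drives the induction on the nilpotency class. -/
theorem conjCoeff_eq_one {ψ : H →* End ℂ V} {n : ℕ}
    (hn : ∀ g ∈ (⊤ : Subgroup H).lowerCentralSeries (n + 1), ψ g = 1) {g : H}
    (hg : g ∈ (⊤ : Subgroup H).lowerCentralSeries n) : conjCoeff ψ g = 1 := by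
  ext f x
  obtain ⟨_, L, rfl⟩ := f
  change L (ψ (g⁻¹ * x * g)) = L (ψ x)
  have h1 : g⁻¹ * x * g = ⁅g⁻¹, x⁆ * x := by simp [commutatorElement_def]
  have h2 : ⁅g⁻¹, x⁆ ∈ (⊤ : Subgroup H).lowerCentralSeries (n + 1) :=
    Subgroup.commutator_mem_commutator (Subgroup.inv_mem _ hg) trivial
  rw [h1, map_mul, hn _ h2, one_mul]

/-- Conjugation has no generalised eigenvalue other than `1` on matrix coefficients. -/
theorem maxGenEigenspace_conjCoeff_eq_top [PreconnectedSpace H] {ψ : H →* End ℂ V}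
    (hc : CoeffContinuous ψ) {n : ℕ}
    (hn : ∀ g ∈ (⊤ : Subgroup H).lowerCentralSeries n, conjCoeff ψ g = 1) (z : H)
    (hst : ∀ (c : ℂ) (g : H), ∀ f ∈ (conjCoeff ψ z).maxGenEigenspace c,
      conjCoeff ψ g f ∈ (conjCoeff ψ z).maxGenEigenspace c) :
    (conjCoeff ψ z).maxGenEigenspace 1 = ⊤ := by
  rw [eq_top_iff, ← Module.End.iSup_maxGenEigenspace_eq_top (conjCoeff ψ z), iSup_le_iff]
  intro c
  by_cases hc1 : c = 1
  · rw [hc1]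
  suffices (conjCoeff ψ z).maxGenEigenspace c = ⊥ by rw [this]; exact bot_le
  by_contra hbot
  -- The stability hypothesis `hst` lets Lie-Kolchin be applied inside the generalised eigenspace of
  -- `c ≠ 1`. The resulting f cannot be fixed by z; the rest shows that every element fixes f.
  obtain ⟨f, hf, hf0, hfχ⟩ := exists_common_eigenvector (coeffContinuous_conjCoeff hc)
    (n := n) (fun g hg => hn g (Subgroup.derived_le_lower_central n hg)) _ hbot (hst c)
  have hz : conjCoeff ψ z f ≠ f := by
    intro h
    have h1 : f ∈ (conjCoeff ψ z).maxGenEigenspace 1 :=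
      Module.End.eigenspace_le_maxGenEigenspace
        (Module.End.mem_eigenspace_iff.2 (by rw [h, one_smul]))
    exact hf0 ((Submodule.disjoint_def.1
      (Module.End.disjoint_genEigenspace (conjCoeff ψ z) hc1 ⊤ ⊤)) f hf h1)
  let S : Subgroup H :=
    { carrier := {g | conjCoeff ψ g f = f}
      one_mem' := by simp
      mul_mem' := fun {a b} (ha : _ = _) (hb : _ = _) => by
        change conjCoeff ψ (a * b) f = f
        rw [map_mul, Module.End.mul_apply, hb, ha]
      inv_mem' := fun {a} (ha : _ = _) => by
        change conjCoeff ψ a⁻¹ f = f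
        nth_rw 1 [← ha]
        rw [← Module.End.mul_apply, ← map_mul, inv_mul_cancel, map_one]
        rfl }
  -- Conjugation by g fixes g, so evaluating the eigenvector equation for g at the point g gives
  -- f(g) = c f(g). Thus the stabiliser of f contains the nonempty open set where f ≠ 0, and is an
  -- open subgroup.
  have hfS : ∀ g, (f : H → ℂ) g ≠ 0 → g ∈ S := by
    intro g hg
    obtain ⟨c, hc⟩ := hfχ g
    have h1 : (conjCoeff ψ g f : H → ℂ) g = c * (f : H → ℂ) g := by rw [hc]; rfl
    rw [conjCoeff_apply, inv_mul_cancel, one_mul] at h1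
    have h2 : c = 1 := by
      have : (c - 1) * (f : H → ℂ) g = 0 := by rw [sub_mul, ← h1]; ring
      exact sub_eq_zero.1 ((mul_eq_zero.1 this).resolve_right hg)
    change conjCoeff ψ g f = f
    rw [hc, h2, one_smul]
  obtain ⟨x, hx⟩ : ∃ x, (f : H → ℂ) x ≠ 0 := by
    by_contra h
    push Not at h
    exact hf0 (Subtype.ext (funext h))
  have hopen : IsOpen (S : Set H) := by
    refine S.isOpen_of_mem_nhds (g := x) ?_
    have hcont := continuous_of_mem_coeffSpace hc f.2
    exact Filter.mem_of_superset ((isOpen_ne.preimage hcont).mem_nhds hx) hfS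
  have huniv : (S : Set H) = Set.univ :=
    IsClopen.eq_univ ⟨S.isClosed_of_isOpen hopen, hopen⟩ ⟨1, S.one_mem⟩
  exact hz (show z ∈ S from by rw [← SetLike.mem_coe, huniv]; trivial)

/-- On coefficients, conjugating the argument is the transpose of X ↦ ψ(z)⁻¹Xψ(z). Unipotence
thereby passes from coefficient functions to the endomorphisms ψ(g). -/
theorem coeffMap_conjEnd_pow (ψ : H →* End ℂ V) (z : H) (k : ℕ) (L : Dual ℂ (End ℂ V)) :
    ((conjFun H z - 1) ^ k) (coeffMap ψ L) =
      coeffMap ψ (L ∘ₗ ((conjEnd (ψ z⁻¹) (ψ z) - 1) ^ k : End ℂ (End ℂ V))) := by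
  induction k generalizing L with
  | zero => rfl
  | succ k ih =>
    rw [pow_succ, Module.End.mul_apply, LinearMap.sub_apply, conjFun_coeffMap, Module.End.one_apply,
      ← map_sub, ih, pow_succ']
    have : ∀ X : End ℂ V, (L ∘ₗ conjEnd (ψ z⁻¹) (ψ z) - L) X =
        L ((conjEnd (ψ z⁻¹) (ψ z) - 1) X) := fun X => (map_sub L _ _).symm
    ext g
    exact this _

/-- If `ad M` is nilpotent on `X`, then `X` preserves the generalised eigenspaces of `M`. -/
theorem mem_maxGenEigenspace_of_ad_pow_eq_zero {M X : End ℂ V} {N : ℕ}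
    (h : ((LinearMap.mulLeft ℂ M - LinearMap.mulRight ℂ M : End ℂ (End ℂ V)) ^ N) X = 0)
    {c : ℂ} {v : V} (hv : v ∈ M.maxGenEigenspace c) : X v ∈ M.maxGenEigenspace c := by
  rw [Module.End.mem_maxGenEigenspace] at hv ⊢
  obtain ⟨K, hK⟩ := hv
  refine ⟨N + K, ?_⟩
  set A : End ℂ (End ℂ V) := LinearMap.mulLeft ℂ M - LinearMap.mulRight ℂ M
  set R : End ℂ (End ℂ V) := LinearMap.mulRight ℂ (M - c • 1)
  -- Left multiplication by M - c is ad M plus right multiplication by M - c, and the two commute.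
  -- In the binomial expansion of the power `N + K`, the terms with at least `N` factors ad M kill
  -- X, and the others contain at least `K` factors M - c applied to v.
  have hAR : LinearMap.mulLeft ℂ (M - c • 1) = A + R := by
    ext1 Y
    change (M - c • 1) * Y = (M * Y - Y * M) + Y * (M - c • 1)
    simp only [sub_mul, mul_sub, smul_mul_assoc, mul_smul_comm, one_mul, mul_one]
    abel
  have hcomm : Commute A R := by
    ext1 Y
    change M * (Y * (M - c • 1)) - (Y * (M - c • 1)) * M = (M * Y - Y * M) * (M - c • 1)
    simp only [mul_sub, sub_mul, smul_mul_assoc, mul_smul_comm, mul_one, mul_assoc, smul_sub]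
    abel
  have h1 : ((M - c • 1) ^ (N + K)) (X v) = (((A + R) ^ (N + K)) X) v := by
    rw [← hAR, LinearMap.pow_mulLeft]
    rfl
  rw [h1, hcomm.add_pow']
  simp only [LinearMap.sum_apply, LinearMap.smul_apply]
  refine Finset.sum_eq_zero fun ⟨i, j⟩ hij => ?_
  have hij' := Finset.HasAntidiagonal.mem_antidiagonal.1 hij
  suffices ((A ^ i * R ^ j) X) v = 0 by rw [this, smul_zero]
  by_cases hi : N ≤ i
  · rw [(hcomm.pow_pow i j).eq, Module.End.mul_apply, Module.End.pow_map_zero_of_le hi h, map_zero]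
    rfl
  · have hj : K ≤ j := by simp only at hij'; omega
    rw [(hcomm.pow_pow i j).eq, Module.End.mul_apply, LinearMap.pow_mulRight]
    change ((A ^ i) X) (((M - c • 1) ^ j) v) = 0
    rw [Module.End.pow_map_zero_of_le hj hK, map_zero]

/-- The step of the induction on the nilpotency class. -/
theorem mem_maxGenEigenspace_of_conjCoeff [PreconnectedSpace H] {ψ : H →* End ℂ V}
    (z : H) (htop : (conjCoeff ψ z).maxGenEigenspace 1 = ⊤)
    (c : ℂ) (g : H) {v : V} (hv : v ∈ (ψ z).maxGenEigenspace c) :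
    ψ g v ∈ (ψ z).maxGenEigenspace c := by
  set C := conjEnd (ψ z⁻¹) (ψ z) with hC
  -- `C - 1` is nilpotent on `ψ g`
  obtain ⟨N, hN⟩ : ∃ N : ℕ, ∀ f : coeffSpace ψ, ((conjCoeff ψ z - 1) ^ N) f = 0 := by
    refine ⟨finrank ℂ (coeffSpace ψ), fun f => ?_⟩
    have hf : f ∈ (conjCoeff ψ z).maxGenEigenspace 1 := htop ▸ Submodule.mem_top
    rw [Module.End.maxGenEigenspace_eq_genEigenspace_finrank, Module.End.mem_genEigenspace_nat,
      one_smul] at hf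
    exact hf
  have hC0 : ((C - 1) ^ N) (ψ g) = 0 := by
    refine (Module.forall_dual_apply_eq_zero_iff ℂ _).1 fun L => ?_
    have h1 := congrFun (coeffMap_conjEnd_pow ψ z N L) g
    have h2 : ∀ (k : ℕ) (f : coeffSpace ψ), (((conjCoeff ψ z - 1) ^ k) f : H → ℂ) =
        ((conjFun H z - 1) ^ k) (f : H → ℂ) := by
      intro k
      induction k with
      | zero => intro f; rfl
      | succ k ih => intro f; rw [pow_succ, Module.End.mul_apply, ih, pow_succ]; rfl
    have h3 := h2 N ⟨coeffMap ψ L, L, rfl⟩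
    rw [hN] at h3
    change ((conjFun H z - 1) ^ N) (coeffMap ψ L) g = L (((C - 1) ^ N) (ψ g)) at h1
    rw [← h1, ← h3]
    rfl
  -- hence `ad (ψ z)` is nilpotent on `ψ g`
  have hzz : ψ z * ψ z⁻¹ = 1 := by rw [← map_mul, mul_inv_cancel, map_one]
  -- ad ψ(z) is `C - 1` composed with a left multiplication commuting with it, so the `N`-th power
  -- still kills ψ(g).
  have had : LinearMap.mulLeft ℂ (ψ z) - LinearMap.mulRight ℂ (ψ z) =
      LinearMap.mulLeft ℂ (-ψ z) * (C - 1) := by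
    ext1 X
    change ψ z * X - X * ψ z = -ψ z * (ψ z⁻¹ * (X * ψ z) - X)
    rw [mul_sub, ← mul_assoc (-ψ z) (ψ z⁻¹), neg_mul, hzz, neg_mul, neg_mul, one_mul]
    abel
  have hcomm : Commute (LinearMap.mulLeft ℂ (-ψ z)) (C - 1) := by
    refine Commute.sub_right ?_ (Commute.one_right _)
    ext1 X
    change -ψ z * (ψ z⁻¹ * (X * ψ z)) = ψ z⁻¹ * ((-ψ z * X) * ψ z)
    rw [neg_mul, neg_mul, neg_mul, mul_neg, ← mul_assoc (ψ z), hzz, mul_assoc (ψ z) X, ← mul_assoc (ψ z⁻¹), ← map_mul ψ z⁻¹ z,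
      inv_mul_cancel, map_one]
  refine mem_maxGenEigenspace_of_ad_pow_eq_zero (N := N) ?_ hv
  rw [had, hcomm.mul_pow, Module.End.mul_apply, hC0, map_zero]

/-- The coefficient space consists of functions on `H`, so the induction has to stay in the universe
of `H`. A representation in another universe is reached by one further step of the same kind. -/
theorem mem_maxGenEigenspace_of_lowerCentralSeries_small [PreconnectedSpace H] (n : ℕ) :
    ∀ {V : Type u} [AddCommGroup V] [Module ℂ V] [FiniteDimensional ℂ V] {ψ : H →* End ℂ V},
    CoeffContinuous ψ → (∀ g ∈ (⊤ : Subgroup H).lowerCentralSeries n, ψ g = 1) →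
    ∀ (z : H) (c : ℂ) (g : H), ∀ v ∈ (ψ z).maxGenEigenspace c,
      ψ g v ∈ (ψ z).maxGenEigenspace c := by
  induction n with
  | zero =>
    intro V _ _ _ ψ _ h1 z c g v hv
    rw [h1 g trivial]
    exact hv
  | succ n ih =>
    intro V _ _ _ ψ hc h1 z c g v hv
    exact mem_maxGenEigenspace_of_conjCoeff z
      (maxGenEigenspace_conjCoeff_eq_top hc (fun g hg => conjCoeff_eq_one h1 hg) z
        (ih (coeffContinuous_conjCoeff hc) (fun g hg => conjCoeff_eq_one h1 hg) z)) c g hv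

/-- The generalised eigenspaces of the elements of a connected nilpotent group are stable under
the group. -/
theorem mem_maxGenEigenspace_of_isNilpotent [PreconnectedSpace H] [Group.IsNilpotent H]
    {ψ : H →* End ℂ V} (hc : CoeffContinuous ψ) (z : H) (c : ℂ) (g : H) {v : V}
    (hv : v ∈ (ψ z).maxGenEigenspace c) : ψ g v ∈ (ψ z).maxGenEigenspace c := by
  obtain ⟨n, hn⟩ := Subgroup.nilpotent_iff_lowerCentralSeries.1 ‹Group.IsNilpotent H›
  have h1 : ∀ g ∈ (⊤ : Subgroup H).lowerCentralSeries (n + 1), ψ g = 1 := by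
    intro g hg
    have hg' := Subgroup.lowerCentralSeries_antitone (⊤ : Subgroup H) (Nat.le_succ n) hg
    rw [hn, Subgroup.mem_bot] at hg'
    rw [hg', map_one]
  exact mem_maxGenEigenspace_of_conjCoeff z
    (maxGenEigenspace_conjCoeff_eq_top hc (fun g hg => conjCoeff_eq_one h1 hg) z
      (mem_maxGenEigenspace_of_lowerCentralSeries_small n (coeffContinuous_conjCoeff hc)
        (fun g hg => conjCoeff_eq_one h1 hg) z)) c g hv

end ConnectedGroups
end SolvCoh
end

set_option linter.style.haveILetI false
noncomputable section
namespace SolvCoh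

/-! ### First derivatives of translations and conjugations, in the chart at 1. -/

section LieCalculus

open Filter Topology

variable {𝕜 : Type*} [RCLike 𝕜]
  {E : Type*} [NormedAddCommGroup E] [NormedSpace 𝕜 E]
  {G : Type*} [TopologicalSpace G] [ChartedSpace E G] [Group G]

variable (𝕜 E G) in
/-- The multiplication of `G` in the preferred chart at `1`. -/
def chartMul (p : E × E) : E :=
  extChartAt 𝓘(𝕜, E) (1 : G)
    ((extChartAt 𝓘(𝕜, E) (1 : G)).symm p.1 * (extChartAt 𝓘(𝕜, E) (1 : G)).symm p.2)

variable (𝕜 E G) in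
/-- The coordinates of `1` in the preferred chart at `1`. -/
def chartOne : E := extChartAt 𝓘(𝕜, E) (1 : G) 1

variable (𝕜 E G) in
theorem extChartAt_symm_chartOne :
    (extChartAt 𝓘(𝕜, E) (1 : G)).symm (chartOne 𝕜 E G) = 1 :=
  extChartAt_to_inv (I := 𝓘(𝕜, E)) (1 : G)

variable (𝕜 E G) in
theorem chartOne_mem : chartOne 𝕜 E G ∈ (extChartAt 𝓘(𝕜, E) (1 : G)).target :=
  mem_extChartAt_target (I := 𝓘(𝕜, E)) (1 : G)

variable [LieGroup 𝓘(𝕜, E) ∞ G]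

theorem contMDiffAt_extChartAt_symm {x : E} (hx : x ∈ (extChartAt 𝓘(𝕜, E) (1 : G)).target) :
    ContMDiffAt 𝓘(𝕜, E) 𝓘(𝕜, E) ∞ (extChartAt 𝓘(𝕜, E) (1 : G)).symm x := by
  have := contMDiffOn_extChartAt_symm (I := 𝓘(𝕜, E)) (n := ∞) (1 : G)
  exact this.contMDiffAt ((isOpen_extChartAt_target (I := 𝓘(𝕜, E)) (1 : G)).mem_nhds hx)

variable (𝕜 E G) in
theorem contDiffAt_chartMul :
    ContDiffAt 𝕜 ∞ (chartMul 𝕜 E G) (chartOne 𝕜 E G, chartOne 𝕜 E G) := by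
  rw [← contMDiffAt_iff_contDiffAt]
  have h1 : ContMDiffAt 𝓘(𝕜, E × E) 𝓘(𝕜, E) ∞
      (fun p : E × E => (extChartAt 𝓘(𝕜, E) (1 : G)).symm p.1 *
        (extChartAt 𝓘(𝕜, E) (1 : G)).symm p.2) (chartOne 𝕜 E G, chartOne 𝕜 E G) := by
    refine ContMDiffAt.mul ?_ ?_
    · exact (contMDiffAt_extChartAt_symm (chartOne_mem 𝕜 E G)).comp
        (chartOne 𝕜 E G, chartOne 𝕜 E G) contDiffAt_fst.contMDiffAt
    · exact (contMDiffAt_extChartAt_symm (chartOne_mem 𝕜 E G)).comp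
        (chartOne 𝕜 E G, chartOne 𝕜 E G) contDiffAt_snd.contMDiffAt
  refine ContMDiffAt.comp (chartOne 𝕜 E G, chartOne 𝕜 E G) (I' := 𝓘(𝕜, E))
    (g := extChartAt 𝓘(𝕜, E) (1 : G)) ?_ h1
  have : ((extChartAt 𝓘(𝕜, E) (1 : G)).symm (chartOne 𝕜 E G, chartOne 𝕜 E G).1 *
        (extChartAt 𝓘(𝕜, E) (1 : G)).symm (chartOne 𝕜 E G, chartOne 𝕜 E G).2) = 1 := by
    simp only [extChartAt_symm_chartOne, mul_one]
  rw [this]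
  exact contMDiffAt_extChartAt

variable (G) in
-- The tangent space at 1 is identified with `E` by this very chart, so no coordinate change appears
-- when passing between G and `E` at 1.
theorem hasMFDerivAt_extChartAt_one :
    HasMFDerivAt 𝓘(𝕜, E) 𝓘(𝕜, E) (extChartAt 𝓘(𝕜, E) (1 : G)) (1 : G)
      (ContinuousLinearMap.id 𝕜 E) := by
  have h : MDifferentiableAt 𝓘(𝕜, E) 𝓘(𝕜, E) (extChartAt 𝓘(𝕜, E) (1 : G)) (1 : G) :=
    (contMDiffAt_extChartAt (n := ∞)).mdifferentiableAt (by simp)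
  have h1 := h.hasMFDerivAt
  have : IsManifold 𝓘(𝕜, E) 1 G := IsManifold.of_le (n := ∞) (by exact_mod_cast le_top)
  rwa [mfderiv_extChartAt_self] at h1

variable (G) in
theorem hasMFDerivAt_extChartAt_symm_one :
    HasMFDerivAt 𝓘(𝕜, E) 𝓘(𝕜, E) (extChartAt 𝓘(𝕜, E) (1 : G)).symm (chartOne 𝕜 E G)
      (ContinuousLinearMap.id 𝕜 E) := by
  have h := (contMDiffAt_extChartAt_symm (chartOne_mem 𝕜 E G)).mdifferentiableAt (by simp)
  have h1 := h.hasMFDerivAt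
  have : IsManifold 𝓘(𝕜, E) 1 G := IsManifold.of_le (n := ∞) (by exact_mod_cast le_top)
  have h2 := mfderivWithin_range_extChartAt_symm (I := 𝓘(𝕜, E)) (x := (1 : G))
  simp only [modelWithCornersSelf_coe, Set.range_id, mfderivWithin_univ] at h2
  have h3 : mfderiv 𝓘(𝕜, E) 𝓘(𝕜, E) (extChartAt 𝓘(𝕜, E) (1 : G)).symm (chartOne 𝕜 E G) =
    ContinuousLinearMap.id 𝕜 E := h2
  rwa [h3] at h1

theorem hasMFDerivAt_mul_left (g h : G) :
    HasMFDerivAt 𝓘(𝕜, E) 𝓘(𝕜, E) (fun x : G => g * x) h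
      (mfderiv 𝓘(𝕜, E) 𝓘(𝕜, E) (fun x : G => g * x) h) :=
  ((contMDiff_mul_left (I := 𝓘(𝕜, E)) (n := ∞) (a := g)).mdifferentiable (by simp)
    h).hasMFDerivAt

theorem hasMFDerivAt_mul_right (g h : G) :
    HasMFDerivAt 𝓘(𝕜, E) 𝓘(𝕜, E) (fun x : G => x * g) h
      (mfderiv 𝓘(𝕜, E) 𝓘(𝕜, E) (fun x : G => x * g) h) :=
  ((contMDiff_mul_right (I := 𝓘(𝕜, E)) (n := ∞) (a := g)).mdifferentiable (by simp)
    h).hasMFDerivAt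

theorem hasMFDerivAt_conj (g h : G) :
    HasMFDerivAt 𝓘(𝕜, E) 𝓘(𝕜, E) (fun x : G => g * x * g⁻¹) h
      (mfderiv 𝓘(𝕜, E) 𝓘(𝕜, E) (fun x : G => g * x * g⁻¹) h) :=
  (((contMDiff_mul_right (I := 𝓘(𝕜, E)) (n := ∞) (a := g⁻¹)).comp
    (contMDiff_mul_left (I := 𝓘(𝕜, E)) (n := ∞) (a := g))).mdifferentiable (by simp)
    h).hasMFDerivAt

variable (𝕜 E) in
/-- The adjoint representation, as a continuous linear endomorphism of the model space. -/
def adL (g : G) : E →L[𝕜] E :=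
  mfderiv 𝓘(𝕜, E) 𝓘(𝕜, E) (fun x : G => g * x * g⁻¹) (1 : G)

theorem hasMFDerivAt_conj_one (g : G) :
    HasMFDerivAt 𝓘(𝕜, E) 𝓘(𝕜, E) (fun x : G => g * x * g⁻¹) (1 : G) (adL 𝕜 E g) :=
  hasMFDerivAt_conj g 1

theorem adL_one : adL 𝕜 E (1 : G) = ContinuousLinearMap.id 𝕜 E := by
  have : (fun x : G => (1 : G) * x * 1⁻¹) = id := by ext; simp
  rw [adL, this]
  exact mfderiv_id

theorem adL_mul (g h : G) : adL 𝕜 E (g * h) = (adL 𝕜 E g).comp (adL 𝕜 E h) := by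
  have h1 := hasMFDerivAt_conj_one (𝕜 := 𝕜) (E := E) h
  have h2 : HasMFDerivAt 𝓘(𝕜, E) 𝓘(𝕜, E) (fun x : G => g * x * g⁻¹) (h * 1 * h⁻¹)
      (adL 𝕜 E g) := by
    have : h * 1 * h⁻¹ = 1 := by group
    rw [this]; exact hasMFDerivAt_conj_one g
  have h3 := HasMFDerivAt.comp (1 : G) h2 h1
  have h4 : ((fun x : G => g * x * g⁻¹) ∘ fun x => h * x * h⁻¹) =
      fun x => (g * h) * x * (g * h)⁻¹ := by
    ext x; simp only [Function.comp, mul_inv_rev]; group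
  rw [h4] at h3
  exact (hasMFDerivAt_conj_one (g * h)).mfderiv.symm.trans h3.mfderiv

/-- Left translation, in coordinates at the source. -/
theorem mfderiv_symm_comp_fderiv_chartMul_inr {x : E}
    (hx : x ∈ (extChartAt 𝓘(𝕜, E) (1 : G)).target)
    (hd : DifferentiableAt 𝕜 (chartMul 𝕜 E G) (x, chartOne 𝕜 E G)) :
    (show E →L[𝕜] E from mfderiv 𝓘(𝕜, E) 𝓘(𝕜, E) (extChartAt 𝓘(𝕜, E) (1 : G)).symm x).comp
      ((fderiv 𝕜 (chartMul 𝕜 E G) (x, chartOne 𝕜 E G)).comp (ContinuousLinearMap.inr 𝕜 E E)) =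
    (mfderiv 𝓘(𝕜, E) 𝓘(𝕜, E)
      (fun h : G => (extChartAt 𝓘(𝕜, E) (1 : G)).symm x * h) (1 : G) : E →L[𝕜] E) := by
  set φ := extChartAt 𝓘(𝕜, E) (1 : G) with hφ
  set e := chartOne 𝕜 E G with he
  have hxe : chartMul 𝕜 E G (x, e) = x := by
    simp only [chartMul, he, extChartAt_symm_chartOne, mul_one]
    exact φ.right_inv hx
  have h1 : HasMFDerivAt 𝓘(𝕜, E) 𝓘(𝕜, E) (fun y : E => φ.symm x * φ.symm y) e
      (mfderiv 𝓘(𝕜, E) 𝓘(𝕜, E) (fun h : G => φ.symm x * h) (1 : G) : E →L[𝕜] E) := by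
    have a := hasMFDerivAt_mul_left (𝕜 := 𝕜) (E := E) (φ.symm x) (φ.symm e)
    have b := HasMFDerivAt.comp e a (hasMFDerivAt_extChartAt_symm_one (𝕜 := 𝕜) G)
    have c : φ.symm e = 1 := extChartAt_symm_chartOne 𝕜 E G
    rw [c] at b
    exact b
  have h2 : HasFDerivAt (fun y : E => chartMul 𝕜 E G (x, y))
      ((fderiv 𝕜 (chartMul 𝕜 E G) (x, e)).comp (ContinuousLinearMap.inr 𝕜 E E)) e := by
    have := hd.hasFDerivAt
    exact HasFDerivAt.comp e this (hasFDerivAt_prodMk_right x e)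
  have h3 : HasMFDerivAt 𝓘(𝕜, E) 𝓘(𝕜, E) φ.symm (chartMul 𝕜 E G (x, e))
      (mfderiv 𝓘(𝕜, E) 𝓘(𝕜, E) φ.symm x) := by
    rw [hxe]
    exact ((contMDiffAt_extChartAt_symm hx).mdifferentiableAt (by simp)).hasMFDerivAt
  have h4 := HasMFDerivAt.comp (f := fun y : E => chartMul 𝕜 E G (x, y)) e h3 h2.hasMFDerivAt
  have h5 : (fun y : E => φ.symm x * φ.symm y) =ᶠ[𝓝 e]
      φ.symm ∘ fun y : E => chartMul 𝕜 E G (x, y) := by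
    have : ContinuousAt (fun y : E => φ.symm x * φ.symm y) e := h1.continuousAt
    have hm : φ.source ∈ 𝓝 (φ.symm x * φ.symm e) := by
      rw [extChartAt_symm_chartOne, mul_one]
      exact (isOpen_extChartAt_source (I := 𝓘(𝕜, E)) (1 : G)).mem_nhds (φ.map_target hx)
    filter_upwards [this hm] with y hy
    exact (φ.left_inv hy).symm
  exact (h4.congr_of_eventuallyEq h5).mfderiv.symm.trans h1.mfderiv

/-- Right translation, in coordinates at the source. -/
theorem mfderiv_symm_comp_fderiv_chartMul_inl {x : E}
    (hx : x ∈ (extChartAt 𝓘(𝕜, E) (1 : G)).target)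
    (hd : DifferentiableAt 𝕜 (chartMul 𝕜 E G) (chartOne 𝕜 E G, x)) :
    (show E →L[𝕜] E from mfderiv 𝓘(𝕜, E) 𝓘(𝕜, E) (extChartAt 𝓘(𝕜, E) (1 : G)).symm x).comp
      ((fderiv 𝕜 (chartMul 𝕜 E G) (chartOne 𝕜 E G, x)).comp (ContinuousLinearMap.inl 𝕜 E E)) =
    (mfderiv 𝓘(𝕜, E) 𝓘(𝕜, E)
      (fun h : G => h * (extChartAt 𝓘(𝕜, E) (1 : G)).symm x) (1 : G) : E →L[𝕜] E) := by
  set φ := extChartAt 𝓘(𝕜, E) (1 : G) with hφ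
  set e := chartOne 𝕜 E G with he
  have hxe : chartMul 𝕜 E G (e, x) = x := by
    simp only [chartMul, he, extChartAt_symm_chartOne, one_mul]
    exact φ.right_inv hx
  have h1 : HasMFDerivAt 𝓘(𝕜, E) 𝓘(𝕜, E) (fun y : E => φ.symm y * φ.symm x) e
      (mfderiv 𝓘(𝕜, E) 𝓘(𝕜, E) (fun h : G => h * φ.symm x) (1 : G) : E →L[𝕜] E) := by
    have a := hasMFDerivAt_mul_right (𝕜 := 𝕜) (E := E) (φ.symm x) (φ.symm e)
    have b := HasMFDerivAt.comp e a (hasMFDerivAt_extChartAt_symm_one (𝕜 := 𝕜) G)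
    have c : φ.symm e = 1 := extChartAt_symm_chartOne 𝕜 E G
    rw [c] at b
    exact b
  have h2 : HasFDerivAt (fun y : E => chartMul 𝕜 E G (y, x))
      ((fderiv 𝕜 (chartMul 𝕜 E G) (e, x)).comp (ContinuousLinearMap.inl 𝕜 E E)) e := by
    have := hd.hasFDerivAt
    exact HasFDerivAt.comp (f := fun y : E => (y, x)) e this (hasFDerivAt_prodMk_left e x)
  have h3 : HasMFDerivAt 𝓘(𝕜, E) 𝓘(𝕜, E) φ.symm (chartMul 𝕜 E G (e, x))
      (mfderiv 𝓘(𝕜, E) 𝓘(𝕜, E) φ.symm x) := by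
    rw [hxe]
    exact ((contMDiffAt_extChartAt_symm hx).mdifferentiableAt (by simp)).hasMFDerivAt
  have h4 := HasMFDerivAt.comp (f := fun y : E => chartMul 𝕜 E G (y, x)) e h3 h2.hasMFDerivAt
  have h5 : (fun y : E => φ.symm y * φ.symm x) =ᶠ[𝓝 e]
      φ.symm ∘ fun y : E => chartMul 𝕜 E G (y, x) := by
    have : ContinuousAt (fun y : E => φ.symm y * φ.symm x) e := h1.continuousAt
    have hm : φ.source ∈ 𝓝 (φ.symm e * φ.symm x) := by
      rw [extChartAt_symm_chartOne, one_mul]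
      exact (isOpen_extChartAt_source (I := 𝓘(𝕜, E)) (1 : G)).mem_nhds (φ.map_target hx)
    filter_upwards [this hm] with y hy
    exact (φ.left_inv hy).symm
  exact (h4.congr_of_eventuallyEq h5).mfderiv.symm.trans h1.mfderiv

/-- `L_g = R_g ∘ c_g`, infinitesimally. -/
theorem mfderiv_mul_left_eq (g : G) :
    (mfderiv 𝓘(𝕜, E) 𝓘(𝕜, E) (fun h : G => g * h) (1 : G) : E →L[𝕜] E) =
    (show E →L[𝕜] E from mfderiv 𝓘(𝕜, E) 𝓘(𝕜, E) (fun h : G => h * g) (1 : G)).comp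
      (adL 𝕜 E g) := by
  have h2 : HasMFDerivAt 𝓘(𝕜, E) 𝓘(𝕜, E) (fun x : G => x * g) (g * 1 * g⁻¹)
      (mfderiv 𝓘(𝕜, E) 𝓘(𝕜, E) (fun h : G => h * g) (1 : G) : E →L[𝕜] E) := by
    have : g * 1 * g⁻¹ = 1 := by group
    rw [this]; exact hasMFDerivAt_mul_right g 1
  have h3 := HasMFDerivAt.comp (1 : G) h2 (hasMFDerivAt_conj_one (𝕜 := 𝕜) (E := E) g)
  have h4 : ((fun x : G => x * g) ∘ fun x => g * x * g⁻¹) = fun x => g * x := by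
    ext x; simp
  rw [h4] at h3
  exact h3.mfderiv

end LieCalculus

/-! ### The bracket as the derivative of Ad, through the second derivative of multiplication. -/

section LieCalculus

open Filter Topology

variable {𝕜 : Type*} [RCLike 𝕜]
  {E : Type*} [NormedAddCommGroup E] [NormedSpace 𝕜 E]
  {G : Type*} [TopologicalSpace G] [ChartedSpace E G] [Group G]
  [LieGroup 𝓘(𝕜, E) ∞ G]

theorem two_le_smooth : (2 : WithTop ℕ∞) ≤ ∞ := by
  change ((2 : ℕ∞) : WithTop ℕ∞) ≤ ((⊤ : ℕ∞) : WithTop ℕ∞)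
  exact WithTop.coe_le_coe.2 le_top

variable (𝕜 E G) in
/-- The second derivative of the multiplication at `(1, 1)`, in the two variables separately. -/
def chartMulSecond : E × E →L[𝕜] E × E →L[𝕜] E :=
  fderiv 𝕜 (fderiv 𝕜 (chartMul 𝕜 E G)) (chartOne 𝕜 E G, chartOne 𝕜 E G)

variable (𝕜 E G) in
theorem hasFDerivAt_fderiv_chartMul :
    HasFDerivAt (fderiv 𝕜 (chartMul 𝕜 E G)) (chartMulSecond 𝕜 E G)
      (chartOne 𝕜 E G, chartOne 𝕜 E G) := by
  have h := (contDiffAt_chartMul 𝕜 E G).fderiv_right (m := 1)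
    (by rw [one_add_one_eq_two]; exact two_le_smooth)
  exact (h.differentiableAt (by simp)).hasFDerivAt

theorem chartMulSecond_comm (p q : E × E) :
    chartMulSecond 𝕜 E G p q = chartMulSecond 𝕜 E G q p := by
  have h := (contDiffAt_chartMul 𝕜 E G).isSymmSndFDerivAt
    (by rw [minSmoothness_of_isRCLikeNormedField]; exact two_le_smooth)
  exact h p q

variable (𝕜 E G) in
/-- The derivative at `1` of left translation by `x`, in the chart at `1`. -/
def chartLeft (x : E) : E →L[𝕜] E :=
  (fderiv 𝕜 (chartMul 𝕜 E G) (x, chartOne 𝕜 E G)).comp (ContinuousLinearMap.inr 𝕜 E E)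

variable (𝕜 E G) in
/-- The derivative at `1` of right translation by `x`, in the chart at `1`. -/
def chartRight (x : E) : E →L[𝕜] E :=
  (fderiv 𝕜 (chartMul 𝕜 E G) (chartOne 𝕜 E G, x)).comp (ContinuousLinearMap.inl 𝕜 E E)

variable (𝕜 E G) in
/-- The mixed second derivative of the multiplication at `(1, 1)`. -/
def chartMixed : E →L[𝕜] E →L[𝕜] E :=
  ((ContinuousLinearMap.compL 𝕜 E (E × E) E).flip (ContinuousLinearMap.inr 𝕜 E E)).comp
    ((chartMulSecond 𝕜 E G).comp (ContinuousLinearMap.inl 𝕜 E E))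

variable (𝕜 E G) in
theorem hasFDerivAt_chartLeft :
    HasFDerivAt (chartLeft 𝕜 E G) (chartMixed 𝕜 E G) (chartOne 𝕜 E G) := by
  have h := HasFDerivAt.comp (f := fun x : E => (x, chartOne 𝕜 E G)) (chartOne 𝕜 E G)
    (hasFDerivAt_fderiv_chartMul 𝕜 E G) (hasFDerivAt_prodMk_left _ _)
  exact ((ContinuousLinearMap.compL 𝕜 E (E × E) E).flip
    (ContinuousLinearMap.inr 𝕜 E E)).hasFDerivAt.comp _ h

variable (𝕜 E G) in
theorem hasFDerivAt_chartRight :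
    HasFDerivAt (chartRight 𝕜 E G) (chartMixed 𝕜 E G).flip (chartOne 𝕜 E G) := by
  have h := HasFDerivAt.comp (f := fun x : E => (chartOne 𝕜 E G, x)) (chartOne 𝕜 E G)
    (hasFDerivAt_fderiv_chartMul 𝕜 E G) (hasFDerivAt_prodMk_right _ _)
  have h2 := ((ContinuousLinearMap.compL 𝕜 E (E × E) E).flip
    (ContinuousLinearMap.inl 𝕜 E E)).hasFDerivAt.comp _ h
  convert! h2 using 1
  ext v w
  -- Differentiating in the other order gives the flipped mixed derivative, by symmetry of the
  -- second derivative.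
  change chartMulSecond 𝕜 E G (w, 0) (0, v) = chartMulSecond 𝕜 E G (0, v) (w, 0)
  rw [chartMulSecond_comm]

variable (𝕜 E G) in
theorem eventually_chartMul_differentiableAt :
    ∀ᶠ x in 𝓝 (chartOne 𝕜 E G), x ∈ (extChartAt 𝓘(𝕜, E) (1 : G)).target ∧
      DifferentiableAt 𝕜 (chartMul 𝕜 E G) (x, chartOne 𝕜 E G) ∧
      DifferentiableAt 𝕜 (chartMul 𝕜 E G) (chartOne 𝕜 E G, x) := by
  have h : ∀ᶠ p in 𝓝 (chartOne 𝕜 E G, chartOne 𝕜 E G),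
      DifferentiableAt 𝕜 (chartMul 𝕜 E G) p := by
    have := ((contDiffAt_chartMul 𝕜 E G).of_le (m := 1) (by exact_mod_cast le_top)).eventually
      (by simp)
    filter_upwards [this] with p hp using hp.differentiableAt (by simp)
  have h1 : Tendsto (fun x : E => (x, chartOne 𝕜 E G)) (𝓝 (chartOne 𝕜 E G))
      (𝓝 (chartOne 𝕜 E G, chartOne 𝕜 E G)) := by
    exact Continuous.tendsto (by fun_prop) _
  have h2 : Tendsto (fun x : E => (chartOne 𝕜 E G, x)) (𝓝 (chartOne 𝕜 E G))
      (𝓝 (chartOne 𝕜 E G, chartOne 𝕜 E G)) := by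
    exact Continuous.tendsto (by fun_prop) _
  filter_upwards [(isOpen_extChartAt_target (I := 𝓘(𝕜, E)) (1 : G)).mem_nhds (chartOne_mem 𝕜 E G),
    h1.eventually h, h2.eventually h] with x a b c using ⟨a, b, c⟩

theorem isInvertible_mfderiv_symm {x : E} (hx : x ∈ (extChartAt 𝓘(𝕜, E) (1 : G)).target) :
    (show E →L[𝕜] E from
      mfderiv 𝓘(𝕜, E) 𝓘(𝕜, E) (extChartAt 𝓘(𝕜, E) (1 : G)).symm x).IsInvertible := by
  have : IsManifold 𝓘(𝕜, E) 1 G := IsManifold.of_le (n := ∞) (by exact_mod_cast le_top)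
  have h := isInvertible_mfderivWithin_extChartAt_symm (I := 𝓘(𝕜, E)) hx
  simp only [modelWithCornersSelf_coe, Set.range_id, mfderivWithin_univ] at h
  exact h

variable (𝕜 E G) in
-- L_x = R_x ∘ c_x, where c_x is conjugation by x, is differentiated at 1 and read in the chart; the
-- invertible derivative of the inverse chart cancels.
theorem eventually_chartLeft_eq :
    ∀ᶠ x in 𝓝 (chartOne 𝕜 E G), chartLeft 𝕜 E G x =
      (chartRight 𝕜 E G x).comp (adL 𝕜 E ((extChartAt 𝓘(𝕜, E) (1 : G)).symm x)) := by
  filter_upwards [eventually_chartMul_differentiableAt 𝕜 E G] with x ⟨hx, h1, h2⟩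
  have a := mfderiv_symm_comp_fderiv_chartMul_inr hx h1
  have b := mfderiv_symm_comp_fderiv_chartMul_inl hx h2
  rw [mfderiv_mul_left_eq, ← b] at a
  obtain ⟨M, hM⟩ := isInvertible_mfderiv_symm (G := G) hx
  rw [← hM] at a
  ext v
  apply M.injective
  exact congrArg (fun f : E →L[𝕜] E => f v) a

variable (𝕜 E G) in
theorem chartLeft_chartOne : chartLeft 𝕜 E G (chartOne 𝕜 E G) = ContinuousLinearMap.id 𝕜 E := by
  have h := (eventually_chartMul_differentiableAt 𝕜 E G).self_of_nhds
  have a := mfderiv_symm_comp_fderiv_chartMul_inr h.1 h.2.1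
  have e1 : (fun h : G => (extChartAt 𝓘(𝕜, E) (1 : G)).symm (chartOne 𝕜 E G) * h) = id := by
    ext h; rw [extChartAt_symm_chartOne, one_mul]; rfl
  rw [e1, mfderiv_id] at a
  have e2 := (hasMFDerivAt_extChartAt_symm_one (𝕜 := 𝕜) (E := E) G).mfderiv
  rw [e2] at a
  exact a

variable (𝕜 E G) in
theorem chartRight_chartOne :
    chartRight 𝕜 E G (chartOne 𝕜 E G) = ContinuousLinearMap.id 𝕜 E := by
  have a := (eventually_chartLeft_eq 𝕜 E G).self_of_nhds
  rw [chartLeft_chartOne, extChartAt_symm_chartOne, adL_one] at a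
  exact a.symm

variable [CompleteSpace E]

variable (𝕜 E G) in
-- Near 1 one has Ad = R⁻¹L, with R and L both the identity at 1. The product rule leaves the
-- derivative of L minus that of R, which are the mixed derivative and its flip.
theorem hasFDerivAt_adL_chart :
    HasFDerivAt (fun x => adL 𝕜 E ((extChartAt 𝓘(𝕜, E) (1 : G)).symm x))
      (chartMixed 𝕜 E G - (chartMixed 𝕜 E G).flip) (chartOne 𝕜 E G) := by
  have hR := hasFDerivAt_chartRight 𝕜 E G
  have hL := hasFDerivAt_chartLeft 𝕜 E G
  have hone := chartRight_chartOne 𝕜 E G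
  -- the inverse of `chartRight`
  have hinv : HasFDerivAt (fun x => Ring.inverse (chartRight 𝕜 E G x))
      (-(chartMixed 𝕜 E G).flip) (chartOne 𝕜 E G) := by
    have h1 := hasFDerivAt_ringInverse (𝕜 := 𝕜) (1 : (E →L[𝕜] E)ˣ)
    have h2 : HasFDerivAt (Ring.inverse (M₀ := E →L[𝕜] E))
      (-ContinuousLinearMap.mulLeftRight 𝕜 (E →L[𝕜] E) ↑(1 : (E →L[𝕜] E)ˣ)⁻¹ ↑(1 : (E →L[𝕜] E)ˣ)⁻¹)
      (chartRight 𝕜 E G (chartOne 𝕜 E G)) := by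
      rw [hone]; exact h1
    have h3 := h2.comp _ hR
    convert! h3 using 1
  have hmul := hinv.mul' hL
  have hev : (fun x => adL 𝕜 E ((extChartAt 𝓘(𝕜, E) (1 : G)).symm x)) =ᶠ[𝓝 (chartOne 𝕜 E G)]
      fun x => Ring.inverse (chartRight 𝕜 E G x) * chartLeft 𝕜 E G x := by
    have hu : ∀ᶠ x in 𝓝 (chartOne 𝕜 E G), IsUnit (chartRight 𝕜 E G x) := by
      refine hR.continuousAt.eventually (Units.isOpen.mem_nhds ?_)
      rw [hone]; exact isUnit_one
    filter_upwards [eventually_chartLeft_eq 𝕜 E G, hu] with x hx hx'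
    rw [hx]
    exact (Ring.inverse_mul_cancel_left _ _ hx').symm
  refine (hmul.congr_of_eventuallyEq hev).congr_fderiv ?_
  have hval : Ring.inverse (chartRight 𝕜 E G (chartOne 𝕜 E G)) = 1 := by
    rw [hone]; exact Ring.inverse_one _
  ext v w
  change Ring.inverse (chartRight 𝕜 E G (chartOne 𝕜 E G)) (chartMixed 𝕜 E G v w) +
    (-(chartMixed 𝕜 E G).flip v) (chartLeft 𝕜 E G (chartOne 𝕜 E G) w) = _
  rw [hval, chartLeft_chartOne]
  simp [sub_eq_add_neg]

variable (G) in
theorem hasMFDerivAt_adL_one :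
    HasMFDerivAt 𝓘(𝕜, E) 𝓘(𝕜, E →L[𝕜] E) (fun g : G => adL 𝕜 E g) (1 : G)
      (chartMixed 𝕜 E G - (chartMixed 𝕜 E G).flip) := by
  have h := HasMFDerivAt.comp (1 : G) (hasFDerivAt_adL_chart 𝕜 E G).hasMFDerivAt
    (hasMFDerivAt_extChartAt_one (𝕜 := 𝕜) G)
  refine HasMFDerivAt.congr_of_eventuallyEq h ?_
  have := extChartAt_source_mem_nhds (I := 𝓘(𝕜, E)) (1 : G)
  filter_upwards [this] with g hg
  simp only [Function.comp]
  rw [(extChartAt 𝓘(𝕜, E) (1 : G)).left_inv hg]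

/-- In the chart the invariant vector field of v is x ↦ `chartLeft x v`, whose derivative at 1 is
the mixed second derivative. The bracket of vector fields is then the derivative of Ad found in
`hasMFDerivAt_adL_one`. -/
theorem bracket_eq_chartMixed (v w : GroupLieAlgebra 𝓘(𝕜, E) G) :
    (⁅v, w⁆ : GroupLieAlgebra 𝓘(𝕜, E) G) =
      (chartMixed 𝕜 E G (v : E) (w : E) - chartMixed 𝕜 E G (w : E) (v : E) : E) := by
  have : IsManifold 𝓘(𝕜, E) 1 G := IsManifold.of_le (n := ∞) (by exact_mod_cast le_top)
  have key : ∀ v : GroupLieAlgebra 𝓘(𝕜, E) G,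
      VectorField.mpullbackWithin 𝓘(𝕜, E) 𝓘(𝕜, E) (extChartAt 𝓘(𝕜, E) (1 : G)).symm
        (mulInvariantVectorField v) (Set.range 𝓘(𝕜, E)) =ᶠ[𝓝 (chartOne 𝕜 E G)]
        fun x => (chartLeft 𝕜 E G x (v : E) : E) := by
    intro v
    filter_upwards [eventually_chartMul_differentiableAt 𝕜 E G] with x ⟨hx, h1, h2⟩
    have a := mfderiv_symm_comp_fderiv_chartMul_inr hx h1
    obtain ⟨M, hM⟩ := isInvertible_mfderiv_symm (G := G) hx
    rw [VectorField.mpullbackWithin_apply]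
    simp only [modelWithCornersSelf_coe, Set.range_id, mfderivWithin_univ]
    have b : mulInvariantVectorField v ((extChartAt 𝓘(𝕜, E) (1 : G)).symm x) =
      (M (chartLeft 𝕜 E G x (v : E)) : E) := by
      rw [← hM] at a
      exact (congrArg (fun f : E →L[𝕜] E => f v) a).symm
    rw [b]
    have c : mfderiv 𝓘(𝕜, E) 𝓘(𝕜, E) (extChartAt 𝓘(𝕜, E) (1 : G)).symm x = (M : E →L[𝕜] E) :=
      hM.symm
    rw [c]
    have d : (M : E →L[𝕜] E).inverse = M.symm := ContinuousLinearMap.inverse_equiv M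
    exact (congrArg (fun f : E →L[𝕜] E => f (M (chartLeft 𝕜 E G x (v : E)))) d).trans
      (M.symm_apply_apply _)
  have fd : ∀ v : E, fderiv 𝕜 (fun x => chartLeft 𝕜 E G x v) (chartOne 𝕜 E G) =
      (chartMixed 𝕜 E G).flip v := by
    intro v
    exact ((hasFDerivAt_chartLeft 𝕜 E G).clm_apply (hasFDerivAt_const v _)).fderiv.trans
      (by ext; simp)
  have e1 := Filter.EventuallyEq.lieBracket_vectorField_eq (𝕜 := 𝕜) (key v) (key w)
  have e2 : ∀ v w : E, VectorField.lieBracket 𝕜 (fun x => (chartLeft 𝕜 E G x v : E))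
      (fun x => (chartLeft 𝕜 E G x w : E)) (chartOne 𝕜 E G) =
      chartMixed 𝕜 E G v w - chartMixed 𝕜 E G w v := by
    intro v w
    rw [VectorField.lieBracket, fd, fd, chartLeft_chartOne]
    rfl
  have e0 : (extChartAt 𝓘(𝕜, E) (1 : G)).symm ⁻¹' Set.univ ∩ Set.range 𝓘(𝕜, E) =
      (Set.univ : Set E) := by
    simp
  have e3 : ∀ (X Y : E → E) (s : Set E), s = Set.univ →
      VectorField.lieBracketWithin 𝕜 X Y s (chartOne 𝕜 E G) =
        VectorField.lieBracket 𝕜 X Y (chartOne 𝕜 E G) := by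
    rintro X Y s rfl
    rw [VectorField.lieBracketWithin_univ]
  have e4 : (show E →L[𝕜] E from
      mfderiv 𝓘(𝕜, E) 𝓘(𝕜, E) (extChartAt 𝓘(𝕜, E) (1 : G)) (1 : G)).inverse =
      ContinuousLinearMap.id 𝕜 E := by
    rw [(hasMFDerivAt_extChartAt_one (𝕜 := 𝕜) (E := E) G).mfderiv]
    exact ContinuousLinearMap.inverse_id
  exact congrArg₂ (fun (f : E →L[𝕜] E) (x : E) => f x) e4
    (((e3 _ _ _ e0).trans e1).trans (e2 v w))

end LieCalculus

/-! ### Cartan's formula for the Chevalley–Eilenberg differential. -/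

section CartanFormula

variable {𝕜 : Type*} [RCLike 𝕜] [NormedAlgebra 𝕜 ℂ]
  {L : Type*} [AddCommGroup L] [Module 𝕜 L]
  {V : Type*} [AddCommGroup V] [Module ℂ V] [Module 𝕜 V] [IsScalarTower 𝕜 ℂ V]

/-- Pull back a cochain along `A` and push its values forward along `T`. -/
def pullPush (T : Module.End ℂ V) (A : Module.End 𝕜 L) (p : ℕ) :
    Module.End ℂ (L [⋀^Fin p]→ₗ[𝕜] V) where
  toFun φ := (T.restrictScalars 𝕜).compAlternatingMap (φ.compLinearMap A)
  map_add' φ η := by ext; simp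
  map_smul' a φ := by ext; simp

theorem pullPush_apply (T : Module.End ℂ V) (A : Module.End 𝕜 L) (p : ℕ)
    (φ : L [⋀^Fin p]→ₗ[𝕜] V) (v : Fin p → L) :
    pullPush T A p φ v = T (φ fun i => A (v i)) := rfl

theorem pullPush_mul (T S : Module.End ℂ V) (A B : Module.End 𝕜 L) (p : ℕ) :
    pullPush (T * S) (B * A) p = pullPush T A p * pullPush S B p := rfl

theorem sum_ge_eq {n : ℕ} {M : Type*} [AddCommMonoid M] (i : Fin n) (f : Fin n → M) :
    ∑ j ≥ i, f j = ∑ j, if i ≤ j then f j else 0 := by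
  rw [← Finset.sum_filter]
  congr 1
  ext; simp

theorem sum_ge_zero {n : ℕ} {M : Type*} [AddCommMonoid M] (f : Fin (n + 1) → M) :
    ∑ j ≥ (0 : Fin (n + 1)), f j = ∑ j, f j := by
  rw [sum_ge_eq]
  exact Finset.sum_congr rfl fun j _ => if_pos (Fin.zero_le j)

theorem sum_ge_succ {n : ℕ} {M : Type*} [AddCommMonoid M] (i : Fin n) (f : Fin (n + 1) → M) :
    ∑ j ≥ i.succ, f j = ∑ j ≥ i, f j.succ := by
  rw [sum_ge_eq, sum_ge_eq, Fin.sum_univ_succ, if_neg (by simp), zero_add]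
  simp only [Fin.succ_le_succ_iff]

/-- The differential commutes with equivariant maps. -/
theorem ceDifferential_pullPush (b : L →ₗ[𝕜] L →ₗ[𝕜] L) (hb : ∀ x, b x x = 0)
    (θ : L →ₗ[𝕜] V →ₗ[ℂ] V) {T : Module.End ℂ V} {A : Module.End 𝕜 L}
    (hA : ∀ x y, b (A x) (A y) = A (b x y)) (hT : ∀ x w, θ x (T w) = T (θ (A x) w))
    (p : ℕ) (φ : L [⋀^Fin p]→ₗ[𝕜] V) :
    ceDifferential b θ p (pullPush T A p φ) = pullPush T A (p + 1) (ceDifferential b θ p φ) := by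
  ext x
  rw [pullPush_apply]
  cases p with
  | zero =>
    rw [ceDifferential_zero_apply, ceDifferential_zero_apply, pullPush_apply, hT]
    congr 3
    exact Subsingleton.elim _ _
  | succ p =>
    rw [ceDifferential_succ_apply b hb, ceDifferential_succ_apply b hb, map_sub, map_sum, map_sum]
    congr 1
    · refine Finset.sum_congr rfl fun i _ => ?_
      rw [map_zsmul, pullPush_apply, hT]
      rfl
    · refine Finset.sum_congr rfl fun i _ => ?_
      rw [map_sum]
      refine Finset.sum_congr rfl fun j _ => ?_
      rw [map_zsmul, pullPush_apply]
      congr 3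
      ext k
      refine Fin.cases ?_ (fun k => ?_) k
      · exact (hA _ _).symm
      · rfl

theorem map_vecCons_swap {p : ℕ} (φ : L [⋀^Fin (p + 2)]→ₗ[𝕜] V) (x y : L) (w : Fin p → L) :
    φ (Matrix.vecCons y (Matrix.vecCons x w)) = -φ (Matrix.vecCons x (Matrix.vecCons y w)) := by
  rw [← φ.map_swap (Matrix.vecCons x (Matrix.vecCons y w)) (i := 0) (j := 1) (by simp)]
  congr 1
  ext k
  refine Fin.cases ?_ (fun k => Fin.cases ?_ (fun k => ?_) k) k
  · simp
  · simp
  · simp only [Function.comp]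
    rw [Equiv.swap_apply_of_ne_of_ne]
    · rfl
    · exact Fin.succ_ne_zero _
    · rw [← Fin.succ_zero_eq_one]
      exact fun h => Fin.succ_ne_zero _ (Fin.succ_injective _ h)

/-- Moving y from the front to slot j costs the sign (-1)^j. -/
theorem map_update_eq {p : ℕ} (φ : L [⋀^Fin (p + 1)]→ₗ[𝕜] V) (v : Fin (p + 1) → L)
    (j : Fin (p + 1)) (y : L) :
    (-1 : ℤ) ^ (j : ℕ) • φ (Matrix.vecCons y (j.removeNth v)) = φ (Function.update v j y) := by
  rw [← Fin.insertNth_removeNth, AlternatingMap.map_insertNth]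

theorem removeNth_succ_vecCons {p : ℕ} (x : L) (v : Fin (p + 1) → L) (i : Fin (p + 1)) :
    i.succ.removeNth (Matrix.vecCons x v : Fin (p + 2) → L) =
      Matrix.vecCons x (i.removeNth v) := by
  ext k
  refine Fin.cases ?_ (fun k => ?_) k
  · simp [Fin.removeNth]
  · simp [Fin.removeNth]

theorem removeNth_zero_vecCons {p : ℕ} (x : L) (v : Fin p → L) :
    (0 : Fin (p + 1)).removeNth (Matrix.vecCons x v : Fin (p + 1) → L) = v := by
  ext k
  simp [Fin.removeNth]

/-- Cartan's formula in degree zero. -/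
theorem ceDifferential_zero_vecCons (b : L →ₗ[𝕜] L →ₗ[𝕜] L) (θ : L →ₗ[𝕜] V →ₗ[ℂ] V)
    (φ : L [⋀^Fin 0]→ₗ[𝕜] V) (x : L) (v : Fin 0 → L) :
    ceDifferential b θ 0 φ (Matrix.vecCons x v) =
      θ x (φ v) - ∑ i, φ (Function.update v i (b x (v i))) := by
  rw [ceDifferential_zero_apply, Finset.univ_eq_empty, Finset.sum_empty, sub_zero]
  congr 2
  exact Subsingleton.elim _ _

/-- Cartan's formula in positive degree. -/
theorem ceDifferential_succ_vecCons (b : L →ₗ[𝕜] L →ₗ[𝕜] L) (hb : ∀ x, b x x = 0)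
    (θ : L →ₗ[𝕜] V →ₗ[ℂ] V) {p : ℕ} (φ : L [⋀^Fin (p + 1)]→ₗ[𝕜] V) (x : L)
    (v : Fin (p + 1) → L) :
    ceDifferential b θ (p + 1) φ (Matrix.vecCons x v) +
        ceDifferential b θ p (φ.curryLeft x) v =
      θ x (φ v) - ∑ i, φ (Function.update v i (b x (v i))) := by
  -- The brackets involving x reassemble into the derivation of φ by ad x, slot by slot.
  have h0 : ∑ j : Fin (p + 1), (-1 : ℤ) ^ ((0 : Fin (p + 1)) + j : ℕ) •
      φ (Matrix.vecCons (b x (v j)) (j.removeNth v)) =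
      ∑ i, φ (Function.update v i (b x (v i))) := by
    refine Finset.sum_congr rfl fun j _ => ?_
    rw [← map_update_eq]
    simp
  generalize ∑ i, φ (Function.update v i (b x (v i))) = S at h0 ⊢
  rw [ceDifferential_succ_apply b hb, Fin.sum_univ_succ (n := p), Fin.sum_univ_succ (n := p + 1),
    sum_ge_zero]
  simp only [Fin.castSucc_zero, removeNth_zero_vecCons, removeNth_succ_vecCons,
    Matrix.cons_val_zero, Matrix.cons_val_succ, Fin.val_zero, pow_zero, one_smul]
  rw [Fin.val_zero] at h0
  rw [h0]
  -- The terms not involving x as an actor cancel against the differential of the contraction: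
  -- deleting an entry behind x shifts its index by one and flips the sign.
  have h1 : ∑ i : Fin (p + 1), (-1 : ℤ) ^ (i.succ : ℕ) • θ (v i)
      (φ (Matrix.vecCons x (i.removeNth v))) =
      -∑ i : Fin (p + 1), (-1 : ℤ) ^ (i : ℕ) • θ (v i) (φ.curryLeft x (i.removeNth v)) := by
    rw [← Finset.sum_neg_distrib]
    refine Finset.sum_congr rfl fun i _ => ?_
    rw [Fin.val_succ, pow_succ, mul_neg_one, neg_smul]
    rfl
  rw [h1]
  cases p with
  | zero =>
    rw [ceDifferential_zero_apply]
    have : (0 : Fin 1).removeNth v = ![] := Subsingleton.elim _ _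
    simp [this]
    abel
  | succ p =>
    rw [ceDifferential_succ_apply b hb]
    -- For brackets both indices shift, so the sign comes instead from exchanging x with the bracket
    -- in the first two slots.
    have h2 : ∑ i : Fin (p + 1), ∑ j ≥ i.succ, (-1 : ℤ) ^ ((i.succ : Fin (p + 2)) + j : ℕ) •
        φ (Matrix.vecCons (b ((Matrix.vecCons x v : Fin (p + 3) → L) i.succ.castSucc) (v j))
          (j.removeNth (i.succ.castSucc.removeNth (Matrix.vecCons x v : Fin (p + 3) → L)))) =
        -∑ i : Fin (p + 1), ∑ j ≥ i, (-1 : ℤ) ^ (i + j : ℕ) •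
          φ.curryLeft x (Matrix.vecCons (b (v i.castSucc) (v j.succ))
            (j.removeNth (i.castSucc.removeNth v))) := by
      rw [← Finset.sum_neg_distrib]
      refine Finset.sum_congr rfl fun i _ => ?_
      rw [sum_ge_succ, ← Finset.sum_neg_distrib]
      refine Finset.sum_congr rfl fun j _ => ?_
      rw [← Fin.succ_castSucc, removeNth_succ_vecCons, removeNth_succ_vecCons,
        Matrix.cons_val_succ, map_vecCons_swap, smul_neg, AlternatingMap.curryLeft_apply_apply]
      congr 2
      rw [Fin.val_succ, Fin.val_succ]
      ring
    rw [h2]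
    abel

end CartanFormula

/-! ### Equivariance of derivatives under conjugation. -/

section LieCalculus

open Filter Topology

variable {𝕜 : Type*} [RCLike 𝕜]
  {E : Type*} [NormedAddCommGroup E] [NormedSpace 𝕜 E]
  {G : Type*} [TopologicalSpace G] [ChartedSpace E G] [Group G]
  [LieGroup 𝓘(𝕜, E) ∞ G]
  {F : Type*} [NormedAddCommGroup F] [NormedSpace 𝕜 F]

/-- A map into a vector space, read in the preferred chart at `1`. -/
theorem hasFDerivAt_chart_of_hasMFDerivAt {f : G → F} {D : E →L[𝕜] F}
    (h : HasMFDerivAt 𝓘(𝕜, E) 𝓘(𝕜, F) f (1 : G) D) :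
    HasFDerivAt (fun x => f ((extChartAt 𝓘(𝕜, E) (1 : G)).symm x)) D (chartOne 𝕜 E G) := by
  have h1 : HasMFDerivAt 𝓘(𝕜, E) 𝓘(𝕜, F) f
      ((extChartAt 𝓘(𝕜, E) (1 : G)).symm (chartOne 𝕜 E G)) D := by
    rw [extChartAt_symm_chartOne]; exact h
  exact (HasMFDerivAt.comp (chartOne 𝕜 E G) h1
    (hasMFDerivAt_extChartAt_symm_one (𝕜 := 𝕜) G)).hasFDerivAt

theorem hasMFDerivAt_of_chart {f : G → F} {D : E →L[𝕜] F}
    (h : HasFDerivAt (fun x => f ((extChartAt 𝓘(𝕜, E) (1 : G)).symm x)) D (chartOne 𝕜 E G)) :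
    HasMFDerivAt 𝓘(𝕜, E) 𝓘(𝕜, F) f (1 : G) D := by
  have h := HasMFDerivAt.comp (1 : G) h.hasMFDerivAt (hasMFDerivAt_extChartAt_one (𝕜 := 𝕜) G)
  refine HasMFDerivAt.congr_of_eventuallyEq h ?_
  filter_upwards [extChartAt_source_mem_nhds (I := 𝓘(𝕜, E)) (1 : G)] with g hg
  simp only [Function.comp]
  rw [(extChartAt 𝓘(𝕜, E) (1 : G)).left_inv hg]

/-- Equivariance of the derivative at `1` of a conjugation-equivariant map. -/
theorem hasMFDerivAt_conj_equivariant {f : G → F} {D : E →L[𝕜] F}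
    (h : HasMFDerivAt 𝓘(𝕜, E) 𝓘(𝕜, F) f (1 : G) D) {g : G} (c : F →L[𝕜] F)
    (hc : ∀ x, f (g * x * g⁻¹) = c (f x)) (v : E) : D (adL 𝕜 E g v) = c (D v) := by
  have h1 : HasMFDerivAt 𝓘(𝕜, E) 𝓘(𝕜, F) f (g * 1 * g⁻¹) D := by
    have : g * 1 * g⁻¹ = 1 := by group
    rw [this]; exact h
  have h2 := HasMFDerivAt.comp (1 : G) h1 (hasMFDerivAt_conj_one (𝕜 := 𝕜) (E := E) g)
  have h3 := HasMFDerivAt.comp (1 : G) c.hasFDerivAt.hasMFDerivAt h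
  have h4 : (f ∘ fun x => g * x * g⁻¹) = c ∘ f := funext hc
  rw [h4] at h2
  have h5 : (D.comp (adL 𝕜 E g) : E →L[𝕜] F) = c.comp D := h2.mfderiv.symm.trans h3.mfderiv
  exact congrArg (fun f : E →L[𝕜] F => f v) h5

variable (𝕜 E G) in
/-- The bracket of the Lie algebra as a continuous bilinear map on the model space. -/
def adD : E →L[𝕜] E →L[𝕜] E := chartMixed 𝕜 E G - (chartMixed 𝕜 E G).flip

theorem adD_self (v : E) : adD 𝕜 E G v v = 0 := by
  simp [adD]

variable [CompleteSpace E]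

/-- Differentiate Ad(gxg⁻¹) = Ad(g) Ad(x) Ad(g)⁻¹ at x = 1: Ad(g) is an automorphism of the bracket.
-/
theorem adD_adL (g : G) (v w : E) :
    adD 𝕜 E G (adL 𝕜 E g v) (adL 𝕜 E g w) = adL 𝕜 E g (adD 𝕜 E G v w) := by
  have hinv : (adL 𝕜 E g⁻¹).comp (adL 𝕜 E g) = ContinuousLinearMap.id 𝕜 E := by
    rw [← adL_mul, inv_mul_cancel, adL_one]
  have h := hasMFDerivAt_conj_equivariant (hasMFDerivAt_adL_one (𝕜 := 𝕜) (E := E) G) (g := g)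
    ((ContinuousLinearMap.compL 𝕜 E E E (adL 𝕜 E g)).comp
      ((ContinuousLinearMap.compL 𝕜 E E E).flip (adL 𝕜 E g⁻¹))) (fun x => by
        rw [adL_mul, adL_mul]; rfl) v
  have h2 := congrArg (fun f : E →L[𝕜] E => f (adL 𝕜 E g w)) h
  have h3 : adL 𝕜 E g⁻¹ (adL 𝕜 E g w) = w := congrArg (fun f : E →L[𝕜] E => f w) hinv
  refine h2.trans ?_
  change adL 𝕜 E g (adD 𝕜 E G v (adL 𝕜 E g⁻¹ (adL 𝕜 E g w))) = _
  rw [h3]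

variable (𝕜 E G) in
theorem hasFDerivAt_adL_inv_chart :
    HasFDerivAt (fun x => adL 𝕜 E ((extChartAt 𝓘(𝕜, E) (1 : G)).symm x)⁻¹)
      (-adD 𝕜 E G) (chartOne 𝕜 E G) := by
  have h0 := hasFDerivAt_adL_chart 𝕜 E G
  have h1 := hasFDerivAt_ringInverse (𝕜 := 𝕜) (1 : (E →L[𝕜] E)ˣ)
  have h2 : HasFDerivAt (Ring.inverse (M₀ := E →L[𝕜] E))
      (-ContinuousLinearMap.mulLeftRight 𝕜 (E →L[𝕜] E) ↑(1 : (E →L[𝕜] E)ˣ)⁻¹ ↑(1 : (E →L[𝕜] E)ˣ)⁻¹)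
      (adL 𝕜 E ((extChartAt 𝓘(𝕜, E) (1 : G)).symm (chartOne 𝕜 E G))) := by
    rw [extChartAt_symm_chartOne, adL_one]; exact h1
  have h3 := HasFDerivAt.comp (chartOne 𝕜 E G) h2 h0
  have h4 : (Ring.inverse (M₀ := E →L[𝕜] E) ∘
      fun x => adL 𝕜 E ((extChartAt 𝓘(𝕜, E) (1 : G)).symm x)) =
      fun x => adL 𝕜 E ((extChartAt 𝓘(𝕜, E) (1 : G)).symm x)⁻¹ := by
    ext1 x
    have a : ∀ g : G, adL 𝕜 E g * adL 𝕜 E g⁻¹ = 1 := fun g => by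
      have := adL_mul (𝕜 := 𝕜) (E := E) g g⁻¹
      rw [mul_inv_cancel, adL_one] at this
      exact this.symm
    have b := a ((extChartAt 𝓘(𝕜, E) (1 : G)).symm x)
    have c := a ((extChartAt 𝓘(𝕜, E) (1 : G)).symm x)⁻¹
    rw [inv_inv] at c
    exact Ring.inverse_unit (⟨_, _, b, c⟩ : (E →L[𝕜] E)ˣ)
  rw [h4] at h3
  refine h3.congr_fderiv ?_
  ext v w
  simp [adD]
  abel

end LieCalculus

/-! ### Continuity of multilinear maps in finite dimension. -/

section Multilinear

variable {𝕜 : Type*} [RCLike 𝕜]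
  {E : Type*} [NormedAddCommGroup E] [NormedSpace 𝕜 E] [FiniteDimensional 𝕜 E]
  {F : Type*} [NormedAddCommGroup F] [NormedSpace 𝕜 F]

theorem continuous_multilinearMap {ι : Type*} [Finite ι] (f : MultilinearMap 𝕜 (fun _ : ι => E) F) :
    Continuous f := by
  classical
  have := Fintype.ofFinite ι
  let b := Module.finBasis 𝕜 E
  have h : ∀ v : ι → E, f v = ∑ r : ι → Fin (Module.finrank 𝕜 E),
      (∏ i, b.coord (r i) (v i)) • f fun i => b (r i) := by
    intro v
    have h1 : v = fun i => ∑ j, b.coord j (v i) • b j := by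
      ext i
      simp [b.sum_repr]
    conv_lhs => rw [h1]
    rw [f.map_sum]
    refine Finset.sum_congr rfl fun r _ => ?_
    rw [f.map_smul_univ]
  rw [funext h]
  refine continuous_finsetSum _ fun r _ => ?_
  refine Continuous.smul (continuous_finsetProd _ fun i _ => ?_) continuous_const
  exact (b.coord (r i)).continuous_of_finiteDimensional.comp (continuous_apply i)

end Multilinear


/-! ### Lie derivatives and cochains moved along curves. -/

section Action

open Filter Topology

variable {𝕜 : Type*} [RCLike 𝕜] [NormedAlgebra 𝕜 ℂ]
  {L : Type*} [AddCommGroup L] [Module 𝕜 L]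
  {V : Type*} [AddCommGroup V] [Module ℂ V] [Module 𝕜 V] [IsScalarTower 𝕜 ℂ V]

/-- The Lie derivative of a cochain. -/
def lieDer (b : L →ₗ[𝕜] L →ₗ[𝕜] L) (θ : L →ₗ[𝕜] V →ₗ[ℂ] V) :
    ∀ (p : ℕ), L [⋀^Fin p]→ₗ[𝕜] V → L → L [⋀^Fin p]→ₗ[𝕜] V
  | 0, φ, x => (ceDifferential b θ 0 φ).curryLeft x
  | p + 1, φ, x => (ceDifferential b θ (p + 1) φ).curryLeft x +
      ceDifferential b θ p (φ.curryLeft x)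

theorem lieDer_apply (b : L →ₗ[𝕜] L →ₗ[𝕜] L) (hb : ∀ x, b x x = 0) (θ : L →ₗ[𝕜] V →ₗ[ℂ] V)
    (p : ℕ) (φ : L [⋀^Fin p]→ₗ[𝕜] V) (x : L) (v : Fin p → L) :
    lieDer b θ p φ x v = θ x (φ v) - ∑ i, φ (Function.update v i (b x (v i))) := by
  cases p with
  | zero => exact ceDifferential_zero_vecCons b θ φ x v
  | succ p => exact ceDifferential_succ_vecCons b hb θ φ x v

/-- On a cocycle one term of Cartan's formula vanishes and the other is d of the contraction; in
degree zero nothing remains. -/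
theorem lieDer_mem_coboundaries (b : L →ₗ[𝕜] L →ₗ[𝕜] L) (θ : L →ₗ[𝕜] V →ₗ[ℂ] V)
    {p : ℕ} {φ : L [⋀^Fin p]→ₗ[𝕜] V} (hφ : ceDifferential b θ p φ = 0) (x : L) :
    lieDer b θ p φ x ∈ coboundaries (ceDifferential b θ) p := by
  cases p with
  | zero =>
    have : lieDer b θ 0 φ x = 0 := by
      rw [lieDer, hφ]; rfl
    rw [this]
    exact Submodule.zero_mem _
  | succ p =>
    have : lieDer b θ (p + 1) φ x = ceDifferential b θ p (φ.curryLeft x) := by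
      rw [lieDer, hφ]
      exact zero_add _
    rw [this]
    exact ⟨_, rfl⟩

theorem finiteDimensional_alternatingMap [FiniteDimensional 𝕜 ℂ] [FiniteDimensional 𝕜 L]
    [FiniteDimensional ℂ V] (p : ℕ) : FiniteDimensional ℂ (L [⋀^Fin p]→ₗ[𝕜] V) := by
  have h1 : FiniteDimensional 𝕜 V := FiniteDimensional.trans 𝕜 ℂ V
  have h2 : FiniteDimensional 𝕜 (MultilinearMap 𝕜 (fun _ : Fin p => L) V) := inferInstance
  have h3 : FiniteDimensional 𝕜 (L [⋀^Fin p]→ₗ[𝕜] V) :=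
    Module.Finite.of_injective
      (AlternatingMap.toMultilinearMapLM (S := 𝕜) : (L [⋀^Fin p]→ₗ[𝕜] V) →ₗ[𝕜] _)
      AlternatingMap.coe_multilinearMap_injective
  have h4 : IsScalarTower 𝕜 ℂ (L [⋀^Fin p]→ₗ[𝕜] V) := ⟨fun a c φ => by ext; simp⟩
  exact Module.Finite.of_restrictScalars_finite 𝕜 ℂ _

theorem alternatingMap_separating (p : ℕ) (φ : L [⋀^Fin p]→ₗ[𝕜] V)
    (h : ∀ l ∈ {l : Module.Dual ℂ (L [⋀^Fin p]→ₗ[𝕜] V) | ∃ (m : Module.Dual ℂ V) (v : Fin p → L),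
      ∀ φ, l φ = m (φ v)}, l φ = 0) : φ = 0 := by
  ext v
  refine (Module.forall_dual_apply_eq_zero_iff ℂ _).1 fun m => ?_
  exact h { toFun := fun φ => m (φ v), map_add' := by simp, map_smul' := by simp }
    ⟨m, v, fun _ => rfl⟩

/-- The derivative of a cochain moved along curves of endomorphisms. -/
theorem hasFDerivAt_move {E V : Type*} [NormedAddCommGroup E] [NormedSpace 𝕜 E]
    [FiniteDimensional 𝕜 E] [NormedAddCommGroup V] [NormedSpace ℂ V] [NormedSpace 𝕜 V]
    [IsScalarTower 𝕜 ℂ V] [FiniteDimensional ℂ V]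
    {A : E → E →L[𝕜] E} {B : E →L[𝕜] E →L[𝕜] E} {T : E → V →L[ℂ] V} {DT : E →L[𝕜] V →L[ℂ] V}
    {x₀ : E} (hA : HasFDerivAt A (-B) x₀) (hT : HasFDerivAt T DT x₀) (hA0 : A x₀ = 1)
    (hT0 : T x₀ = 1) {p : ℕ} (φ : MultilinearMap 𝕜 (fun _ : Fin p => E) V) (v : Fin p → E)
    (m : Module.Dual ℂ V) :
    ∃ D : E →L[𝕜] ℂ, HasFDerivAt (fun x => m (T x (φ fun i => A x (v i)))) D x₀ ∧
      ∀ x, D x = m (DT x (φ v) - ∑ i, φ (Function.update v i (B x (v i)))) := by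
  let φ' : ContinuousMultilinearMap 𝕜 (fun _ : Fin p => E) V :=
    ⟨φ, continuous_multilinearMap (E := E) φ⟩
  let m' : V →L[𝕜] ℂ := (LinearMap.toContinuousLinearMap m).restrictScalars 𝕜
  let rs : (V →L[ℂ] V) →L[𝕜] (V →L[𝕜] V) := ContinuousLinearMap.restrictScalarsL ℂ V V 𝕜 𝕜
  have h1 : HasFDerivAt (fun x => fun i => A x (v i))
      (ContinuousLinearMap.pi fun i => (-B).flip (v i)) x₀ :=
    hasFDerivAt_pi.2 fun i => (hA.clm_apply (hasFDerivAt_const (v i) _)).congr_fderiv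
      (by ext; simp)
  have h2 := HasFDerivAt.comp x₀ (φ'.hasFDerivAt _) h1
  have h3 := (rs.hasFDerivAt.comp x₀ hT).clm_apply h2
  have h4 := m'.hasFDerivAt.comp x₀ h3
  refine ⟨_, h4, fun x => ?_⟩
  have e1 : (fun i => A x₀ (v i)) = v := by rw [hA0]; rfl
  simp only [Function.comp, ContinuousLinearMap.comp_apply, add_apply,
    ContinuousLinearMap.flip_apply]
  rw [e1, hT0]
  change m _ = m _
  congr 1
  rw [add_comm, sub_eq_add_neg]
  change DT x (φ v) + φ'.linearDeriv v _ = _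
  congr 1
  rw [ContinuousMultilinearMap.linearDeriv_apply, ← Finset.sum_neg_distrib]
  refine Finset.sum_congr rfl fun i _ => ?_
  change φ (Function.update v i (-(B x (v i)))) = _
  rw [← neg_one_smul 𝕜, MultilinearMap.map_update_smul, neg_one_smul]

end Action

/-! ### The action of G on the cochains of its Lie algebra, and its derivative. -/

section Action

open Filter Topology

variable {𝕜 : Type*} [RCLike 𝕜] [NormedAlgebra 𝕜 ℂ] [FiniteDimensional 𝕜 ℂ]
  {E : Type*} [NormedAddCommGroup E] [NormedSpace 𝕜 E] [FiniteDimensional 𝕜 E]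
  {G : Type*} [TopologicalSpace G] [ChartedSpace E G] [Group G] [LieGroup 𝓘(𝕜, E) ∞ G]
  {V : Type*} [NormedAddCommGroup V] [NormedSpace ℂ V] [NormedSpace 𝕜 V]
  [IsScalarTower 𝕜 ℂ V] [FiniteDimensional ℂ V]

instance (p : ℕ) : FiniteDimensional ℂ ((𝔤 𝕜 E G) [⋀^Fin p]→ₗ[𝕜] V) :=
  finiteDimensional_alternatingMap p

theorem lieBilin_apply (x y : 𝔤 𝕜 E G) : lieBilin 𝕜 E G x y = (adD 𝕜 E G (x : E) (y : E) : E) :=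
  haveI : CompleteSpace E := FiniteDimensional.complete 𝕜 E
  bracket_eq_chartMixed x y

theorem lieBilin_self (x : 𝔤 𝕜 E G) : lieBilin 𝕜 E G x x = 0 :=
  (lieBilin_apply x x).trans (adD_self (𝕜 := 𝕜) (E := E) (G := G) x)

theorem Ad_one : Ad 𝕜 E (1 : G) = 1 := by
  ext x
  exact congrArg (fun f : E →L[𝕜] E => f x) (adL_one (𝕜 := 𝕜) (E := E) (G := G))

theorem Ad_mul (g h : G) : Ad 𝕜 E (g * h) = Ad 𝕜 E g * Ad 𝕜 E h := by
  ext x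
  exact congrArg (fun f : E →L[𝕜] E => f x) (adL_mul (𝕜 := 𝕜) (E := E) g h)

theorem lieBilin_Ad (g : G) (x y : 𝔤 𝕜 E G) :
    lieBilin 𝕜 E G (Ad 𝕜 E g x) (Ad 𝕜 E g y) = Ad 𝕜 E g (lieBilin 𝕜 E G x y) := by
  have : CompleteSpace E := FiniteDimensional.complete 𝕜 E
  rw [lieBilin_apply, lieBilin_apply]
  exact adD_adL (𝕜 := 𝕜) (E := E) g x y

variable (𝕜 E) in
/-- The action of `G` on the cochains of its Lie algebra with values in a representation. -/
def cochainRep (π : G →* (V →L[ℂ] V)) (p : ℕ) :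
    G →* Module.End ℂ ((𝔤 𝕜 E G) [⋀^Fin p]→ₗ[𝕜] V) where
  toFun g := pullPush (π g : V →ₗ[ℂ] V) (Ad 𝕜 E g⁻¹) p
  map_one' := by
    rw [inv_one, Ad_one, map_one]
    rfl
  map_mul' g h := by
    rw [mul_inv_rev, Ad_mul, map_mul]
    rfl

/-- Smoothness at `1` of a representation. -/
def SmoothAtOne (𝕜 : Type*) [RCLike 𝕜] [NormedAlgebra 𝕜 ℂ]
    (E : Type*) [NormedAddCommGroup E] [NormedSpace 𝕜 E]
    {G : Type*} [TopologicalSpace G] [ChartedSpace E G] [Group G]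
    {V : Type*} [NormedAddCommGroup V] [NormedSpace ℂ V] [NormedSpace 𝕜 V] [IsScalarTower 𝕜 ℂ V]
    (π : G →* (V →L[ℂ] V)) : Prop :=
  MDifferentiableAt 𝓘(𝕜, E) 𝓘(𝕜, V →L[ℂ] V) (fun g : G => π g) (1 : G)

theorem SmoothAtOne.hasMFDerivAt {π : G →* (V →L[ℂ] V)} (hπ : SmoothAtOne 𝕜 E π) :
    HasMFDerivAt 𝓘(𝕜, E) 𝓘(𝕜, V →L[ℂ] V) (fun g : G => π g) (1 : G)
      (mfderiv 𝓘(𝕜, E) 𝓘(𝕜, V →L[ℂ] V) (fun g : G => π g) (1 : G) : E →L[𝕜] V →L[ℂ] V) :=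
  MDifferentiableAt.hasMFDerivAt hπ

variable (𝕜 V) in
/-- Left multiplication by an endomorphism. -/
def mulLeftCLM (T : V →L[ℂ] V) : (V →L[ℂ] V) →L[𝕜] (V →L[ℂ] V) :=
  (ContinuousLinearMap.compL ℂ V V V T).restrictScalars 𝕜

variable (𝕜 V) in
/-- Right multiplication by an endomorphism. -/
def mulRightCLM (T : V →L[ℂ] V) : (V →L[ℂ] V) →L[𝕜] (V →L[ℂ] V) :=
  ((ContinuousLinearMap.compL ℂ V V V).flip T).restrictScalars 𝕜

/-- Differentiate π(gxg⁻¹) = π(g)π(x)π(g)⁻¹ at x = 1. With `lieBilin_Ad` this makes the action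
commute with the differential. -/
theorem derivedRep_Ad {π : G →* (V →L[ℂ] V)} (hπ : SmoothAtOne 𝕜 E π) (g : G) (x : 𝔤 𝕜 E G)
    (w : V) : derivedRep 𝕜 E π (Ad 𝕜 E g x) (π g w) = π g (derivedRep 𝕜 E π x w) := by
  have h := hasMFDerivAt_conj_equivariant hπ.hasMFDerivAt (g := g)
    ((mulLeftCLM 𝕜 V (π g)).comp (mulRightCLM 𝕜 V (π g⁻¹))) (fun x => by
      rw [map_mul, map_mul]; rfl) (x : E)
  have h2 := congrArg (fun f : V →L[ℂ] V => f (π g w)) h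
  refine h2.trans ?_
  have h3 : π g⁻¹ (π g w) = w := by
    have : (π g⁻¹ * π g) w = w := by rw [← map_mul, inv_mul_cancel, map_one]; rfl
    exact this
  exact congrArg (fun w => π g (derivedRep 𝕜 E π x w)) h3

theorem ceDifferential_cochainRep {π : G →* (V →L[ℂ] V)} (hπ : SmoothAtOne 𝕜 E π) (p : ℕ) (g : G)
    (φ : (𝔤 𝕜 E G) [⋀^Fin p]→ₗ[𝕜] V) :
    ceDifferential (lieBilin 𝕜 E G) (derivedRep 𝕜 E π) p (cochainRep 𝕜 E π p g φ) =
      cochainRep 𝕜 E π (p + 1) g (ceDifferential (lieBilin 𝕜 E G) (derivedRep 𝕜 E π) p φ) := by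
  refine ceDifferential_pullPush _ lieBilin_self _ (fun x y => lieBilin_Ad _ x y) (fun x w => ?_) p φ
  have h := derivedRep_Ad hπ g (Ad 𝕜 E g⁻¹ x) w
  rw [← Module.End.mul_apply, ← Ad_mul, mul_inv_cancel, Ad_one] at h
  exact h

/-- The derivative at `1` of the action on cochains is the Lie derivative. -/
theorem hasMFDerivAt_cochainRep {π : G →* (V →L[ℂ] V)} (hπ : SmoothAtOne 𝕜 E π) (p : ℕ)
    (φ : (𝔤 𝕜 E G) [⋀^Fin p]→ₗ[𝕜] V) (l : Module.Dual ℂ ((𝔤 𝕜 E G) [⋀^Fin p]→ₗ[𝕜] V)) :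
    ∃ D : E →L[𝕜] ℂ,
      HasMFDerivAt 𝓘(𝕜, E) 𝓘(𝕜, ℂ) (fun g : G => l (cochainRep 𝕜 E π p g φ)) (1 : G) D ∧
      ∀ x : E, D x = l (lieDer (lieBilin 𝕜 E G) (derivedRep 𝕜 E π) p φ x) := by
  have hcs : CompleteSpace E := FiniteDimensional.complete 𝕜 E
  -- The claim is linear in l, so only the functionals φ ↦ m(φ v) matter; for these the product rule
  -- gives the formula of `lieDer_apply`.
  have hl : l ∈ Submodule.span ℂ {l : Module.Dual ℂ ((𝔤 𝕜 E G) [⋀^Fin p]→ₗ[𝕜] V) |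
      ∃ (m : Module.Dual ℂ V) (v : Fin p → 𝔤 𝕜 E G), ∀ φ, l φ = m (φ v)} := by
    rw [span_eq_top_of_separating (alternatingMap_separating p)]; trivial
  induction hl using Submodule.span_induction with
  | zero => exact ⟨0, hasMFDerivAt_const _ _, fun _ => rfl⟩
  | add l₁ l₂ _ _ h₁ h₂ =>
    obtain ⟨D₁, a₁, b₁⟩ := h₁
    obtain ⟨D₂, a₂, b₂⟩ := h₂
    refine ⟨D₁ + D₂, hasMFDerivAt_of_chart
      ((hasFDerivAt_chart_of_hasMFDerivAt a₁).add (hasFDerivAt_chart_of_hasMFDerivAt a₂)),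
      fun x => ?_⟩
    rw [add_apply, b₁, b₂]; rfl
  | smul a l _ h =>
    obtain ⟨D, h1, h2⟩ := h
    refine ⟨a • D, hasMFDerivAt_of_chart ((hasFDerivAt_chart_of_hasMFDerivAt h1).const_smul a), fun x => ?_⟩
    rw [smul_apply, h2]; rfl
  | mem l h =>
    obtain ⟨m, v, hl⟩ := h
    have hA := hasFDerivAt_adL_inv_chart 𝕜 E G
    obtain ⟨DT, hDT, hDT'⟩ : ∃ DT : E →L[𝕜] (V →L[ℂ] V),
        HasFDerivAt (fun x => π ((extChartAt 𝓘(𝕜, E) (1 : G)).symm x)) DT (chartOne 𝕜 E G) ∧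
        ∀ x w, DT x w = derivedRep 𝕜 E π x w :=
      ⟨_, hasFDerivAt_chart_of_hasMFDerivAt hπ.hasMFDerivAt, fun _ _ => rfl⟩
    obtain ⟨D, h1, h2⟩ := hasFDerivAt_move hA hDT
      (by rw [extChartAt_symm_chartOne, inv_one, adL_one]; rfl)
      (by rw [extChartAt_symm_chartOne, map_one]) φ.toMultilinearMap v m
    refine ⟨D, hasMFDerivAt_of_chart (h1.congr_of_eventuallyEq
      (Filter.Eventually.of_forall fun x => hl _)), fun x => ?_⟩
    refine (h2 x).trans (Eq.trans (congrArg m ?_) (hl _).symm)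
    refine Eq.trans ?_ (lieDer_apply (lieBilin 𝕜 E G) lieBilin_self (derivedRep 𝕜 E π) p φ x v).symm
    refine congrArg₂ (· - ·) (hDT' x _) (Finset.sum_congr rfl fun i _ => ?_)
    exact congrArg (fun y => φ (Function.update v i y)) (lieBilin_apply x (v i)).symm

end Action

/-! ### Functions with zero derivative on a connected Lie group. -/

section Invariance

open Filter Topology

variable {𝕜 : Type*} [RCLike 𝕜]
  {E : Type*} [NormedAddCommGroup E] [NormedSpace 𝕜 E]
  {G : Type*} [TopologicalSpace G] [ChartedSpace E G] [Group G] [LieGroup 𝓘(𝕜, E) ∞ G]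
  {F : Type*} [NormedAddCommGroup F] [NormedSpace 𝕜 F]

theorem eventually_eq_of_hasMFDerivAt_zero {f : G → F}
    (hf : ∀ g, HasMFDerivAt 𝓘(𝕜, E) 𝓘(𝕜, F) f g (0 : E →L[𝕜] F)) :
    ∀ᶠ g in 𝓝 (1 : G), f g = f 1 := by
  let A : NormedSpace ℝ E := NormedSpace.restrictScalars ℝ 𝕜 E
  obtain ⟨r, hr, hball⟩ := Metric.mem_nhds_iff.1
    (extChartAt_target_mem_nhds (I := 𝓘(𝕜, E)) (1 : G))
  have hd : ∀ x ∈ Metric.ball (chartOne 𝕜 E G) r,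
      HasFDerivAt (fun x => f ((extChartAt 𝓘(𝕜, E) (1 : G)).symm x)) (0 : E →L[𝕜] F) x := by
    intro x hx
    have h1 := ((contMDiffAt_extChartAt_symm (𝕜 := 𝕜) (G := G) (hball hx)).mdifferentiableAt
      (by simp)).hasMFDerivAt
    have h2 := (HasMFDerivAt.comp x (hf _) h1).hasFDerivAt
    exact h2.congr_fderiv (ContinuousLinearMap.zero_comp _)
  have hpre := (convex_ball (chartOne 𝕜 E G) r).isPreconnected
  have hin : ∀ᶠ g in 𝓝 (1 : G), extChartAt 𝓘(𝕜, E) (1 : G) g ∈ Metric.ball (chartOne 𝕜 E G) r :=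
    (continuousAt_extChartAt (I := 𝓘(𝕜, E)) (1 : G)).preimage_mem_nhds (Metric.ball_mem_nhds _ hr)
  filter_upwards [hin, extChartAt_source_mem_nhds (I := 𝓘(𝕜, E)) (1 : G)] with g hg hgs
  have := Metric.isOpen_ball.is_const_of_fderiv_eq_zero hpre
    (fun x hx => (hd x hx).differentiableAt.differentiableWithinAt)
    (fun x hx => (hd x hx).fderiv) hg (Metric.mem_ball_self hr)
  rwa [(extChartAt 𝓘(𝕜, E) (1 : G)).left_inv hgs, extChartAt_symm_chartOne] at this

/-- A function with vanishing derivative on a connected Lie group is constant. -/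
theorem eq_of_hasMFDerivAt_zero [PreconnectedSpace G] {f : G → F}
    (hf : ∀ g, HasMFDerivAt 𝓘(𝕜, E) 𝓘(𝕜, F) f g (0 : E →L[𝕜] F)) (g h : G) : f g = f h := by
  have hG : IsTopologicalGroup G := topologicalGroup_of_lieGroup 𝓘(𝕜, E) ∞
  refine IsLocallyConstant.apply_eq_of_isPreconnected (f := f) ?_ isPreconnected_univ
    (Set.mem_univ g) (Set.mem_univ h)
  rw [IsLocallyConstant.iff_eventually_eq]
  intro a
  -- Left translation reduces local constancy at a to local constancy at 1.
  have h1 := eventually_eq_of_hasMFDerivAt_zero (𝕜 := 𝕜) (f := fun x => f (a * x)) fun g => by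
    have := HasMFDerivAt.comp g (hf (a * g)) (hasMFDerivAt_mul_left (𝕜 := 𝕜) (E := E) a g)
    convert! this
  rw [mul_one] at h1
  have h2 : Tendsto (fun y => a⁻¹ * y) (𝓝 a) (𝓝 1) := by
    have : Continuous fun y => a⁻¹ * y := continuous_const_mul _
    simpa using this.tendsto a
  filter_upwards [h2.eventually h1] with y hy
  simpa using hy

end Invariance

/-! ### Triviality of the action on cohomology. -/

section Invariance

open Filter Topology

variable {𝕜 : Type*} [RCLike 𝕜] [NormedAlgebra 𝕜 ℂ] [FiniteDimensional 𝕜 ℂ]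
  {E : Type*} [NormedAddCommGroup E] [NormedSpace 𝕜 E] [FiniteDimensional 𝕜 E]
  {G : Type*} [TopologicalSpace G] [ChartedSpace E G] [Group G] [LieGroup 𝓘(𝕜, E) ∞ G]
  {V : Type*} [NormedAddCommGroup V] [NormedSpace ℂ V] [NormedSpace 𝕜 V]
  [IsScalarTower 𝕜 ℂ V] [FiniteDimensional ℂ V]

/-- Writing x = g(g⁻¹x) carries the derivative at 1 to g; its values are l of g applied to Lie
derivatives of φ. Smoothness of π at 1 alone thus suffices everywhere. -/
theorem exists_hasMFDerivAt_cochainRep {π : G →* (V →L[ℂ] V)} (hπ : SmoothAtOne 𝕜 E π) (p : ℕ)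
    (φ : (𝔤 𝕜 E G) [⋀^Fin p]→ₗ[𝕜] V) (l : Module.Dual ℂ ((𝔤 𝕜 E G) [⋀^Fin p]→ₗ[𝕜] V)) (g : G) :
    ∃ D : E →L[𝕜] ℂ,
      HasMFDerivAt 𝓘(𝕜, E) 𝓘(𝕜, ℂ) (fun g : G => l (cochainRep 𝕜 E π p g φ)) g D ∧
      ∀ x : E, ∃ y : E, D x =
        l (cochainRep 𝕜 E π p g (lieDer (lieBilin 𝕜 E G) (derivedRep 𝕜 E π) p φ y)) := by
  obtain ⟨D, h1, h2⟩ := hasMFDerivAt_cochainRep hπ p φ (l ∘ₗ cochainRep 𝕜 E π p g)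
  have h3 : HasMFDerivAt 𝓘(𝕜, E) 𝓘(𝕜, ℂ)
      (fun h : G => (l ∘ₗ cochainRep 𝕜 E π p g) (cochainRep 𝕜 E π p h φ)) (g⁻¹ * g) D := by
    rw [inv_mul_cancel]; exact h1
  have h4 := HasMFDerivAt.comp g h3 (hasMFDerivAt_mul_left (𝕜 := 𝕜) (E := E) g⁻¹ g)
  refine ⟨_, h4.congr_of_eventuallyEq (Eventually.of_forall fun x => ?_), fun x => ⟨_, h2 _⟩⟩
  simp only [Function.comp, LinearMap.comp_apply]
  rw [← Module.End.mul_apply, ← map_mul, mul_inv_cancel_left]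

theorem coeffContinuous_cochainRep {π : G →* (V →L[ℂ] V)} (hπ : SmoothAtOne 𝕜 E π) (p : ℕ) :
    CoeffContinuous (cochainRep 𝕜 E π p) := fun l φ =>
  continuous_iff_continuousAt.2 fun g =>
    (exists_hasMFDerivAt_cochainRep hπ p φ l g).choose_spec.1.continuousAt

theorem cochainRep_mem_coboundaries {π : G →* (V →L[ℂ] V)} (hπ : SmoothAtOne 𝕜 E π) {p : ℕ} (g : G)
    {φ : (𝔤 𝕜 E G) [⋀^Fin p]→ₗ[𝕜] V}
    (hφ : φ ∈ coboundaries (ceDifferential (lieBilin 𝕜 E G) (derivedRep 𝕜 E π)) p) :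
    cochainRep 𝕜 E π p g φ ∈
      coboundaries (ceDifferential (lieBilin 𝕜 E G) (derivedRep 𝕜 E π)) p := by
  cases p with
  | zero =>
    have : φ = 0 := hφ
    rw [this, map_zero]
    exact Submodule.zero_mem _
  | succ p =>
    obtain ⟨ψ, rfl⟩ := hφ
    exact ⟨_, ceDifferential_cochainRep hπ p g ψ⟩

/-- A connected group acts trivially on the cohomology of its Lie algebra. -/
theorem cochainRep_sub_mem_coboundaries [PreconnectedSpace G] {π : G →* (V →L[ℂ] V)}
    (hπ : SmoothAtOne 𝕜 E π) {p : ℕ} (g : G) {φ : (𝔤 𝕜 E G) [⋀^Fin p]→ₗ[𝕜] V}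
    (hφ : ceDifferential (lieBilin 𝕜 E G) (derivedRep 𝕜 E π) p φ = 0) :
    cochainRep 𝕜 E π p g φ - φ ∈
      coboundaries (ceDifferential (lieBilin 𝕜 E G) (derivedRep 𝕜 E π)) p := by
  -- For l vanishing on coboundaries, g ↦ l(g · φ) has derivative zero, since g maps the coboundary
  -- given by a Lie derivative to a coboundary.
  rw [← Subspace.forall_mem_dualAnnihilator_apply_eq_zero_iff]
  intro l hl
  have hl := (Submodule.mem_dualAnnihilator l).1 hl
  have h : ∀ g, HasMFDerivAt 𝓘(𝕜, E) 𝓘(𝕜, ℂ) (fun g : G => l (cochainRep 𝕜 E π p g φ)) g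
      (0 : E →L[𝕜] ℂ) := by
    intro g
    obtain ⟨D, h1, h2⟩ := exists_hasMFDerivAt_cochainRep hπ p φ l g
    have : D = 0 := by
      ext x
      obtain ⟨y, hy⟩ := h2 x
      rw [hy, hl _ (cochainRep_mem_coboundaries hπ g (lieDer_mem_coboundaries _ _ hφ y))]
      rfl
    rwa [this] at h1
  rw [map_sub, sub_eq_zero]
  have := eq_of_hasMFDerivAt_zero h g 1
  rw [map_one] at this
  exact this

end Invariance

/-! ### Jordan decomposition and generalised eigenspaces. -/

section Jordan

open Module

theorem mul_sub_mul_eq {R : Type*} [Ring R] (x y a b : R) :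
    x * a - y * b = (x - y) * a + y * (a - b) := by noncomm_ring

/-- Commuting endomorphisms with nilpotent difference have the same generalised eigenspaces. -/
theorem maxGenEigenspace_le_of_isNilpotent_sub {K M : Type*} [Field K] [AddCommGroup M] [Module K M]
    {f g : End K M} (hfg : Commute f g) (hn : IsNilpotent (g - f)) (c : K) :
    f.maxGenEigenspace c ≤ g.maxGenEigenspace c := by
  intro v hv
  rw [Module.End.mem_maxGenEigenspace] at hv ⊢
  obtain ⟨k, hk⟩ := hv
  obtain ⟨l, hl⟩ := hn
  refine ⟨k + l, ?_⟩
  have h1 : g - c • (1 : End K M) = (f - c • (1 : End K M)) + (g - f) := by abel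
  have h2 : Commute (f - c • (1 : End K M)) (g - f) := by
    have a : Commute (c • (1 : End K M)) (g - f) := (Commute.one_left _).smul_left c
    exact (hfg.sub_right (Commute.refl f)).sub_left a
  rw [h1, h2.add_pow, LinearMap.sum_apply]
  refine Finset.sum_eq_zero fun m hm => ?_
  rw [Finset.mem_range] at hm
  rcases le_or_gt k m with h | h
  · rw [((h2.pow_pow m (k + l - m)).eq), Module.End.mul_apply, Module.End.mul_apply,
      ← Nat.sub_add_cancel h, pow_add, Module.End.mul_apply]
    rw [show ((((k + l).choose (m - k + k) : ℕ) : End K M)) v =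
      ((k + l).choose (m - k + k)) • v by simp, map_nsmul, hk]
    simp
  · have : k + l - m = (k - m) + l := by omega
    rw [this, pow_add, hl]
    simp

theorem maxGenEigenspace_eq_eigenspace_of_jordan {K M : Type*} [Field K] [AddCommGroup M]
    [Module K M] {f s : End K M} (hs : s.IsSemisimple) (hn : IsNilpotent (f - s))
    (h : Commute f s) (c : K) : f.maxGenEigenspace c = s.eigenspace c := by
  rw [← hs.isFinitelySemisimple.maxGenEigenspace_eq_eigenspace]
  refine le_antisymm (maxGenEigenspace_le_of_isNilpotent_sub h ?_ c)
    (maxGenEigenspace_le_of_isNilpotent_sub h.symm hn c)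
  rw [← neg_sub]
  exact hn.neg

/-- The squarefree minimal polynomial of g also annihilates f. This serves to restrict from
multilinear to alternating maps. -/
theorem isSemisimple_of_intertwining {K M M' : Type*} [Field K] [AddCommGroup M] [Module K M]
    [AddCommGroup M'] [Module K M'] [FiniteDimensional K M'] (ι : M →ₗ[K] M')
    (hι : Function.Injective ι) {f : End K M} {g : End K M'} (h : ∀ x, ι (f x) = g (ι x))
    (hg : g.IsSemisimple) : f.IsSemisimple := by
  refine Module.End.isSemisimple_of_squarefree_aeval_eq_zero (p := minpoly K g)
    hg.minpoly_squarefree ?_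
  have key : ∀ (q : Polynomial K) x, ι (Polynomial.aeval f q x) = Polynomial.aeval g q (ι x) := by
    intro q
    induction q using Polynomial.induction_on with
    | C a => intro x; simp
    | add p q hp hq => intro x; simp [hp, hq]
    | monomial n a ih =>
      intro x
      rw [pow_succ, ← mul_assoc, map_mul (Polynomial.aeval f) (_ * _),
        map_mul (Polynomial.aeval g) (_ * _), Module.End.mul_apply, Module.End.mul_apply, ih]
      simp only [Polynomial.aeval_X, h]
  ext x
  apply hι
  rw [key, minpoly.aeval]
  simp

theorem isNilpotent_of_intertwining {K M M' : Type*} [Field K] [AddCommGroup M] [Module K M]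
    [AddCommGroup M'] [Module K M'] (ι : M →ₗ[K] M')
    (hι : Function.Injective ι) {f : End K M} {g : End K M'} (h : ∀ x, ι (f x) = g (ι x))
    (hg : IsNilpotent g) : IsNilpotent f := by
  obtain ⟨n, hn⟩ := hg
  refine ⟨n, ?_⟩
  have key : ∀ (n : ℕ) x, ι ((f ^ n) x) = (g ^ n) (ι x) := by
    intro n
    induction n with
    | zero => intro x; simp
    | succ n ih =>
      intro x
      rw [pow_succ, pow_succ, Module.End.mul_apply, Module.End.mul_apply, ih, h]
  ext x
  apply hι
  rw [key, hn]
  simp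

end Jordan

/-! ### Jordan decomposition of the action on cochains. -/

section JordanCochains

open Module

variable {𝕜 : Type*} [RCLike 𝕜] [NormedAlgebra 𝕜 ℂ]
  {L : Type*} [AddCommGroup L] [Module 𝕜 L]
  {V : Type*} [AddCommGroup V] [Module ℂ V] [Module 𝕜 V] [IsScalarTower 𝕜 ℂ V]

/-- Pull back a multilinear map along one endomorphism in each argument. -/
def multiPull {p : ℕ} (A : Fin p → End 𝕜 L) : End ℂ (MultilinearMap 𝕜 (fun _ : Fin p => L) V) where
  toFun φ := φ.compLinearMap A
  map_add' _ _ := rfl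
  map_smul' _ _ := rfl

theorem multiPull_apply {p : ℕ} (A : Fin p → End 𝕜 L)
    (φ : MultilinearMap 𝕜 (fun _ : Fin p => L) V) (v : Fin p → L) :
    multiPull A φ v = φ fun i => A i (v i) := rfl

theorem multiPull_mul {p : ℕ} (A B : Fin p → End 𝕜 L) :
    multiPull (V := V) (B * A) = multiPull A * multiPull B := rfl

/-- Pull back a multilinear map in one argument. -/
def slotPull {p : ℕ} (i : Fin p) (A : End 𝕜 L) :
    End ℂ (MultilinearMap 𝕜 (fun _ : Fin p => L) V) :=
  multiPull (Function.update 1 i A)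

theorem slotPull_apply {p : ℕ} (i : Fin p) (A : End 𝕜 L)
    (φ : MultilinearMap 𝕜 (fun _ : Fin p => L) V) (v : Fin p → L) :
    slotPull i A φ v = φ (Function.update v i (A (v i))) := by
  rw [slotPull, multiPull_apply]
  congr 1
  ext j
  by_cases h : j = i
  · subst h; simp
  · simp [h]

theorem slotPull_mul {p : ℕ} (i : Fin p) (A B : End 𝕜 L) :
    slotPull (V := V) i (B * A) = slotPull i A * slotPull i B := by
  ext φ v
  simp only [Module.End.mul_apply, slotPull_apply, Function.update_idem, Function.update_self]

theorem slotPull_one {p : ℕ} (i : Fin p) : slotPull (V := V) i (1 : End 𝕜 L) = 1 := by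
  ext φ v
  simp [slotPull_apply]

theorem slotPull_pow {p : ℕ} (i : Fin p) (A : End 𝕜 L) (n : ℕ) :
    slotPull (V := V) i (A ^ n) = slotPull i A ^ n := by
  induction n with
  | zero => rw [pow_zero, pow_zero, slotPull_one]
  | succ n ih => rw [pow_succ, pow_succ', slotPull_mul, ih]

theorem slotPull_add {p : ℕ} (i : Fin p) (A B : End 𝕜 L) :
    slotPull (V := V) i (A + B) = slotPull i A + slotPull i B := by
  ext φ v
  rw [LinearMap.add_apply, add_apply, slotPull_apply, slotPull_apply, slotPull_apply,
    LinearMap.add_apply, MultilinearMap.map_update_add]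

theorem slotPull_sub {p : ℕ} (i : Fin p) (A B : End 𝕜 L) :
    slotPull (V := V) i (A - B) = slotPull i A - slotPull i B := by
  rw [eq_sub_iff_add_eq, ← slotPull_add, sub_add_cancel]

theorem aeval_slotPull {p : ℕ} (i : Fin p) (A : End 𝕜 L) (f : Polynomial 𝕜) :
    Polynomial.aeval (slotPull (V := V) i A) (f.map (algebraMap 𝕜 ℂ)) =
      slotPull i (Polynomial.aeval A f) := by
  induction f using Polynomial.induction_on' with
  | add f g hf hg => rw [Polynomial.map_add, map_add, hf, hg, map_add, slotPull_add]
  | monomial n a =>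
    rw [Polynomial.map_monomial, Polynomial.aeval_monomial, Polynomial.aeval_monomial,
      ← slotPull_pow]
    ext φ v
    rw [slotPull_apply]
    have h1 : (algebraMap 𝕜 (End 𝕜 L) a * A ^ n) (v i) = a • (A ^ n) (v i) := by
      simp [Module.algebraMap_end_apply]
    rw [h1, MultilinearMap.map_update_smul, Module.End.mul_apply, Module.algebraMap_end_apply,
      smul_apply, algebraMap_smul, slotPull_apply]

variable [FiniteDimensional 𝕜 L]

theorem isSemisimple_slotPull {p : ℕ} (i : Fin p) {A : End 𝕜 L} (hA : A.IsSemisimple) :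
    (slotPull (V := V) i A).IsSemisimple := by
  refine Module.End.isSemisimple_of_squarefree_aeval_eq_zero
    (p := (minpoly 𝕜 A).map (algebraMap 𝕜 ℂ)) ?_ ?_
  -- Squarefreeness need not survive an extension of scalars in general, but separability does.
  · have := PerfectField.separable_iff_squarefree.2 hA.minpoly_squarefree
    exact (this.map (f := algebraMap 𝕜 ℂ)).squarefree
  · rw [aeval_slotPull, minpoly.aeval]
    ext φ v
    rw [slotPull_apply, LinearMap.zero_apply, MultilinearMap.map_update_zero]
    rfl

theorem isNilpotent_slotPull {p : ℕ} (i : Fin p) {A : End 𝕜 L} (hA : IsNilpotent A) :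
    IsNilpotent (slotPull (V := V) i A) := by
  obtain ⟨n, hn⟩ := hA
  refine ⟨n, ?_⟩
  rw [← slotPull_pow, hn]
  ext φ v
  rw [slotPull_apply, LinearMap.zero_apply, MultilinearMap.map_update_zero]
  rfl

theorem commute_multiPull {p : ℕ} {A B : Fin p → End 𝕜 L} (h : ∀ i, Commute (A i) (B i)) :
    Commute (multiPull (V := V) A) (multiPull B) := by
  have : A * B = B * A := funext fun i => h i
  rw [Commute, SemiconjBy, ← multiPull_mul, ← multiPull_mul, this]

/-- Pulling back in all slots is a product of commuting one-slot pullbacks. Hence semisimplicity and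
nilpotence of the difference are proved one slot at a time. Alternating maps do not allow this, so
the argument is made for multilinear maps. -/
theorem multiPull_jordan [FiniteDimensional 𝕜 ℂ] [FiniteDimensional ℂ V] {A S : End 𝕜 L}
    (hS : S.IsSemisimple) (hn : IsNilpotent (A - S)) (hc : Commute A S) (p : ℕ) :
    (multiPull (V := V) fun _ : Fin p => S).IsSemisimple ∧
      IsNilpotent ((multiPull (V := V) fun _ : Fin p => A) - multiPull fun _ => S) := by
  have hfd : FiniteDimensional 𝕜 V := FiniteDimensional.trans 𝕜 ℂ V
  have hst : IsScalarTower 𝕜 ℂ (MultilinearMap 𝕜 (fun _ : Fin p => L) V) :=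
    ⟨fun a c φ => by ext; simp⟩
  have hfd' : FiniteDimensional ℂ (MultilinearMap 𝕜 (fun _ : Fin p => L) V) :=
    Module.Finite.of_restrictScalars_finite 𝕜 ℂ _
  have key : ∀ s : Finset (Fin p),
      (multiPull (V := V) fun i : Fin p => if i ∈ s then S else 1).IsSemisimple ∧
      IsNilpotent ((multiPull (V := V) fun i : Fin p => if i ∈ s then A else 1) -
        multiPull fun i => if i ∈ s then S else 1) := by
    intro s
    induction s using Finset.induction_on with
    | empty =>
      constructor
      · exact Module.End.isSemisimple_id
      · simp
    | insert i s hi ih =>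
      have hstep : ∀ B : End 𝕜 L, (multiPull (V := V) fun j : Fin p => if j ∈ insert i s then B else 1)
          = (multiPull (V := V) fun j : Fin p => if j ∈ s then B else 1) * slotPull i B := by
        intro B
        rw [slotPull, ← multiPull_mul]
        congr 1
        ext1 j
        by_cases hj : j = i
        · subst hj; simp [hi]
        · simp [hj]
      have comm : ∀ (B B' : End 𝕜 L), Commute B B' → Commute
          (multiPull (V := V) fun j : Fin p => if j ∈ s then B else 1) (slotPull i B') := by
        intro B B' hB
        refine commute_multiPull fun j => ?_
        by_cases hj : j = i
        · subst hj; simp [hi]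
        · simp [hj]
      have comm2 : Commute (multiPull (V := V) fun j : Fin p => if j ∈ s then A else 1)
          (multiPull (V := V) fun j : Fin p => if j ∈ s then S else 1) := by
        refine commute_multiPull fun j => ?_
        split_ifs
        · exact hc
        · exact Commute.refl _
      have comm3 : Commute (slotPull (V := V) i A) (slotPull i S) := by
        refine commute_multiPull fun j => ?_
        by_cases hj : j = i
        · subst hj; simpa using hc
        · simp [hj]
      rw [hstep, hstep]
      refine ⟨ih.1.mul_of_commute (comm S S (Commute.refl _)) (isSemisimple_slotPull i hS), ?_⟩
      set X := multiPull (V := V) fun j : Fin p => if j ∈ s then A else 1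
      set Y := multiPull (V := V) fun j : Fin p => if j ∈ s then S else 1
      -- The difference of products telescopes into two commuting nilpotent terms.
      have e : X * slotPull i A - Y * slotPull i S =
          (X - Y) * slotPull i A + Y * (slotPull i A - slotPull i S) := mul_sub_mul_eq _ _ _ _
      rw [e]
      have c1 := comm A A (Commute.refl _)
      have c2 := comm A S hc
      have c3 := comm S A hc.symm
      have c4 := comm S S (Commute.refl _)
      refine Commute.isNilpotent_add ?_ ((c1.sub_left c3).isNilpotent_mul_right ih.2)
        ((c3.sub_right c4).isNilpotent_mul_left ?_)
      · have d1 : Commute (X - Y) Y := comm2.sub_left (Commute.refl _)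
        have d2 : Commute (X - Y) (slotPull i A - slotPull i S) :=
          (c1.sub_left c3).sub_right (c2.sub_left c4)
        have d3 : Commute (slotPull (V := V) i A) (slotPull i A - slotPull i S) :=
          (Commute.refl _).sub_right comm3
        exact (d1.mul_right d2).mul_left (c3.symm.mul_right d3)
      · rw [← slotPull_sub]
        exact isNilpotent_slotPull i hn
  simpa using key Finset.univ

/-- Push the values of a multilinear map forward. -/
def multiPush (p : ℕ) : End ℂ V →ₐ[ℂ] End ℂ (MultilinearMap 𝕜 (fun _ : Fin p => L) V) where
  toFun T :=
    { toFun := fun φ => (T.restrictScalars 𝕜).compMultilinearMap φ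
      map_add' := fun φ η => by ext; simp
      map_smul' := fun a φ => by ext; simp }
  map_one' := rfl
  map_mul' _ _ := rfl
  map_zero' := rfl
  map_add' _ _ := rfl
  commutes' a := rfl

theorem commute_multiPush {p : ℕ} (T : End ℂ V) (A : Fin p → End 𝕜 L) :
    Commute (multiPush p T) (multiPull (V := V) A) := rfl

/-- The operator with the semisimple parts is semisimple, commutes with the original one and differs
from it by a nilpotent, since push and pull commute. It is therefore the semisimple part of the
original, and its eigenspaces are the generalised eigenspaces. This identifies Φ(c)-invariants with
generalised invariants. -/
theorem maxGenEigenspace_pullPush [FiniteDimensional 𝕜 ℂ] [FiniteDimensional ℂ V]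
    (T : End ℂ V) (A : End 𝕜 L) (p : ℕ) (a : ℂ) (c : ℂ) :
    (pullPush (a • T) A p).maxGenEigenspace c =
      (a • pullPush (semisimplePart T) (semisimplePart A) p).eigenspace c := by
  obtain ⟨hT1, hT2, hT3⟩ := semisimplePart_spec T
  obtain ⟨hA1, hA2, hA3⟩ := semisimplePart_spec A
  set Ts := semisimplePart T
  set As := semisimplePart A
  have hT4 : Commute T Ts := by
    have := (hT3.add_right (Commute.refl Ts)).symm
    rwa [sub_add_cancel] at this
  have hA4 : Commute A As := by
    have := (hA3.add_right (Commute.refl As)).symm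
    rwa [sub_add_cancel] at this
  have hfd : FiniteDimensional 𝕜 V := FiniteDimensional.trans 𝕜 ℂ V
  have hst : IsScalarTower 𝕜 ℂ (MultilinearMap 𝕜 (fun _ : Fin p => L) V) :=
    ⟨fun a c φ => by ext; simp⟩
  have hfd' : FiniteDimensional ℂ (MultilinearMap 𝕜 (fun _ : Fin p => L) V) :=
    Module.Finite.of_restrictScalars_finite 𝕜 ℂ _
  obtain ⟨h1, h2⟩ := multiPull_jordan (V := V) hA1 hA2 hA4 p
  let ι : (L [⋀^Fin p]→ₗ[𝕜] V) →ₗ[ℂ] MultilinearMap 𝕜 (fun _ : Fin p => L) V :=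
    AlternatingMap.toMultilinearMapLM (S := ℂ)
  have hι : Function.Injective ι := AlternatingMap.coe_multilinearMap_injective
  let Q : End ℂ V →ₐ[ℂ] End ℂ (MultilinearMap 𝕜 (fun _ : Fin p => L) V) := multiPush p
  have hQs : (Q Ts).IsSemisimple := by
    refine Module.End.isSemisimple_of_squarefree_aeval_eq_zero (p := minpoly ℂ Ts)
      hT1.minpoly_squarefree ?_
    rw [Polynomial.aeval_algHom_apply, minpoly.aeval, map_zero]
  have hss : (a • (Q Ts * multiPull fun _ => As)).IsSemisimple := by
    have := hQs.mul_of_commute (commute_multiPush Ts _) h1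
    have h3 : (algebraMap ℂ (End ℂ (MultilinearMap 𝕜 (fun _ : Fin p => L) V)) a).IsSemisimple := by
      refine Module.End.isSemisimple_of_squarefree_aeval_eq_zero
        (p := Polynomial.X - Polynomial.C a) ?_ (by simp)
      exact (Polynomial.irreducible_X_sub_C a).squarefree
    rw [Algebra.smul_def]
    exact h3.mul_of_commute (Algebra.commutes a _) this
  have hnil : IsNilpotent (a • (Q T * multiPull fun _ => A) - a • (Q Ts * multiPull fun _ => As)) := by
    set X := multiPull (V := V) fun _ : Fin p => A
    set Y := multiPull (V := V) fun _ : Fin p => As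
    have hXY : Commute X Y := commute_multiPull fun _ => hA4
    have hQQ : Commute (Q T) (Q Ts) := by
      rw [Commute, SemiconjBy, ← map_mul, ← map_mul, hT4.eq]
    have c0 : ∀ T, Commute (Q T) X := fun T => commute_multiPush T _
    have c0' : ∀ T, Commute (Q T) Y := fun T => commute_multiPush T _
    have e : a • (Q T * X) - a • (Q Ts * Y) = a • ((Q T - Q Ts) * X + Q Ts * (X - Y)) :=
      (smul_sub a (Q T * X) (Q Ts * Y)).symm.trans (congrArg (a • ·) (mul_sub_mul_eq _ _ _ _))
    rw [e]
    refine IsNilpotent.smul (Commute.isNilpotent_add ?_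
      (((c0 T).sub_left (c0 Ts)).isNilpotent_mul_right ?_)
      (((c0 Ts).sub_right (c0' Ts)).isNilpotent_mul_left h2)) a
    · have d1 : Commute (Q T - Q Ts) (Q Ts) := hQQ.sub_left (Commute.refl _)
      have d2 : Commute (Q T - Q Ts) (X - Y) :=
        ((c0 T).sub_left (c0 Ts)).sub_right ((c0' T).sub_left (c0' Ts))
      have d3 : Commute X (X - Y) := (Commute.refl _).sub_right hXY
      exact (d1.mul_right d2).mul_left ((c0 Ts).symm.mul_right d3)
    · rw [← map_sub]
      obtain ⟨n, hn⟩ := hT2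
      exact ⟨n, by rw [← map_pow, hn, map_zero]⟩
  refine maxGenEigenspace_eq_eigenspace_of_jordan
    (isSemisimple_of_intertwining ι hι (fun _ => rfl) hss)
    (isNilpotent_of_intertwining ι hι (fun _ => rfl) hnil) ?_ c
  rw [Commute, SemiconjBy, mul_smul_comm, smul_mul_assoc, ← pullPush_mul, ← pullPush_mul, hA4.eq,
    smul_mul_assoc, mul_smul_comm, hT4.eq]

end JordanCochains

/-! ### Fitting decompositions for a family with stable generalised eigenspaces. -/

section Fitting

open Module

variable {K M : Type*} [Field K] [AddCommGroup M] [Module K M] [FiniteDimensional K M]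

/-- Fitting's lemma for T - 1 on `W`. The exponent `N` is left free: exponent 1 serves for
representing classes, and a large one for lifting coboundaries. -/
theorem exists_fitting {T : End K M} {W : Submodule K M} (hW : ∀ w ∈ W, T w ∈ W) (N : ℕ) {w : M}
    (hw : w ∈ W) : ∃ w₁ ∈ W ⊓ T.maxGenEigenspace 1, ∃ ξ ∈ W, w = w₁ + ((T - 1) ^ N) ξ := by
  have hW' : ∀ w ∈ W, (T - 1) w ∈ W := fun w hw => W.sub_mem (hW w hw) hw
  set f : End K W := (T - 1).restrict hW' with hf
  have hpow : ∀ (k : ℕ) (x : W), (((f ^ k) x : W) : M) = ((T - 1) ^ k) (x : M) := by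
    intro k
    induction k with
    | zero => intro x; rfl
    | succ k ih =>
      intro x
      rw [pow_succ, pow_succ, Module.End.mul_apply, Module.End.mul_apply, ih]
      rfl
  obtain ⟨k, hk⟩ := Filter.eventually_atTop.1 f.eventually_codisjoint_ker_pow_range_pow
  have hcod := hk (k + N) (Nat.le_add_right _ _)
  have hmem : (⟨w, hw⟩ : W) ∈ LinearMap.ker (f ^ (k + N)) ⊔ LinearMap.range (f ^ (k + N)) := by
    rw [codisjoint_iff.1 hcod]; trivial
  obtain ⟨a, ha, b, ⟨c, rfl⟩, hab⟩ := Submodule.mem_sup.1 hmem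
  refine ⟨a, ⟨a.2, ?_⟩, ((f ^ k) c : W), ((f ^ k) c).2, ?_⟩
  · rw [SetLike.mem_coe, Module.End.mem_maxGenEigenspace]
    refine ⟨k + N, ?_⟩
    rw [one_smul, ← hpow, LinearMap.mem_ker.1 ha]
    rfl
  · rw [← hpow, ← Module.End.mul_apply, ← pow_add, add_comm N k]
    exact congrArg Subtype.val hab.symm

theorem eq_zero_of_mem_maxGenEigenspace_of_pow {T : End K M} {x y : M}
    (hx : x ∈ T.maxGenEigenspace 1) (h : ((T - 1) ^ finrank K M) y = x) : x = 0 := by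
  rw [Module.End.maxGenEigenspace_eq_genEigenspace_finrank, Module.End.mem_genEigenspace_nat,
    one_smul] at hx
  have hy : y ∈ T.maxGenEigenspace 1 := by
    rw [Module.End.mem_maxGenEigenspace]
    refine ⟨finrank K M + finrank K M, ?_⟩
    rw [one_smul, pow_add, Module.End.mul_apply, h]
    exact LinearMap.mem_ker.1 hx
  rw [Module.End.maxGenEigenspace_eq_genEigenspace_finrank, Module.End.mem_genEigenspace_nat,
    one_smul] at hy
  rw [← h]
  exact LinearMap.mem_ker.1 hy

/-- The common generalised eigenspace, for the eigenvalue one, of a family of endomorphisms. -/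
def genInvariants {ι : Type*} (T : ι → End K M) : Submodule K M :=
  ⨅ i, (T i).maxGenEigenspace 1

/-- Finite dimension replaces the infinite family by a finite one, which makes induction over its
members possible. -/
theorem exists_finset_genInvariants {ι : Type*} (T : ι → End K M) :
    ∃ s : Finset ι, (s.inf fun i => (T i).maxGenEigenspace 1) = genInvariants T := by
  obtain ⟨s, hs⟩ := Finset.exists_inf_le fun i => (T i).maxGenEigenspace 1
  refine ⟨s, le_antisymm (le_iInf hs) (Finset.le_inf fun i _ => iInf_le _ i)⟩

variable {ι : Type*} {T : ι → End K M}

theorem mapsTo_finset_inf (hT : ∀ i j, ∀ v ∈ (T i).maxGenEigenspace 1,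
    T j v ∈ (T i).maxGenEigenspace 1) (s : Finset ι) (j : ι) {v : M}
    (hv : v ∈ s.inf fun i => (T i).maxGenEigenspace 1) :
    T j v ∈ s.inf fun i => (T i).maxGenEigenspace 1 := by
  rw [Submodule.mem_finsetInf] at hv ⊢
  exact fun i hi => hT i j v (hv i hi)

/-- If the family acts trivially modulo `B` on `Z`, then each class is represented by a
generalised invariant. -/
theorem exists_genInvariant_sub_mem (hT : ∀ i j, ∀ v ∈ (T i).maxGenEigenspace 1,
    T j v ∈ (T i).maxGenEigenspace 1) {Z B : Submodule K M} (hZ : ∀ j, ∀ v ∈ Z, T j v ∈ Z)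
    (hB : ∀ j, ∀ v ∈ Z, T j v - v ∈ B) {z : M} (hz : z ∈ Z) :
    ∃ z' ∈ genInvariants T ⊓ Z, z - z' ∈ B := by
  classical
  obtain ⟨s, hs⟩ := exists_finset_genInvariants T
  rw [← hs]
  clear hs
  induction s using Finset.induction_on with
  | empty => exact ⟨z, ⟨by simp, hz⟩, by simp⟩
  | insert i s _ ih =>
    obtain ⟨z₁, ⟨h1, h1Z⟩, h2⟩ := ih
    -- With exponent 1 the discarded part is (T - 1)ξ with ξ in `Z`, hence lies in `B`. Stability
    -- keeps the conditions already achieved.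
    obtain ⟨w₁, ⟨hw₁, hw₁'⟩, ξ, hξ, hw⟩ := exists_fitting (T := T i)
      (W := (s.inf fun i => (T i).maxGenEigenspace 1) ⊓ Z)
      (fun w hw => ⟨mapsTo_finset_inf hT s i hw.1, hZ i w hw.2⟩) 1 (w := z₁) ⟨h1, h1Z⟩
    refine ⟨w₁, ⟨?_, hw₁.2⟩, ?_⟩
    · rw [Finset.inf_insert]
      exact ⟨hw₁', hw₁.1⟩
    · have : z - w₁ = (z - z₁) + (T i ξ - ξ) := by
        rw [hw, pow_one, LinearMap.sub_apply, Module.End.one_apply]; abel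
      rw [this]
      exact B.add_mem h2 (hB i ξ hξ.2)

/-- A generalised invariant in the image of an equivariant map comes from a generalised invariant. -/
theorem exists_genInvariant_map_eq {M' : Type*} [AddCommGroup M'] [Module K M']
    [FiniteDimensional K M'] {T' : ι → End K M'} (d : M →ₗ[K] M') (hd : ∀ i x, d (T i x) = T' i (d x))
    (hT : ∀ i j, ∀ v ∈ (T i).maxGenEigenspace 1, T j v ∈ (T i).maxGenEigenspace 1)
    {y : M} (hy : d y ∈ genInvariants T') : ∃ y' ∈ genInvariants T, d y' = d y := by
  classical
  obtain ⟨s, hs⟩ := exists_finset_genInvariants T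
  rw [← hs]
  clear hs
  have hdpow : ∀ i (n : ℕ) x, d (((T i - 1) ^ n) x) = ((T' i - 1) ^ n) (d x) := by
    intro i n
    induction n with
    | zero => intro x; rfl
    | succ n ih =>
      intro x
      rw [pow_succ, pow_succ, Module.End.mul_apply, Module.End.mul_apply, ih]
      simp [hd]
  induction s using Finset.induction_on with
  | empty => exact ⟨y, by simp, rfl⟩
  | insert i s _ ih =>
    obtain ⟨y₁, h1, h2⟩ := ih
    -- With exponent `finrank K M'`, the image of the discarded part is in the range of that power
    -- of T' - 1 as well as in the generalised eigenspace for 1, and these meet only in zero.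
    obtain ⟨w₁, ⟨hw₁, hw₁'⟩, ξ, hξ, hw⟩ := exists_fitting (T := T i)
      (W := (s.inf fun i => (T i).maxGenEigenspace 1))
      (fun w hw => mapsTo_finset_inf hT s i hw) (finrank K M') (w := y₁) h1
    refine ⟨w₁, ?_, ?_⟩
    · rw [Finset.inf_insert]
      exact ⟨hw₁', hw₁⟩
    · have h3 : d w₁ ∈ (T' i).maxGenEigenspace 1 := by
        rw [SetLike.mem_coe, Module.End.mem_maxGenEigenspace] at hw₁'
        rw [Module.End.mem_maxGenEigenspace]
        obtain ⟨k, hk⟩ := hw₁'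
        rw [one_smul] at hk
        exact ⟨k, by rw [one_smul, ← hdpow, hk, map_zero]⟩
      have h4 : d y - d w₁ ∈ (T' i).maxGenEigenspace 1 :=
        Submodule.sub_mem _ ((Submodule.mem_iInf _).1 hy i) h3
      have h5 : ((T' i - 1) ^ finrank K M') (d ξ) = d y - d w₁ := by
        rw [← hdpow, ← h2]
        conv_rhs => rw [hw, map_add, add_sub_cancel_left]
      exact (sub_eq_zero.1 (eq_zero_of_mem_maxGenEigenspace_of_pow h4 h5)).symm

end Fitting

/-! ### Criteria for quasi-isomorphisms and for finiteness in direct sums. -/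

section QuasiIso

variable {K : ℕ → Type*} [∀ p, AddCommGroup (K p)] [∀ p, Module ℂ (K p)]

theorem bijective_cohomologyInclusion {d : ∀ p, K p →ₗ[ℂ] K (p + 1)} {A : ∀ p, Submodule ℂ (K p)}
    (hA : IsSubcomplex d A)
    (hsurj : ∀ p, ∀ z, d p z = 0 → ∃ z' ∈ A p, d p z' = 0 ∧ z - z' ∈ coboundaries d p)
    (hinj : ∀ p, ∀ y, d p y ∈ A (p + 1) → ∃ y' ∈ A p, d p y' = d p y) (p : ℕ) :
    Function.Bijective (cohomologyInclusion hA p) := by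
  constructor
  · rw [injective_iff_map_eq_zero]
    intro x hx
    obtain ⟨⟨⟨x, hxA⟩, hxd⟩, rfl⟩ := Submodule.Quotient.mk_surjective _ x
    have hx' := (Submodule.Quotient.mk_eq_zero _).1 hx
    refine (Submodule.Quotient.mk_eq_zero _).2 ?_
    cases p with
    | zero =>
      have : x = 0 := hx'
      subst this
      exact Submodule.zero_mem _
    | succ p =>
      obtain ⟨y, hy⟩ := hx'
      have hy : d p y = x := hy
      obtain ⟨y', hy', h⟩ := hinj p y (hy ▸ hxA)
      exact ⟨⟨y', hy'⟩, Subtype.ext (h.trans hy)⟩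
  · intro x
    obtain ⟨⟨z, hz⟩, rfl⟩ := Submodule.Quotient.mk_surjective _ x
    obtain ⟨z', hz', hd, h⟩ := hsurj p z hz
    refine ⟨Submodule.Quotient.mk ⟨⟨z', hz'⟩, Subtype.ext hd⟩, ?_⟩
    refine (Submodule.Quotient.eq _).2 ?_
    have h2 := Submodule.neg_mem _ h
    rw [neg_sub] at h2
    exact h2

/-- Componentwise choices form an element of the direct sum because 0 may be chosen over 0, so the
support does not grow. -/
theorem exists_directSum_of_forall {ι : Type*} {β γ : ι → Type*} [∀ i, AddCommMonoid (β i)]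
    [∀ i, AddCommMonoid (γ i)] (P : ∀ i, β i → γ i → Prop) (h0 : ∀ i, P i 0 0) (x : ⨁ i, β i)
    (h : ∀ i, ∃ y, P i (x i) y) : ∃ y : ⨁ i, γ i, ∀ i, P i (x i) (y i) := by
  classical
  choose y hy using h
  refine ⟨DFinsupp.mk (DFinsupp.support x) fun i => y i, fun i => ?_⟩
  rw [DFinsupp.mk_apply]
  split_ifs with hi
  · exact hy i
  · rw [DFinsupp.notMem_support_iff.1 hi]
    exact h0 i

theorem mem_coboundaries_lmap {ι : Type*} {K : ι → ℕ → Type*} [∀ i p, AddCommGroup (K i p)]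
    [∀ i p, Module ℂ (K i p)] (d : ∀ i p, K i p →ₗ[ℂ] K i (p + 1)) (p : ℕ) (x : ⨁ i, K i p)
    (hx : ∀ i, x i ∈ coboundaries (d i) p) :
    x ∈ coboundaries (K := fun p => ⨁ i, K i p) (fun p => DirectSum.lmap fun i => d i p) p := by
  cases p with
  | zero =>
    have : x = 0 := by
      ext i
      exact hx i
    rw [this]
    exact Submodule.zero_mem _
  | succ p =>
    obtain ⟨y, hy⟩ := exists_directSum_of_forall (γ := fun i => K i p) (fun i b c => d i p c = b)
      (fun i => map_zero _) x hx
    refine ⟨y, ?_⟩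
    ext i
    exact hy i

/-- Subspaces of a direct sum which are finite-dimensional in each of finitely many summands. -/
theorem finite_of_forall_eq_zero {ι : Type*} {β : ι → Type*} [∀ i, AddCommGroup (β i)]
    [∀ i, Module ℂ (β i)] [∀ i, Module.Finite ℂ (β i)] {S : Set ι} (hS : S.Finite)
    (A : Submodule ℂ (⨁ i, β i)) (hA : ∀ x ∈ A, ∀ i ∉ S, x i = 0) : Module.Finite ℂ A := by
  have := hS.to_subtype
  let f : A →ₗ[ℂ] (∀ i : S, β i) :=
    LinearMap.pi fun i => (DirectSum.component ℂ ι β i) ∘ₗ A.subtype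
  refine Module.Finite.of_injective f ?_
  rw [injective_iff_map_eq_zero]
  intro x hx
  ext i
  by_cases hi : i ∈ S
  · exact congrFun hx ⟨i, hi⟩
  · exact hA x x.2 i hi

end QuasiIso


/-! ### Invariants of a nilpotent supplement compute the cohomology. -/

section Invariants

open Module

variable {𝕜 : Type*} [RCLike 𝕜] [NormedAlgebra 𝕜 ℂ] [FiniteDimensional 𝕜 ℂ]
  {E : Type*} [NormedAddCommGroup E] [NormedSpace 𝕜 E] [FiniteDimensional 𝕜 E]
  {G : Type*} [TopologicalSpace G] [ChartedSpace E G] [Group G] [LieGroup 𝓘(𝕜, E) ∞ G]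
  {V : Type*} [NormedAddCommGroup V] [NormedSpace ℂ V] [NormedSpace 𝕜 V]
  [IsScalarTower 𝕜 ℂ V] [FiniteDimensional ℂ V]

theorem smoothAtOne_twist {ρ : G →* (V →L[ℂ] V)}
    (hρ : ContMDiff 𝓘(𝕜, E) 𝓘(𝕜, V →L[ℂ] V) ∞ (fun g => ρ g)) (α : Characters 𝕜 E G) :
    SmoothAtOne 𝕜 E (twist α.1 ρ) := by
  have h1 : HasMFDerivAt 𝓘(𝕜, E) 𝓘(𝕜, V →L[ℂ] V) (fun g : G => ρ g) (1 : G)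
      (mfderiv 𝓘(𝕜, E) 𝓘(𝕜, V →L[ℂ] V) (fun g : G => ρ g) (1 : G) : E →L[𝕜] V →L[ℂ] V) :=
    (hρ.mdifferentiable (by simp) 1).hasMFDerivAt
  have h2 : HasMFDerivAt 𝓘(𝕜, E) 𝓘(𝕜, ℂ) (fun g : G => (α.1 g : ℂ)) (1 : G)
      (mfderiv 𝓘(𝕜, E) 𝓘(𝕜, ℂ) (fun g : G => (α.1 g : ℂ)) (1 : G) : E →L[𝕜] ℂ) :=
    (α.2.1.mdifferentiable (by simp) 1).hasMFDerivAt
  have h3 := (hasFDerivAt_chart_of_hasMFDerivAt h2).smul (hasFDerivAt_chart_of_hasMFDerivAt h1)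
  exact (hasMFDerivAt_of_chart (f := fun g : G => (α.1 g : ℂ) • ρ g) h3).mdifferentiableAt

variable (C : Subgroup G)

/-- The action of a subgroup on the summand of the character `α`. -/
abbrev summandRep (ρ : G →* (V →L[ℂ] V)) (α : Characters 𝕜 E G) (p : ℕ) (c : C) :
    End ℂ ((𝔤 𝕜 E G) [⋀^Fin p]→ₗ[𝕜] V) :=
  cochainRep 𝕜 E (twist α.1 ρ) p (c : G)

theorem mem_invariants_iff (ρ : G →* (V →L[ℂ] V)) (p : ℕ) (x : TotalCochains 𝕜 E G V p) :
    x ∈ invariants 𝕜 E ρ C p ↔ ∀ α, x α ∈ genInvariants (summandRep C ρ α p) := by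
  have key : ∀ (c : G) (α : Characters 𝕜 E G),
      Phi 𝕜 E ρ c p x α = x α ↔
        x α ∈ (cochainRep 𝕜 E (twist α.1 ρ) p c).maxGenEigenspace 1 := by
    intro c α
    have h1 : cochainRep 𝕜 E (twist α.1 ρ) p c =
      pullPush ((α.1 c : ℂ) • ((ρ c : V →L[ℂ] V) : End ℂ V)) (Ad 𝕜 E c⁻¹) p := rfl
    rw [h1, maxGenEigenspace_pullPush, Module.End.mem_eigenspace_iff, one_smul]
    rfl
  constructor
  · intro h α
    refine (Submodule.mem_iInf _).2 fun c => (key c α).1 ?_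
    rw [h c c.2]
  · intro h c hc
    ext1 α
    exact (key c α).2 ((Submodule.mem_iInf _).1 (h α) ⟨c, hc⟩)

theorem summandRep_mem_maxGenEigenspace {C : Subgroup G} (hC : IsNilpotentSupplement C)
    {ρ : G →* (V →L[ℂ] V)} {α : Characters 𝕜 E G} (hs : SmoothAtOne 𝕜 E (twist α.1 ρ))
    (p : ℕ) (i j : C) (c : ℂ) :
    ∀ v ∈ (summandRep C ρ α p i).maxGenEigenspace c,
      summandRep C ρ α p j v ∈ (summandRep C ρ α p i).maxGenEigenspace c := by
  intro v hv
  have hG : IsTopologicalGroup G := topologicalGroup_of_lieGroup 𝓘(𝕜, E) ∞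
  have h1 := hC.nilpotent
  have h2 : PreconnectedSpace C := Subtype.preconnectedSpace hC.connected.isPreconnected
  have h3 : CoeffContinuous ((cochainRep 𝕜 E (twist α.1 ρ) p).comp C.subtype) := fun l v =>
    (coeffContinuous_cochainRep hs p l v).comp continuous_subtype_val
  exact mem_maxGenEigenspace_of_isNilpotent h3 i c j hv

theorem alternatingMap_eq_zero_of_finrank_lt {p : ℕ} (hp : finrank 𝕜 E < p)
    (φ : (𝔤 𝕜 E G) [⋀^Fin p]→ₗ[𝕜] V) : φ = 0 := by
  ext v
  refine φ.map_linearDependent v fun h => ?_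
  have := h.fintype_card_le_finrank
  rw [Fintype.card_fin] at this
  exact absurd hp (not_lt.2 this)

theorem characters_ext {C : Subgroup G} (hC : IsNilpotentSupplement C) {α β : Characters 𝕜 E G}
    (h : ∀ c ∈ C, α.1 c = β.1 c) : α = β := by
  apply Subtype.ext
  ext g
  obtain ⟨c, hc, n, hn, rfl⟩ := hC.mul_eq g
  rw [map_mul, map_mul, α.2.2 n hn, β.2.2 n hn, h c hc]

theorem summandRep_eq_smul (ρ : G →* (V →L[ℂ] V)) (α : Characters 𝕜 E G) (p : ℕ) (c : C) :
    summandRep C ρ α p c = (α.1 c : ℂ) • cochainRep 𝕜 E ρ p (c : G) := by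
  ext φ v
  rfl

/-- The summand of α carries the action on ρ-valued cochains multiplied by α(c), so eigenvalue 1
there means eigenvalue α(c)⁻¹ for ρ. -/
theorem genInvariants_summandRep_le (ρ : G →* (V →L[ℂ] V)) (α : Characters 𝕜 E G) (p : ℕ) :
    genInvariants (summandRep C ρ α p) ≤
      ⨅ c : C, (cochainRep 𝕜 E ρ p (c : G)).maxGenEigenspace ((α.1 c)⁻¹ : ℂˣ) := by
  refine le_iInf fun c => (iInf_le _ c).trans fun v hv => ?_
  rw [Module.End.mem_maxGenEigenspace] at hv ⊢
  obtain ⟨k, hk⟩ := hv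
  refine ⟨k, ?_⟩
  have h : summandRep C ρ α p c - (1 : ℂ) • (1 : End ℂ ((𝔤 𝕜 E G) [⋀^Fin p]→ₗ[𝕜] V)) =
      (α.1 c : ℂ) • (cochainRep 𝕜 E ρ p (c : G) - (((α.1 c)⁻¹ : ℂˣ) : ℂ) • 1) := by
    rw [summandRep_eq_smul, smul_sub, smul_smul, Units.mul_inv]
  rw [h, smul_pow, LinearMap.smul_apply] at hk
  exact (smul_eq_zero.1 hk).resolve_left (pow_ne_zero _ (Units.ne_zero _))

theorem smoothAtOne_of_contMDiff {ρ : G →* (V →L[ℂ] V)}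
    (hρ : ContMDiff 𝓘(𝕜, E) 𝓘(𝕜, V →L[ℂ] V) ∞ (fun g => ρ g)) : SmoothAtOne 𝕜 E ρ :=
  hρ.mdifferentiable (by simp) 1

/-- All summands are compared within the one finite-dimensional space of ρ-valued cochains. Joint
generalised eigenspaces for distinct weights of C are independent, so only finitely many are
nonzero, and distinct characters give distinct weights by `characters_ext`. -/
theorem finite_setOf_genInvariants_ne_bot {C : Subgroup G} (hC : IsNilpotentSupplement C)
    {ρ : G →* (V →L[ℂ] V)} (hρ : ContMDiff 𝓘(𝕜, E) 𝓘(𝕜, V →L[ℂ] V) ∞ (fun g => ρ g)) (p : ℕ) :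
    {α : Characters 𝕜 E G | genInvariants (summandRep C ρ α p) ≠ ⊥}.Finite := by
  have hG : IsTopologicalGroup G := topologicalGroup_of_lieGroup 𝓘(𝕜, E) ∞
  have h1 := hC.nilpotent
  have h2 : PreconnectedSpace C := Subtype.preconnectedSpace hC.connected.isPreconnected
  have h3 : CoeffContinuous ((cochainRep 𝕜 E ρ p).comp C.subtype) := fun l v =>
    (coeffContinuous_cochainRep (smoothAtOne_of_contMDiff hρ) p l v).comp continuous_subtype_val
  have hind := Module.End.independent_iInf_maxGenEigenspace_of_forall_mapsTo
    (fun c : C => cochainRep 𝕜 E ρ p (c : G))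
    (fun i j c v hv => mem_maxGenEigenspace_of_isNilpotent h3 j c i hv)
  have hfin := WellFoundedGT.finite_ne_bot_of_iSupIndep hind
  refine Set.Finite.subset (hfin.preimage
    (f := fun (α : Characters 𝕜 E G) (c : C) => (((α.1 c)⁻¹ : ℂˣ) : ℂ)) ?_) ?_
  · intro α _ β _ hαβ
    refine characters_ext hC fun c hc => ?_
    have := congrFun hαβ ⟨c, hc⟩
    exact inv_injective (Units.ext this)
  · intro α hα hbot
    exact hα (le_bot_iff.1 ((genInvariants_summandRep_le C ρ α p).trans hbot.le))

/-- The invariants of a connected nilpotent supplement form a finite-dimensional subcomplex which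
computes the cohomology. -/
theorem isFiniteQuasiIsoSubcomplex_invariants [PreconnectedSpace G] {C : Subgroup G}
    (hC : IsNilpotentSupplement C) {ρ : G →* (V →L[ℂ] V)}
    (hρ : ContMDiff 𝓘(𝕜, E) 𝓘(𝕜, V →L[ℂ] V) ∞ (fun g => ρ g)) :
    IsFiniteQuasiIsoSubcomplex (totalDifferential 𝕜 E ρ) (invariants 𝕜 E ρ C) := by
  have hs := fun α : Characters 𝕜 E G => smoothAtOne_twist hρ α
  have hd : ∀ (α : Characters 𝕜 E G) p (c : C) x,
      ceDifferential (lieBilin 𝕜 E G) (derivedRep 𝕜 E (twist α.1 ρ)) p (summandRep C ρ α p c x) =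
      summandRep C ρ α (p + 1) c
        (ceDifferential (lieBilin 𝕜 E G) (derivedRep 𝕜 E (twist α.1 ρ)) p x) :=
    fun α p c x => ceDifferential_cochainRep (hs α) p c x
  have hsub : IsSubcomplex (totalDifferential 𝕜 E ρ) (invariants 𝕜 E ρ C) := by
    intro p x hx
    rw [mem_invariants_iff] at hx ⊢
    intro α
    refine (Submodule.mem_iInf _).2 fun c => ?_
    have h1 := (Submodule.mem_iInf _).1 (hx α) c
    rw [Module.End.mem_maxGenEigenspace] at h1 ⊢
    obtain ⟨k, hk⟩ := h1
    refine ⟨k, ?_⟩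
    have hpow : ∀ (k : ℕ) y,
        ceDifferential (lieBilin 𝕜 E G) (derivedRep 𝕜 E (twist α.1 ρ)) p
          (((summandRep C ρ α p c - (1 : ℂ) • 1) ^ k) y) =
        ((summandRep C ρ α (p + 1) c - (1 : ℂ) • 1) ^ k)
          (ceDifferential (lieBilin 𝕜 E G) (derivedRep 𝕜 E (twist α.1 ρ)) p y) := by
      intro k
      induction k with
      | zero => intro y; rfl
      | succ k ih =>
        intro y
        rw [pow_succ, pow_succ, Module.End.mul_apply, Module.End.mul_apply, ih, LinearMap.sub_apply,
          map_sub, hd, LinearMap.sub_apply, LinearMap.smul_apply, LinearMap.smul_apply, map_smul]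
        rfl
    exact (hpow k (x α)).symm.trans (by rw [hk, map_zero])
  have hfinp : ∀ p, Module.Finite ℂ (invariants 𝕜 E ρ C p) := fun p =>
    finite_of_forall_eq_zero (finite_setOf_genInvariants_ne_bot hC hρ p) _ fun x hx α hα => by
      have h1 := (mem_invariants_iff C ρ p x).1 hx α
      rw [Set.mem_ofPred_eq, not_not] at hα
      rw [hα] at h1
      exact h1
  refine ⟨hsub, ?_, bijective_cohomologyInclusion hsub ?_ ?_⟩
  -- Each degree is finite-dimensional by `hfinp`, and cochains vanish above the dimension of the
  -- group.
  · have h := finite_of_forall_eq_zero (β := fun p => invariants 𝕜 E ρ C p)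
      (Set.finite_Iic (finrank 𝕜 E)) ⊤ fun x _ p hp => by
        rw [Set.mem_Iic, not_le] at hp
        apply Subtype.ext
        ext1 α
        exact alternatingMap_eq_zero_of_finrank_lt hp ((x p).1 α)
    exact Module.Finite.equiv Submodule.topEquiv
  · intro p z hz
    obtain ⟨z', hz'⟩ := exists_directSum_of_forall
      (β := fun _ : Characters 𝕜 E G => (𝔤 𝕜 E G) [⋀^Fin p]→ₗ[𝕜] V)
      (γ := fun _ : Characters 𝕜 E G => (𝔤 𝕜 E G) [⋀^Fin p]→ₗ[𝕜] V)
      (fun α x y =>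
        y ∈ genInvariants (summandRep C ρ α p) ⊓
          LinearMap.ker (ceDifferential (lieBilin 𝕜 E G) (derivedRep 𝕜 E (twist α.1 ρ)) p) ∧
        x - y ∈ coboundaries (ceDifferential (lieBilin 𝕜 E G) (derivedRep 𝕜 E (twist α.1 ρ))) p)
      (fun α => ⟨Submodule.zero_mem _, by rw [sub_zero]; exact Submodule.zero_mem _⟩) z
      (fun α => by
        obtain ⟨y, hy, hy'⟩ := exists_genInvariant_sub_mem (T := summandRep C ρ α p)
          (fun i j => summandRep_mem_maxGenEigenspace hC (hs α) p i j 1)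
          (Z := LinearMap.ker (ceDifferential (lieBilin 𝕜 E G) (derivedRep 𝕜 E (twist α.1 ρ)) p))
          (B := coboundaries (ceDifferential (lieBilin 𝕜 E G) (derivedRep 𝕜 E (twist α.1 ρ))) p)
          (fun j v hv => by
            rw [LinearMap.mem_ker] at hv ⊢
            rw [hd, hv, map_zero])
          (fun j v hv => cochainRep_sub_mem_coboundaries (hs α) _ (LinearMap.mem_ker.1 hv))
          (z := z α) 
            (LinearMap.mem_ker.2 (congrArg (fun x : TotalCochains 𝕜 E G V (p + 1) => x α) hz))
        exact ⟨y, hy, hy'⟩)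
    refine ⟨z', (mem_invariants_iff C ρ p z').2 fun α => (hz' α).1.1, ?_, ?_⟩
    · ext1 α
      exact LinearMap.mem_ker.1 (hz' α).1.2
    · exact mem_coboundaries_lmap (ι := Characters 𝕜 E G)
        (K := fun _ p => (𝔤 𝕜 E G) [⋀^Fin p]→ₗ[𝕜] V)
        (fun α => ceDifferential (lieBilin 𝕜 E G) (derivedRep 𝕜 E (twist α.1 ρ))) p (z - z')
        fun α => (hz' α).2
  · intro p y hy
    have hy := (mem_invariants_iff C ρ (p + 1) _).1 hy
    obtain ⟨y', hy'⟩ := exists_directSum_of_forall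
      (β := fun _ : Characters 𝕜 E G => (𝔤 𝕜 E G) [⋀^Fin p]→ₗ[𝕜] V)
      (γ := fun _ : Characters 𝕜 E G => (𝔤 𝕜 E G) [⋀^Fin p]→ₗ[𝕜] V)
      (fun α x y => y ∈ genInvariants (summandRep C ρ α p) ∧
        ceDifferential (lieBilin 𝕜 E G) (derivedRep 𝕜 E (twist α.1 ρ)) p y =
        ceDifferential (lieBilin 𝕜 E G) (derivedRep 𝕜 E (twist α.1 ρ)) p x)
      (fun α => ⟨Submodule.zero_mem _, rfl⟩) y
      (fun α => exists_genInvariant_map_eq (T := summandRep C ρ α p)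
        (T' := summandRep C ρ α (p + 1)) _ (fun i x => hd α p i x)
          (fun i j => summandRep_mem_maxGenEigenspace hC (hs α) p i j 1) (hy α))
    refine ⟨y', (mem_invariants_iff C ρ p y').2 fun α => (hy' α).1, ?_⟩
    ext1 α
    exact (hy' α).2

end Invariants

/-! ### One-parameter subgroups as integral curves of left-invariant vector fields. -/

section OneParameter

open Filter Topology

variable {E : Type*} [NormedAddCommGroup E] [NormedSpace ℝ E]
  {G : Type*} [TopologicalSpace G] [ChartedSpace E G] [Group G] [LieGroup 𝓘(ℝ, E) ∞ G]

/-- The derivative at `1` of left translation by `g`. -/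
def leftTransl (E : Type*) [NormedAddCommGroup E] [NormedSpace ℝ E]
    {G : Type*} [TopologicalSpace G] [ChartedSpace E G] [Group G] (g : G) : E →L[ℝ] E :=
  mfderiv 𝓘(ℝ, E) 𝓘(ℝ, E) (fun x : G => g * x) (1 : G)

theorem leftTransl_one : leftTransl E (1 : G) = ContinuousLinearMap.id ℝ E := by
  have : (fun x : G => (1 : G) * x) = id := by ext; simp
  rw [leftTransl, this]
  exact mfderiv_id

theorem mfderiv_mul_left_comp_leftTransl (g h : G) :
    (mfderiv 𝓘(ℝ, E) 𝓘(ℝ, E) (fun x : G => g * x) h : E →L[ℝ] E).comp (leftTransl E h) =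
      leftTransl E (g * h) := by
  have h1 : HasMFDerivAt 𝓘(ℝ, E) 𝓘(ℝ, E) (fun x : G => g * x) (h * 1)
      (mfderiv 𝓘(ℝ, E) 𝓘(ℝ, E) (fun x : G => g * x) h : E →L[ℝ] E) := by
    rw [mul_one]; exact hasMFDerivAt_mul_left g h
  have h2 := HasMFDerivAt.comp (1 : G) h1 (hasMFDerivAt_mul_left (𝕜 := ℝ) (E := E) h 1)
  have h3 : (fun x : G => g * x) ∘ (fun x => h * x) = fun x => g * h * x := by
    ext x; simp [mul_assoc]
  rw [h3] at h2
  exact h2.mfderiv.symm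

/-- The curve `γ` has velocity `Y` at time `t`, within the set `s` of times. -/
def HasVelocityWithin (γ : ℝ → G) (s : Set ℝ) (t : ℝ) (Y : E) : Prop :=
  HasMFDerivWithinAt 𝓘(ℝ, ℝ) 𝓘(ℝ, E) γ s t ((1 : ℝ →L[ℝ] ℝ).smulRight Y : ℝ →L[ℝ] E)

/-- The curve `γ` has velocity `Y` at time `t`. -/
def HasVelocity (γ : ℝ → G) (t : ℝ) (Y : E) : Prop :=
  HasMFDerivAt 𝓘(ℝ, ℝ) 𝓘(ℝ, E) γ t ((1 : ℝ →L[ℝ] ℝ).smulRight Y : ℝ →L[ℝ] E)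

theorem hasVelocityWithin_univ {γ : ℝ → G} {t : ℝ} {Y : E} :
    HasVelocityWithin γ Set.univ t Y ↔ HasVelocity γ t Y := hasMFDerivWithinAt_univ

theorem HasVelocityWithin.mul_left {X : E} {γ : ℝ → G} {t : ℝ} {s : Set ℝ}
    (h : HasVelocityWithin γ s t (leftTransl E (γ t) X)) (g : G) :
    HasVelocityWithin (fun t => g * γ t) s t (leftTransl E (g * γ t) X) := by
  rw [← mfderiv_mul_left_comp_leftTransl]
  refine (HasMFDerivAt.comp_hasMFDerivWithinAt t
    (hasMFDerivAt_mul_left (𝕜 := ℝ) (E := E) g (γ t)) h).congr_mfderiv ?_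
  refine ContinuousLinearMap.ext fun r => ?_
  exact map_smul (mfderiv 𝓘(ℝ, E) 𝓘(ℝ, E) (fun x : G => g * x) (γ t) : E →L[ℝ] E) _ _

theorem HasVelocity.mul_left {X : E} {γ : ℝ → G} {t : ℝ}
    (h : HasVelocity γ t (leftTransl E (γ t) X)) (g : G) :
    HasVelocity (fun t => g * γ t) t (leftTransl E (g * γ t) X) :=
  hasVelocityWithin_univ.1 ((hasVelocityWithin_univ.2 h).mul_left g)

theorem HasVelocity.comp_of_hasFDerivAt_id {Y : E} {γ : ℝ → G} {t : ℝ} {f : ℝ → ℝ}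
    (h : HasVelocity γ (f t) Y) (hf : HasFDerivAt f (ContinuousLinearMap.id ℝ ℝ) t) :
    HasVelocity (fun t => γ (f t)) t Y :=
  HasMFDerivAt.comp t h hf.hasMFDerivAt

/-- A one-parameter subgroup with initial velocity `X`. -/
structure IsOneParam (γ : ℝ → G) (X : E) : Prop where
  map_add : ∀ s t, γ (s + t) = γ s * γ t
  velocity : HasVelocity γ 0 X

theorem IsOneParam.map_zero {γ : ℝ → G} {X : E} (h : IsOneParam γ X) : γ 0 = 1 := by
  have := h.map_add 0 0
  rw [add_zero] at this
  exact left_eq_mul.1 this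

theorem IsOneParam.hasVelocity {γ : ℝ → G} {X : E} (h : IsOneParam γ X) (t : ℝ) :
    HasVelocity γ t (leftTransl E (γ t) X) := by
  have h0 : HasVelocity γ (t - t) (leftTransl E (γ (t - t)) X) := by
    rw [sub_self, h.map_zero, leftTransl_one]
    exact h.velocity
  have h1 := (h0.mul_left (γ t)).comp_of_hasFDerivAt_id (t := t) (f := fun s => s - t)
    ((hasFDerivAt_id t).sub_const t)
  have h4 : (fun s => γ t * γ (s - t)) = γ := by
    ext s
    rw [← h.map_add, add_sub_cancel]
  rw [h4, ← h.map_add, sub_self, add_zero] at h1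
  exact h1

theorem IsOneParam.continuous {γ : ℝ → G} {X : E} (h : IsOneParam γ X) : Continuous γ :=
  continuous_iff_continuousAt.2 fun t => HasMFDerivAt.continuousAt (h.hasVelocity t)

theorem t2Space_of_lieGroup (E : Type*) [NormedAddCommGroup E] [NormedSpace ℝ E]
    (G : Type*) [TopologicalSpace G] [ChartedSpace E G] [Group G] [LieGroup 𝓘(ℝ, E) ∞ G] :
    T2Space G := by
  have h1 : IsTopologicalGroup G := topologicalGroup_of_lieGroup 𝓘(ℝ, E) ∞
  have h2 : T1Space G := ChartedSpace.t1Space E G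
  infer_instance

variable [FiniteDimensional ℝ E]

theorem contMDiff_leftInvariant (X : E) :
    ContMDiff 𝓘(ℝ, E) (𝓘(ℝ, E).tangent) 1
      (fun g : G => (⟨g, mulInvariantVectorField (I := 𝓘(ℝ, E)) X g⟩ : TangentBundle 𝓘(ℝ, E) G)) := by
  have : CompleteSpace E := FiniteDimensional.complete ℝ E
  have : LieGroup 𝓘(ℝ, E) (minSmoothness ℝ 3) G := by
    rw [minSmoothness_of_isRCLikeNormedField]; infer_instance
  refine (contMDiff_mulInvariantVectorField (I := 𝓘(ℝ, E)) (G := G) X).of_le ?_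
  rw [minSmoothness_of_isRCLikeNormedField]
  norm_num

theorem eq_of_hasVelocity {X : E} {γ δ : ℝ → G}
    (hγ : ∀ t, HasVelocity γ t (leftTransl E (γ t) X))
    (hδ : ∀ t, HasVelocity δ t (leftTransl E (δ t) X)) (h : γ 0 = δ 0) : γ = δ := by
  have := t2Space_of_lieGroup E G
  have : CompleteSpace E := FiniteDimensional.complete ℝ E
  have : IsManifold 𝓘(ℝ, E) 1 G := IsManifold.of_le (n := ∞) (by exact_mod_cast le_top)
  exact isMIntegralCurve_Ioo_eq_of_contMDiff_boundaryless (t₀ := 0)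
    (contMDiff_leftInvariant (G := G) X) hγ hδ h

theorem IsOneParam.unique {X : E} {γ δ : ℝ → G} (hγ : IsOneParam γ X) (hδ : IsOneParam δ X) :
    γ = δ :=
  eq_of_hasVelocity hγ.hasVelocity hδ.hasVelocity (by rw [hγ.map_zero, hδ.map_zero])

variable (G) in
-- Left translates of a local integral curve at 1 have the same lifetime ε at every point, so
-- integral curves extend to all times. Additivity is uniqueness applied to t ↦ γ(s + t) and t ↦
-- γ(s)γ(t).
theorem exists_isOneParam (X : E) : ∃ γ : ℝ → G, IsOneParam γ X := by
  have := t2Space_of_lieGroup E G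
  have : CompleteSpace E := FiniteDimensional.complete ℝ E
  have : IsManifold 𝓘(ℝ, E) 1 G := IsManifold.of_le (n := ∞) (by exact_mod_cast le_top)
  have hv := contMDiff_leftInvariant (G := G) X
  obtain ⟨γ₀, h0, h1⟩ := exists_isMIntegralCurveAt_of_contMDiffAt_boundaryless (t₀ := 0)
    (hv.contMDiffAt (x := (1 : G)))
  obtain ⟨ε, hε, h2⟩ := isMIntegralCurveAt_iff'.1 h1
  rw [Real.ball_eq_Ioo, zero_sub, zero_add] at h2
  have h2 : ∀ t ∈ Set.Ioo (-ε) ε, HasVelocityWithin γ₀ (Set.Ioo (-ε) ε) t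
    (leftTransl E (γ₀ t) X) := h2
  obtain ⟨γ, h3, h4⟩ := exists_isMIntegralCurve_of_isMIntegralCurveOn hv hε (fun g =>
    ⟨fun t => g * γ₀ t, by simp [h0], fun t ht => (h2 t ht).mul_left g⟩) 1
  have h4 : ∀ t, HasVelocity γ t (leftTransl E (γ t) X) := h4
  refine ⟨γ, fun s t => ?_, ?_⟩
  · exact congrFun (eq_of_hasVelocity (X := X) (γ := fun t => γ (s + t))
      (δ := fun t => γ s * γ t)
      (fun t => (h4 (s + t)).comp_of_hasFDerivAt_id (f := fun t => s + t)
        ((hasFDerivAt_id t).const_add s))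
      (fun t => (h4 t).mul_left (γ s)) (by simp [h3])) t
  · have := h4 0
    rwa [h3, leftTransl_one] at this

theorem IsOneParam.conj {γ : ℝ → G} {X : E} (h : IsOneParam γ X) (g : G) :
    IsOneParam (fun t => g * γ t * g⁻¹) (adL ℝ E g X) := by
  refine ⟨fun s t => by rw [h.map_add]; group, ?_⟩
  have h1 : HasMFDerivAt 𝓘(ℝ, E) 𝓘(ℝ, E) (fun x : G => g * x * g⁻¹) (γ 0) (adL ℝ E g) := by
    rw [h.map_zero]; exact hasMFDerivAt_conj_one g
  refine (HasMFDerivAt.comp (0 : ℝ) h1 h.velocity).congr_mfderiv ?_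
  refine ContinuousLinearMap.ext fun r => ?_
  exact map_smul (adL ℝ E g) _ _

theorem IsOneParam.hasDerivAt_adL {γ : ℝ → G} {X : E} (h : IsOneParam γ X) (t : ℝ) :
    HasDerivAt (fun t => adL ℝ E (γ t)) ((adL ℝ E (γ t)).comp (adD ℝ E G X)) t := by
  have : CompleteSpace E := FiniteDimensional.complete ℝ E
  have h1 : HasMFDerivAt 𝓘(ℝ, E) 𝓘(ℝ, E →L[ℝ] E) (fun g : G => adL ℝ E g) (γ 0) (adD ℝ E G) := by
    rw [h.map_zero]; exact hasMFDerivAt_adL_one G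
  have h2 : HasFDerivAt (fun t => adL ℝ E (γ t)) ((1 : ℝ →L[ℝ] ℝ).smulRight (adD ℝ E G X)) 0 := by
    refine (HasMFDerivAt.comp (0 : ℝ) h1 h.velocity).hasFDerivAt.congr_fderiv ?_
    refine ContinuousLinearMap.ext fun r => ?_
    exact map_smul (adD ℝ E G) _ _
  have h3 : HasDerivAt (fun t => adL ℝ E (γ t)) (adD ℝ E G X) (t - t) := by
    rw [sub_self]
    exact h2.hasDerivAt.congr_deriv (by simp)
  have h4 := (HasDerivAt.comp_sub_const t t h3)
  have h5 := ((ContinuousLinearMap.compL ℝ E E E (adL ℝ E (γ t))).hasFDerivAt).comp_hasDerivAt t h4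
  have h6 : (fun s => adL ℝ E (γ s)) =
      fun s => ContinuousLinearMap.compL ℝ E E E (adL ℝ E (γ t)) (adL ℝ E (γ (s - t))) := by
    ext1 s
    rw [ContinuousLinearMap.compL_apply, ← adL_mul, ← h.map_add, add_sub_cancel]
  rw [h6]
  exact h5

end OneParameter

/-! ### The connected subgroup generated by a nilpotent subalgebra. -/

section ExpSubgroup

open Filter Topology
open scoped commutatorElement

variable {E : Type*} [NormedAddCommGroup E] [NormedSpace ℝ E]
  {G : Type*} [TopologicalSpace G] [ChartedSpace E G] [Group G] [LieGroup 𝓘(ℝ, E) ∞ G]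

theorem adL_mul_apply (g h : G) (X : E) : adL ℝ E (g * h) X = adL ℝ E g (adL ℝ E h X) := by
  rw [adL_mul]; rfl

theorem adL_inv_apply (g : G) (X : E) : adL ℝ E g⁻¹ (adL ℝ E g X) = X := by
  rw [← adL_mul_apply, inv_mul_cancel, adL_one]; rfl

theorem IsOneParam.inv {γ : ℝ → G} {X : E} (h : IsOneParam γ X) (t : ℝ) : (γ t)⁻¹ = γ (-t) :=
  inv_eq_of_mul_eq_one_right (by rw [← h.map_add, add_neg_cancel, h.map_zero])

/-- A flag showing that a subspace of the Lie algebra is a nilpotent subalgebra. -/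
structure IsNilFlag (G : Type*) [TopologicalSpace G] [ChartedSpace E G] [Group G]
    (F : ℕ → Submodule ℝ E) (n : ℕ) : Prop where
  antitone : Antitone F
  bracket_mem : ∀ X ∈ F 0, ∀ i, ∀ Y ∈ F i, adD ℝ E G X Y ∈ F (i + 1)
  eq_bot : F n = ⊥

/-- The subgroup generated by the one-parameter subgroups tangent to a subspace. -/
def expSubgroup (G : Type*) [TopologicalSpace G] [ChartedSpace E G] [Group G]
    (𝔥 : Submodule ℝ E) : Subgroup G :=
  Subgroup.closure {g | ∃ X ∈ 𝔥, ∃ γ : ℝ → G, IsOneParam γ X ∧ ∃ t, γ t = g}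

theorem IsOneParam.mem_expSubgroup {γ : ℝ → G} {X : E} (h : IsOneParam γ X) {𝔥 : Submodule ℝ E}
    (hX : X ∈ 𝔥) (t : ℝ) : γ t ∈ expSubgroup G 𝔥 :=
  Subgroup.subset_closure ⟨X, hX, γ, h, t, rfl⟩

theorem isConnected_expSubgroup (𝔥 : Submodule ℝ E) :
    IsConnected (expSubgroup G 𝔥 : Set G) := by
  have hG : IsTopologicalGroup G := topologicalGroup_of_lieGroup 𝓘(ℝ, E) ∞
  refine ⟨⟨1, Subgroup.one_mem _⟩, isPreconnected_subgroup_closure _ ?_⟩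
  rintro _ ⟨X, hX, γ, hγ, t, rfl⟩
  refine ⟨Set.range γ, ?_, isPreconnected_range hγ.continuous, ⟨0, hγ.map_zero⟩, ⟨t, rfl⟩⟩
  rintro _ ⟨s, rfl⟩
  exact hγ.mem_expSubgroup hX s

variable [FiniteDimensional ℝ E]

theorem normal_expSubgroup {𝔥 : Submodule ℝ E} (h𝔥 : ∀ g : G, ∀ X ∈ 𝔥, adL ℝ E g X ∈ 𝔥) :
    (expSubgroup G 𝔥).Normal := by
  refine ⟨fun n hn g => ?_⟩
  induction hn using Subgroup.closure_induction with
  | mem x hx =>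
    obtain ⟨X, hX, γ, hγ, t, rfl⟩ := hx
    exact (hγ.conj g).mem_expSubgroup (h𝔥 g X hX) t
  | one => rw [mul_one, mul_inv_cancel]; exact Subgroup.one_mem _
  | mul x y _ _ hx hy =>
    have : g * (x * y) * g⁻¹ = (g * x * g⁻¹) * (g * y * g⁻¹) := by group
    rw [this]
    exact Subgroup.mul_mem _ hx hy
  | inv x _ hx =>
    have : g * x⁻¹ * g⁻¹ = (g * x * g⁻¹)⁻¹ := by group
    rw [this]
    exact Subgroup.inv_mem _ hx

/-- The derivative of Ad(γ(s))Y is Ad(γ(s))[X, Y], where [X, Y] lies one step deeper in the flag. By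
induction from the bottom it stays there, so functionals vanishing on that step are constant along
Ad(γ(s))Y. The number `k` bounds the distance to the bottom. -/
theorem IsOneParam.adL_sub_mem {F : ℕ → Submodule ℝ E} {n : ℕ} (hF : IsNilFlag G F n) {γ : ℝ → G}
    {X : E} (hγ : IsOneParam γ X) (hX : X ∈ F 0) (t : ℝ) (k : ℕ) :
    ∀ i, n ≤ i + k → ∀ Y ∈ F i, adL ℝ E (γ t) Y - Y ∈ F (i + 1) := by
  induction k generalizing t with
  | zero =>
    intro i hi Y hY
    have : Y ∈ F n := hF.antitone (by omega) hY
    rw [hF.eq_bot, Submodule.mem_bot] at this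
    rw [this, _root_.map_zero, sub_zero]
    exact Submodule.zero_mem _
  | succ k ih =>
    intro i hi Y hY
    have hXY : adD ℝ E G X Y ∈ F (i + 1) := hF.bracket_mem X hX i Y hY
    rw [← Subspace.forall_mem_dualAnnihilator_apply_eq_zero_iff]
    intro l hl
    have hl := (Submodule.mem_dualAnnihilator l).1 hl
    have hd : ∀ s, HasDerivAt (fun s => l.toContinuousLinearMap (adL ℝ E (γ s) Y)) 0 s := by
      intro s
      have h1 := (hγ.hasDerivAt_adL s).clm_apply (hasDerivAt_const s Y)
      have h2 := l.toContinuousLinearMap.hasFDerivAt.comp_hasDerivAt s h1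
      refine h2.congr_deriv ?_
      rw [_root_.map_zero, add_zero]
      refine hl _ ?_
      have h4 := (F (i + 1)).add_mem
        (hF.antitone (Nat.le_succ _) (ih s (i + 1) (by omega) _ hXY)) hXY
      rwa [sub_add_cancel] at h4
    have h5 := is_const_of_deriv_eq_zero (fun s => (hd s).differentiableAt) (fun s => (hd s).deriv) t 0
    rw [_root_.map_sub, sub_eq_zero]
    rw [hγ.map_zero, adL_one] at h5
    exact h5

theorem adL_sub_mem_of_mem_expSubgroup {F : ℕ → Submodule ℝ E} {n : ℕ} (hF : IsNilFlag G F n) {g : G}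
    (hg : g ∈ expSubgroup G (F 0)) : ∀ i, ∀ Y ∈ F i, adL ℝ E g Y - Y ∈ F (i + 1) := by
  induction hg using Subgroup.closure_induction'' with
  | mem x hx =>
    obtain ⟨X, hX, γ, hγ, t, rfl⟩ := hx
    exact fun i => hγ.adL_sub_mem hF hX t n i (Nat.le_add_left _ _)
  | inv_mem x hx =>
    obtain ⟨X, hX, γ, hγ, t, rfl⟩ := hx
    rw [hγ.inv]
    exact fun i => hγ.adL_sub_mem hF hX (-t) n i (Nat.le_add_left _ _)
  | one =>
    intro i Y _
    rw [adL_one]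
    change Y - Y ∈ _
    rw [sub_self]
    exact Submodule.zero_mem _
  | mul x y _ _ hx hy =>
    intro i Y hY
    have h1 := hF.antitone (Nat.le_succ _) (hx (i + 1) _ (hy i Y hY))
    have : adL ℝ E (x * y) Y - Y = (adL ℝ E x (adL ℝ E y Y - Y) - (adL ℝ E y Y - Y)) +
        (adL ℝ E x Y - Y) + (adL ℝ E y Y - Y) := by
      rw [adL_mul_apply, map_sub]; abel
    rw [this]
    exact Submodule.add_mem _ (Submodule.add_mem _ h1 (hx i Y hY)) (hy i Y hY)

theorem adL_mem_of_mem_expSubgroup {F : ℕ → Submodule ℝ E} {n : ℕ} (hF : IsNilFlag G F n) {g : G}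
    (hg : g ∈ expSubgroup G (F 0)) (i : ℕ) {Y : E} (hY : Y ∈ F i) : adL ℝ E g Y ∈ F i := by
  have := (F i).add_mem (hF.antitone (Nat.le_succ _) (adL_sub_mem_of_mem_expSubgroup hF hg i Y hY)) hY
  rwa [sub_add_cancel] at this

/-- Conjugating a one-parameter subgroup by g gives one with the same initial velocity, hence the
same one. -/
theorem commute_of_adL_eq {𝔥 : Submodule ℝ E} {g : G} (hg : ∀ X ∈ 𝔥, adL ℝ E g X = X) {h : G}
    (hh : h ∈ expSubgroup G 𝔥) : g * h = h * g := by
  have hle : expSubgroup G 𝔥 ≤ Subgroup.centralizer {g} := by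
    rw [expSubgroup, Subgroup.closure_le]
    rintro _ ⟨X, hX, γ, hγ, t, rfl⟩
    rw [SetLike.mem_coe, Subgroup.mem_centralizer_singleton_iff]
    have h1 := hγ.conj g
    rw [hg X hX] at h1
    have h2 := congrFun (h1.unique hγ) t
    have h2 : g * γ t * g⁻¹ = γ t := h2
    rw [mul_inv_eq_iff_eq_mul] at h2
    exact h2.symm
  exact (Subgroup.mem_centralizer_singleton_iff.1 (hle hh)).symm

/-- The terms of a central series of the group belonging to a nilpotent Lie algebra. -/
def flagSeries {F : ℕ → Submodule ℝ E} {n : ℕ} (hF : IsNilFlag G F n) (k : ℕ) :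
    Subgroup (expSubgroup G (F 0)) where
  -- Acting trivially on the flag only makes g central. The second condition adds one last step, at
  -- index `n + 1`, where the series becomes trivial.
  carrier := {g | (∀ i, ∀ Y ∈ F i, adL ℝ E (g : G) Y - Y ∈ F (i + (k + 1))) ∧ (n < k → g = 1)}
  one_mem' := by
    refine ⟨fun i Y _ => ?_, fun _ => rfl⟩
    rw [OneMemClass.coe_one, adL_one]
    change Y - Y ∈ _
    rw [sub_self]
    exact Submodule.zero_mem _
  mul_mem' := by
    rintro x y ⟨hx, hx'⟩ ⟨hy, hy'⟩
    refine ⟨fun i Y hY => ?_, fun h => by rw [hx' h, hy' h, mul_one]⟩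
    have : adL ℝ E (x * y : G) Y - Y = adL ℝ E (x : G) (adL ℝ E (y : G) Y - Y) +
        (adL ℝ E (x : G) Y - Y) := by
      rw [adL_mul_apply, map_sub]; abel
    rw [Subgroup.coe_mul, this]
    exact Submodule.add_mem _ (adL_mem_of_mem_expSubgroup hF x.2 _ (hy i Y hY)) (hx i Y hY)
  inv_mem' := by
    rintro x ⟨hx, hx'⟩
    refine ⟨fun i Y hY => ?_, fun h => by rw [hx' h, inv_one]⟩
    have : adL ℝ E (x : G)⁻¹ Y - Y = -adL ℝ E (x : G)⁻¹ (adL ℝ E (x : G) Y - Y) := by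
      rw [map_sub, adL_inv_apply]; abel
    rw [Subgroup.coe_inv, this]
    exact Submodule.neg_mem _ (adL_mem_of_mem_expSubgroup hF (Subgroup.inv_mem _ x.2) _ (hx i Y hY))

/-- The subgroup belonging to a nilpotent Lie algebra is nilpotent. -/
theorem isNilpotent_expSubgroup {F : ℕ → Submodule ℝ E} {n : ℕ} (hF : IsNilFlag G F n) :
    Group.IsNilpotent (expSubgroup G (F 0)) := by
  rw [Subgroup.nilpotent_iff_finite_descending_central_series]
  refine ⟨n + 1, flagSeries hF, ⟨?_, ?_⟩, ?_⟩
  · rw [eq_top_iff]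
    intro g _
    exact ⟨fun i Y hY => by rw [zero_add]; exact adL_sub_mem_of_mem_expSubgroup hF g.2 i Y hY,
      fun h => absurd h (Nat.not_lt_zero n)⟩
  · rintro x k ⟨hx, hx'⟩ g
    refine ⟨fun i Y hY => ?_, fun h => ?_⟩
    -- With Y = gxZ one gets [x, g]Y - Y = xgZ - gxZ, the commutator of x - 1 and g - 1 applied to
    -- Z. These lower the flag by k + 1 and by 1.
    · obtain ⟨Z, hZi, hZ⟩ : ∃ Z ∈ F i, Y = adL ℝ E (g : G) (adL ℝ E (x : G) Z) := by
        refine ⟨adL ℝ E (x : G)⁻¹ (adL ℝ E (g : G)⁻¹ Y), adL_mem_of_mem_expSubgroup hF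
          (Subgroup.inv_mem _ x.2) i (adL_mem_of_mem_expSubgroup hF (Subgroup.inv_mem _ g.2) i hY), ?_⟩
        have h1 := adL_inv_apply (x : G)⁻¹ (adL ℝ E (g : G)⁻¹ Y)
        have h2 := adL_inv_apply (g : G)⁻¹ Y
        rw [inv_inv] at h1 h2
        rw [h1, h2]
      have e1 : adL ℝ E ((⁅x, g⁆ : expSubgroup G (F 0)) : G) Y =
          adL ℝ E (x : G) (adL ℝ E (g : G) Z) := by
        rw [hZ, ← adL_mul_apply, ← adL_mul_apply, ← adL_mul_apply]
        have : ((⁅x, g⁆ : expSubgroup G (F 0)) : G) * (g * x) = x * g := by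
          simp [commutatorElement_def]
        rw [← mul_assoc] at this
        rw [this]
      rw [e1]
      have e2 : adL ℝ E (x : G) (adL ℝ E (g : G) Z) - Y =
          (adL ℝ E (x : G) (adL ℝ E (g : G) Z - Z) - (adL ℝ E (g : G) Z - Z)) -
          (adL ℝ E (g : G) (adL ℝ E (x : G) Z - Z) - (adL ℝ E (x : G) Z - Z)) := by
        rw [hZ, map_sub, map_sub]; abel
      rw [e2]
      have h1 := adL_sub_mem_of_mem_expSubgroup hF g.2 _ _ (hx i Z hZi)
      have h2 := hx _ _ (adL_sub_mem_of_mem_expSubgroup hF g.2 i Z hZi)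
      have e3 : i + (k + 1 + 1) = i + (k + 1) + 1 := by ring
      have e4 : i + 1 + (k + 1) = i + (k + 1) + 1 := by ring
      rw [e4] at h2
      rw [e3]
      exact Submodule.sub_mem _ h2 h1
    · have hc : g * x = x * g := by
        apply Subtype.ext
        refine (commute_of_adL_eq (𝔥 := F 0) (fun X hX => ?_) g.2).symm
        have h1 := hx 0 X hX
        have h2 : F (0 + (k + 1)) = ⊥ := by
          rw [eq_bot_iff, ← hF.eq_bot]
          exact hF.antitone (by omega)
        rw [h2, Submodule.mem_bot, sub_eq_zero] at h1
        exact h1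
      exact commutatorElement_eq_one_iff_mul_comm.2 hc.symm
  · rw [eq_bot_iff]
    rintro x ⟨_, hx⟩
    exact hx (Nat.lt_succ_self n)

end ExpSubgroup

/-! ### A nilpotent subalgebra complementing the commutators. -/

section NilpotentSupplement

open Module

/-- A Lie algebra has a nilpotent subalgebra which spans it together with the commutators. -/
theorem exists_nilpotent_subalgebra_sup_commutator (L : Type*) [LieRing L] [LieAlgebra ℝ L]
    [FiniteDimensional ℝ L] :
    ∃ (F : ℕ → Submodule ℝ L) (n : ℕ), Antitone F ∧
      (∀ X ∈ F 0, ∀ i, ∀ Y ∈ F i, ⁅X, Y⁆ ∈ F (i + 1)) ∧ F n = ⊥ ∧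
      F 0 ⊔ Submodule.span ℝ {Z | ∃ X Y : L, ⁅X, Y⁆ = Z} = ⊤ := by
  obtain ⟨x, hx⟩ := LieAlgebra.exists_isCartanSubalgebra_engel ℝ L
  set H := LieSubalgebra.engel ℝ x with hH
  have hn : LieRing.IsNilpotent H := hx.nilpotent
  obtain ⟨n, hn⟩ := (LieModule.isNilpotent_iff ℝ H H).1 hn
  refine ⟨fun k => (LieModule.lowerCentralSeries ℝ H H k).toSubmodule.map H.toSubmodule.subtype,
    n, ?_, ?_, ?_, ?_⟩
  · intro i j hij
    exact Submodule.map_mono (LieModule.antitone_lowerCentralSeries ℝ H H hij)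
  · rintro _ ⟨X, _, rfl⟩ i _ ⟨Y, hY, rfl⟩
    let X' : H := X
    let Y' : H := Y
    refine ⟨⁅X', Y'⁆, ?_, rfl⟩
    have h : ⁅X', Y'⁆ ∈ LieModule.lowerCentralSeries ℝ H H (i + 1) := by
      rw [LieModule.lowerCentralSeries_succ]
      exact LieSubmodule.lie_mem_lie (LieSubmodule.mem_top X') hY
    exact h
  · simp only [hn]
    simp
  · rw [eq_top_iff]
    intro y _
    -- Fitting's decomposition for ad x: the kernel of a power lies in the Engel subalgebra. The
    -- exponent `k + 1` ensures that the range consists of commutators with x.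
    obtain ⟨k, hk⟩ := Filter.eventually_atTop.1
      (LieAlgebra.ad ℝ L x).eventually_codisjoint_ker_pow_range_pow
    have hcod := hk (k + 1) (Nat.le_succ k)
    have hmem : y ∈ LinearMap.ker (LieAlgebra.ad ℝ L x ^ (k + 1)) ⊔
        LinearMap.range (LieAlgebra.ad ℝ L x ^ (k + 1)) := by
      rw [codisjoint_iff.1 hcod]; trivial
    obtain ⟨a, ha, b, ⟨c, rfl⟩, rfl⟩ := Submodule.mem_sup.1 hmem
    refine Submodule.add_mem_sup ?_ (Submodule.subset_span
      ⟨x, (LieAlgebra.ad ℝ L x ^ k) c, ?_⟩)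
    · have haH : a ∈ H := (LieSubalgebra.mem_engel_iff ℝ x a).2 ⟨k + 1, ha⟩
      refine ⟨⟨a, haH⟩, ?_, rfl⟩
      simp
    · rw [pow_succ']
      rfl

variable {E : Type*} [NormedAddCommGroup E] [NormedSpace ℝ E] [FiniteDimensional ℝ E]
  (G : Type*) [TopologicalSpace G] [ChartedSpace E G] [Group G] [LieGroup 𝓘(ℝ, E) ∞ G]

variable (E) in
/-- The span of the commutators of the Lie algebra. -/
def commutatorSpan : Submodule ℝ E := Submodule.span ℝ {Z | ∃ X Y : E, adD ℝ E G X Y = Z}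

theorem adD_mem_commutatorSpan (X Y : E) : adD ℝ E G X Y ∈ commutatorSpan E G :=
  Submodule.subset_span ⟨X, Y, rfl⟩

theorem adL_mem_commutatorSpan (g : G) {X : E} (hX : X ∈ commutatorSpan E G) :
    adL ℝ E g X ∈ commutatorSpan E G := by
  have : CompleteSpace E := FiniteDimensional.complete ℝ E
  induction hX using Submodule.span_induction with
  | mem x h =>
    obtain ⟨X, Y, rfl⟩ := h
    rw [← adD_adL]
    exact adD_mem_commutatorSpan G _ _
  | zero => rw [map_zero]; exact Submodule.zero_mem _
  | add x y _ _ hx hy => rw [map_add]; exact Submodule.add_mem _ hx hy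
  | smul a x _ hx => rw [map_smul]; exact Submodule.smul_mem _ _ hx

theorem exists_isNilFlag_sup_commutatorSpan :
    ∃ (F : ℕ → Submodule ℝ E) (n : ℕ), IsNilFlag G F n ∧ F 0 ⊔ commutatorSpan E G = ⊤ := by
  have : CompleteSpace E := FiniteDimensional.complete ℝ E
  have : LieGroup 𝓘(ℝ, E) (minSmoothness ℝ 3) G := by
    rw [minSmoothness_of_isRCLikeNormedField]; infer_instance
  have hbr : ∀ X Y : 𝔤 ℝ E G, ⁅X, Y⁆ = (adD ℝ E G (X : E) (Y : E) : E) :=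
    fun X Y => bracket_eq_chartMixed X Y
  obtain ⟨F, n, h1, h2, h3, h4⟩ := exists_nilpotent_subalgebra_sup_commutator (𝔤 ℝ E G)
  refine ⟨F, n, ⟨h1, fun X hX i Y hY => ?_, h3⟩, ?_⟩
  · exact (congrArg (· ∈ F (i + 1)) (hbr X Y)).mp (h2 X hX i Y hY)
  · have h5 : {Z : 𝔤 ℝ E G | ∃ X Y : 𝔤 ℝ E G, ⁅X, Y⁆ = Z} =
        {Z : E | ∃ X Y : E, adD ℝ E G X Y = Z} := by
      ext Z
      constructor
      · rintro ⟨X, Y, h⟩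
        exact ⟨X, Y, (hbr X Y).symm.trans h⟩
      · rintro ⟨X, Y, h⟩
        exact ⟨X, Y, (hbr X Y).trans h⟩
    rw [h5] at h4
    exact h4

theorem adD_adD (X Y Z : E) : adD ℝ E G (adD ℝ E G X Y) Z =
    adD ℝ E G X (adD ℝ E G Y Z) - adD ℝ E G Y (adD ℝ E G X Z) := by
  have : CompleteSpace E := FiniteDimensional.complete ℝ E
  have : LieGroup 𝓘(ℝ, E) (minSmoothness ℝ 3) G := by
    rw [minSmoothness_of_isRCLikeNormedField]; infer_instance
  have hbr : ∀ X Y : 𝔤 ℝ E G, ⁅X, Y⁆ = (adD ℝ E G (X : E) (Y : E) : E) :=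
    fun X Y => bracket_eq_chartMixed X Y
  have key : ∀ X Y Z : 𝔤 ℝ E G, (adD ℝ E G (adD ℝ E G X Y) Z : E) =
      adD ℝ E G X (adD ℝ E G Y Z) - adD ℝ E G Y (adD ℝ E G X Z) := fun X Y Z =>
    (congrArg (fun W : E => adD ℝ E G W Z) (hbr X Y)).symm.trans
      ((hbr ⁅X, Y⁆ Z).symm.trans ((lie_lie X Y Z).trans (congrArg₂ (fun a b : E => a - b)
        ((hbr X ⁅Y, Z⁆).trans (congrArg (fun W : E => adD ℝ E G X W) (hbr Y Z)))
        ((hbr Y ⁅X, Z⁆).trans (congrArg (fun W : E => adD ℝ E G Y W) (hbr X Z))))))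
  exact key X Y Z

end NilpotentSupplement

/-! ### Nilpotency of the commutator algebra, from the coadjoint representation. -/

section Coadjoint

open Module Topology

variable {E : Type*} [NormedAddCommGroup E] [NormedSpace ℝ E] [FiniteDimensional ℝ E]
  (G : Type*) [TopologicalSpace G] [ChartedSpace E G] [Group G] [LieGroup 𝓘(ℝ, E) ∞ G]

/-- Evaluate a functional of `E → ℂ` on the compositions of `f` with endomorphisms of `E`. -/
def compDual (l : Dual ℂ (E →ₗ[ℝ] ℂ)) (f : E →ₗ[ℝ] ℂ) : (E →L[ℝ] E) →L[ℝ] ℂ :=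
  LinearMap.toContinuousLinearMap
    { toFun := fun T => l (f ∘ₗ (T : E →ₗ[ℝ] E))
      map_add' := fun S T => by
        rw [← map_add]; congr 1; ext; simp
      map_smul' := fun c T => by
        have : f ∘ₗ ((c • T : E →L[ℝ] E) : E →ₗ[ℝ] E) = (c : ℂ) • (f ∘ₗ (T : E →ₗ[ℝ] E)) := by
          ext; simp
        rw [this, map_smul]; simp }

theorem continuous_adL : Continuous fun g : G => adL ℝ E g := by
  have : CompleteSpace E := FiniteDimensional.complete ℝ E
  have hG : IsTopologicalGroup G := topologicalGroup_of_lieGroup 𝓘(ℝ, E) ∞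
  have h1 : ContinuousAt (fun g : G => adL ℝ E g) 1 :=
    (hasMFDerivAt_adL_one (𝕜 := ℝ) (E := E) G).continuousAt
  refine continuous_iff_continuousAt.2 fun g => ?_
  have h2 : ContinuousAt (fun x : G => g⁻¹ * x) g := by fun_prop
  have h3 : ContinuousAt (fun x : G => adL ℝ E (g⁻¹ * x)) g := by
    refine ContinuousAt.comp (g := fun g : G => adL ℝ E g) ?_ h2
    rw [inv_mul_cancel]; exact h1
  have h4 := (ContinuousLinearMap.compL ℝ E E E (adL ℝ E g)).continuous.continuousAt.comp h3
  refine h4.congr (Filter.Eventually.of_forall fun x => ?_)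
  simp only [Function.comp, ContinuousLinearMap.compL_apply]
  rw [← adL_mul, mul_inv_cancel_left]

variable (E) in
/-- The coadjoint action on complex-valued linear forms. -/
def coadRep : G →* End ℂ (E →ₗ[ℝ] ℂ) where
  toFun g :=
    { toFun := fun f => f ∘ₗ (adL ℝ E g⁻¹ : E →ₗ[ℝ] E)
      map_add' := fun _ _ => rfl
      map_smul' := fun _ _ => rfl }
  map_one' := by
    ext f x
    simp only [inv_one, adL_one]
    rfl
  map_mul' g h := by
    ext f x
    simp only [mul_inv_rev, adL_mul]
    rfl

theorem coadRep_apply (g : G) (f : E →ₗ[ℝ] ℂ) :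
    coadRep E G g f = f ∘ₗ (adL ℝ E g⁻¹ : E →ₗ[ℝ] E) := rfl

theorem coeffContinuous_coadRep : CoeffContinuous (coadRep E G) := fun l f => by
  have hG : IsTopologicalGroup G := topologicalGroup_of_lieGroup 𝓘(ℝ, E) ∞
  exact (compDual l f).continuous.comp ((continuous_adL G).comp continuous_inv)

variable {G} in
/-- A subspace containing the coadjoint orbit of `f` contains its infinitesimal orbit. -/
theorem comp_adD_mem {S : Submodule ℂ (E →ₗ[ℝ] ℂ)} {f : E →ₗ[ℝ] ℂ}
    (h : ∀ g : G, f ∘ₗ (adL ℝ E g : E →ₗ[ℝ] E) ∈ S) (X : E) :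
    f ∘ₗ (adD ℝ E G X : E →ₗ[ℝ] E) ∈ S := by
  have : CompleteSpace E := FiniteDimensional.complete ℝ E
  rw [← Subspace.forall_mem_dualAnnihilator_apply_eq_zero_iff]
  intro l hl
  have hl := (Submodule.mem_dualAnnihilator l).1 hl
  have h1 := HasMFDerivAt.comp (1 : G) (compDual l f).hasFDerivAt.hasMFDerivAt
    (hasMFDerivAt_adL_one (𝕜 := ℝ) (E := E) G)
  have h2 : (compDual l f ∘ fun g : G => adL ℝ E g) = fun _ => 0 := funext fun g => hl _ (h g)
  rw [h2] at h1
  have h3 : ((compDual l f).comp (adD ℝ E G) : E →L[ℝ] ℂ) = 0 :=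
    h1.mfderiv.symm.trans (hasMFDerivAt_const _ _).mfderiv
  exact congrArg (fun T : E →L[ℝ] ℂ => T X) h3

variable (E) in
/-- The ascending series of the action of the commutators on linear forms. -/
def coadSeries : ℕ → Submodule ℂ (E →ₗ[ℝ] ℂ)
  | 0 => ⊥
  | k + 1 =>
    { carrier := {f | ∀ X Y : E,
        f ∘ₗ (adD ℝ E G (adD ℝ E G X Y) : E →ₗ[ℝ] E) ∈ coadSeries k}
      add_mem' := fun hf hg X Y => (coadSeries k).add_mem (hf X Y) (hg X Y)
      zero_mem' := fun _ _ => (coadSeries k).zero_mem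
      smul_mem' := fun c _ hf X Y => (coadSeries k).smul_mem c (hf X Y) }

theorem comp_adL_mem_coadSeries (k : ℕ) (g : G) : ∀ f ∈ coadSeries E G k,
    f ∘ₗ (adL ℝ E g : E →ₗ[ℝ] E) ∈ coadSeries E G k := by
  have : CompleteSpace E := FiniteDimensional.complete ℝ E
  induction k with
  | zero =>
    intro f hf
    have hf : f = 0 := hf
    rw [hf, LinearMap.zero_comp]
    exact Submodule.zero_mem _
  | succ k ih =>
    intro f hf X Y
    have h := ih _ (hf (adL ℝ E g X) (adL ℝ E g Y))
    convert! h using 1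
    ext Z
    simp only [LinearMap.comp_apply, ContinuousLinearMap.coe_coe]
    rw [adD_adL, adD_adL]

theorem coadSeries_mono : Monotone (coadSeries E G) := by
  refine monotone_nat_of_le_succ fun k => ?_
  induction k with
  | zero => exact bot_le
  | succ k ih => exact fun f hf X Y => ih (hf X Y)

/-- Lie-Kolchin on the quotient by the `k`-th term gives a form f which is an eigenvector modulo
that term. Infinitesimally every X acts on f by a scalar modulo that term, so commutators act by
zero. Complex-valued forms supply a complex representation without complexifying 𝔤. -/
theorem exists_mem_coadSeries_succ [ConnectedSpace G] [Group.IsSolvable G] {k : ℕ}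
    (hk : coadSeries E G k ≠ ⊤) : ∃ f ∈ coadSeries E G (k + 1), f ∉ coadSeries E G k := by
  have hG : IsTopologicalGroup G := topologicalGroup_of_lieGroup 𝓘(ℝ, E) ∞
  set S := coadSeries E G k with hS
  have hst : ∀ g : G, S ≤ S.comap (coadRep E G g) := fun g f hf =>
    comp_adL_mem_coadSeries G k g⁻¹ f hf
  let ψ : G →* End ℂ ((E →ₗ[ℝ] ℂ) ⧸ S) :=
    { toFun := fun g => S.mapQ S (coadRep E G g) (hst g)
      map_one' := by
        ext f
        simp
      map_mul' := fun g h => by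
        ext f
        simp }
  have hψ : CoeffContinuous ψ := by
    intro l v
    obtain ⟨f, rfl⟩ := Submodule.Quotient.mk_surjective _ v
    exact coeffContinuous_coadRep G (l ∘ₗ S.mkQ) f
  obtain ⟨n, hn⟩ := Group.IsSolvable.solvable (G := G)
  have hnt : Nontrivial ((E →ₗ[ℝ] ℂ) ⧸ S) := Submodule.Quotient.nontrivial_iff.2 hk
  obtain ⟨w, -, hw0, hw⟩ := exists_common_eigenvector hψ (n := n) (fun g hg => by
    rw [hn, Subgroup.mem_bot] at hg
    rw [hg, map_one]) ⊤ top_ne_bot (fun _ _ _ => trivial)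
  obtain ⟨f, rfl⟩ := Submodule.Quotient.mk_surjective _ w
  have hfS : f ∉ S := fun h => hw0 ((Submodule.Quotient.mk_eq_zero _).2 h)
  refine ⟨f, ?_, hfS⟩
  have hS' : ∀ h ∈ S, ∀ X : E, h ∘ₗ (adD ℝ E G X : E →ₗ[ℝ] E) ∈ S := fun h hh X =>
    comp_adD_mem (fun g => comp_adL_mem_coadSeries G k g h hh) X
  have hf1 : ∀ g : G, f ∘ₗ (adL ℝ E g : E →ₗ[ℝ] E) ∈ Submodule.span ℂ {f} ⊔ S := by
    intro g
    obtain ⟨c, hc⟩ := hw g⁻¹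
    have h1 : Submodule.Quotient.mk (p := S) (coadRep E G g⁻¹ f) = Submodule.Quotient.mk (c • f) := hc
    rw [Submodule.Quotient.eq, coadRep_apply, inv_inv] at h1
    refine Submodule.mem_sup.2 ⟨c • f, Submodule.smul_mem _ _ (Submodule.mem_span_singleton_self f),
      _, h1, ?_⟩
    abel
  have hf2 : ∀ X : E, ∃ c : ℂ, ∃ h ∈ S, f ∘ₗ (adD ℝ E G X : E →ₗ[ℝ] E) = c • f + h := by
    intro X
    obtain ⟨a, ha, h, hh, hah⟩ := Submodule.mem_sup.1 (comp_adD_mem hf1 X)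
    obtain ⟨c, rfl⟩ := Submodule.mem_span_singleton.1 ha
    exact ⟨c, h, hh, hah.symm⟩
  intro X Y
  obtain ⟨a, u, hu, hX⟩ := hf2 X
  obtain ⟨b, v, hv, hY⟩ := hf2 Y
  -- By the Jacobi identity this is f ∘ ad X ∘ ad Y - f ∘ ad Y ∘ ad X, and the terms ab f cancel.
  have key : f ∘ₗ (adD ℝ E G (adD ℝ E G X Y) : E →ₗ[ℝ] E) =
      (a • v + u ∘ₗ (adD ℝ E G Y : E →ₗ[ℝ] E)) - (b • u + v ∘ₗ (adD ℝ E G X : E →ₗ[ℝ] E)) := by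
    have hX' := fun Z => LinearMap.congr_fun hX Z
    have hY' := fun Z => LinearMap.congr_fun hY Z
    simp only [LinearMap.comp_apply, ContinuousLinearMap.coe_coe, LinearMap.add_apply,
      LinearMap.smul_apply, smul_eq_mul] at hX' hY'
    ext Z
    simp only [LinearMap.comp_apply, ContinuousLinearMap.coe_coe, LinearMap.add_apply,
      LinearMap.sub_apply, LinearMap.smul_apply, smul_eq_mul]
    rw [adD_adD, map_sub, hX', hY', hY', hX']
    ring
  rw [key]
  exact S.sub_mem (S.add_mem (S.smul_mem _ hv) (hS' u hu Y))
    (S.add_mem (S.smul_mem _ hu) (hS' v hv X))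

theorem exists_coadSeries_eq_top [ConnectedSpace G] [Group.IsSolvable G] :
    ∃ n, coadSeries E G n = ⊤ := by
  obtain ⟨n, hn⟩ := monotone_stabilizes_iff_noetherian.2
    (inferInstance : IsNoetherian ℂ (E →ₗ[ℝ] ℂ)) ⟨coadSeries E G, coadSeries_mono G⟩
  refine ⟨n, ?_⟩
  by_contra h
  obtain ⟨f, hf, hf'⟩ := exists_mem_coadSeries_succ G h
  have h1 : coadSeries E G n = coadSeries E G (n + 1) := hn (n + 1) (Nat.le_succ n)
  exact hf' (h1 ▸ hf)

variable (E) in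
/-- The descending series of the action of the commutators on the Lie algebra. -/
def adSeries : ℕ → Submodule ℝ E
  | 0 => ⊤
  | k + 1 => Submodule.span ℝ {Z | ∃ X X' : E, ∃ Y ∈ adSeries k, adD ℝ E G (adD ℝ E G X X') Y = Z}

theorem adSeries_antitone : Antitone (adSeries E G) := by
  refine antitone_nat_of_succ_le fun k => ?_
  induction k with
  | zero => exact le_top
  | succ k ih =>
    refine Submodule.span_mono ?_
    rintro _ ⟨X, X', Y, hY, rfl⟩
    exact ⟨X, X', Y, ih hY, rfl⟩

theorem apply_eq_zero_of_mem_adSeries (k : ℕ) : ∀ f ∈ coadSeries E G k, ∀ Y ∈ adSeries E G k,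
    f Y = 0 := by
  induction k with
  | zero =>
    intro f hf Y _
    have hf : f = 0 := hf
    rw [hf]; rfl
  | succ k ih =>
    intro f hf Y hY
    induction hY using Submodule.span_induction with
    | mem x h =>
      obtain ⟨X, X', Y, hY, rfl⟩ := h
      exact ih _ (hf X X') Y hY
    | zero => exact map_zero f
    | add x y _ _ hx hy => rw [map_add, hx, hy, add_zero]
    | smul a x _ hx => rw [map_smul, hx, smul_zero]

/-- The commutator algebra of the Lie algebra of a connected solvable group is nilpotent. -/
theorem exists_isNilFlag_commutatorSpan [ConnectedSpace G] [Group.IsSolvable G] :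
    ∃ (F : ℕ → Submodule ℝ E) (n : ℕ), IsNilFlag G F n ∧ F 0 = commutatorSpan E G := by
  obtain ⟨n, hn⟩ := exists_coadSeries_eq_top (E := E) G
  -- `adSeries` starts at the whole algebra; intersecting makes the flag start at the commutators.
  -- It ends at zero because its `n`-th term is killed by all forms in the `n`-th coadjoint term,
  -- which is everything.
  refine ⟨fun k => commutatorSpan E G ⊓ adSeries E G k, n, ⟨?_, ?_, ?_⟩, ?_⟩
  · exact fun i j hij => inf_le_inf_left _ (adSeries_antitone G hij)
  · rintro X hX i Y ⟨_, hY⟩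
    refine ⟨adD_mem_commutatorSpan G X Y, ?_⟩
    replace hX : X ∈ commutatorSpan E G := hX.1
    induction hX using Submodule.span_induction with
    | mem x h =>
      obtain ⟨X, X', rfl⟩ := h
      exact Submodule.subset_span ⟨X, X', Y, hY, rfl⟩
    | zero => rw [map_zero]; exact Submodule.zero_mem _
    | add x y _ _ hx hy => rw [map_add]; exact Submodule.add_mem _ hx hy
    | smul a x _ hx => rw [map_smul]; exact Submodule.smul_mem _ _ hx
  · rw [eq_bot_iff]
    rintro Y ⟨_, hY⟩
    rw [Submodule.mem_bot]
    refine (Module.forall_dual_apply_eq_zero_iff ℝ Y).1 fun l => ?_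
    have := apply_eq_zero_of_mem_adSeries G n (Complex.ofRealCLM.toLinearMap ∘ₗ l)
      (hn ▸ Submodule.mem_top) Y hY
    exact Complex.ofReal_eq_zero.1 this
  · exact inf_top_eq _

end Coadjoint

/-! ### Generation of a connected Lie group by one-parameter subgroups. -/

section ProductMap

open Filter Topology

variable {E : Type*} [NormedAddCommGroup E] [NormedSpace ℝ E]
  {G : Type*} [TopologicalSpace G] [ChartedSpace E G] [Group G] [LieGroup 𝓘(ℝ, E) ∞ G]

variable (E G) in
theorem hasStrictFDerivAt_chartMul :
    HasStrictFDerivAt (chartMul ℝ E G)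
      (ContinuousLinearMap.fst ℝ E E + ContinuousLinearMap.snd ℝ E E)
      (chartOne ℝ E G, chartOne ℝ E G) := by
  have h := (contDiffAt_chartMul ℝ E G).hasStrictFDerivAt (by simp)
  convert! h using 1
  refine ContinuousLinearMap.ext fun p => ?_
  have h1 := congrArg (fun T : E →L[ℝ] E => T p.2) (chartLeft_chartOne ℝ E G)
  have h2 := congrArg (fun T : E →L[ℝ] E => T p.1) (chartRight_chartOne ℝ E G)
  have h1 : fderiv ℝ (chartMul ℝ E G) (chartOne ℝ E G, chartOne ℝ E G) (0, p.2) = p.2 := h1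
  have h2 : fderiv ℝ (chartMul ℝ E G) (chartOne ℝ E G, chartOne ℝ E G) (p.1, 0) = p.1 := h2
  have h3 : p = (p.1, 0) + (0, p.2) := by simp
  conv_rhs => rw [h3, map_add, h1, h2]
  rfl

/-- The map `f` to `G` sends `a` to `1` and is strictly differentiable there. -/
structure HasStrictDerivAtOne {F : Type*} [NormedAddCommGroup F] [NormedSpace ℝ F]
    (f : F → G) (f' : F →L[ℝ] E) (a : F) : Prop where
  strict : HasStrictFDerivAt (fun x => extChartAt 𝓘(ℝ, E) (1 : G) (f x)) f' a
  continuousAt : ContinuousAt f a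
  apply_eq : f a = 1

variable {F : Type*} [NormedAddCommGroup F] [NormedSpace ℝ F]

theorem HasStrictDerivAtOne.eventually_symm_apply {f : F → G} {f' : F →L[ℝ] E} {a : F}
    (h : HasStrictDerivAtOne f f' a) :
    ∀ᶠ x in 𝓝 a, (extChartAt 𝓘(ℝ, E) (1 : G)).symm (extChartAt 𝓘(ℝ, E) (1 : G) (f x)) = f x := by
  have h1 : (extChartAt 𝓘(ℝ, E) (1 : G)).source ∈ 𝓝 (f a) := by
    rw [h.apply_eq]; exact extChartAt_source_mem_nhds (1 : G)
  filter_upwards [h.continuousAt.preimage_mem_nhds h1] with x hx using (extChartAt 𝓘(ℝ, E) (1 : G)).left_inv hx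

theorem hasStrictDerivAtOne_const (a : F) :
    HasStrictDerivAtOne (fun _ => (1 : G)) (0 : F →L[ℝ] E) a :=
  ⟨hasStrictFDerivAt_const _ _, continuousAt_const, rfl⟩

theorem HasStrictDerivAtOne.mul {f g : F → G} {f' g' : F →L[ℝ] E} {a : F}
    (hf : HasStrictDerivAtOne f f' a) (hg : HasStrictDerivAtOne g g' a) :
    HasStrictDerivAtOne (fun x => f x * g x) (f' + g') a := by
  have hG : IsTopologicalGroup G := topologicalGroup_of_lieGroup 𝓘(ℝ, E) ∞
  refine ⟨?_, hf.continuousAt.mul hg.continuousAt, by rw [hf.apply_eq, hg.apply_eq, mul_one]⟩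
  have h1 : HasStrictFDerivAt (chartMul ℝ E G)
      (ContinuousLinearMap.fst ℝ E E + ContinuousLinearMap.snd ℝ E E)
      (extChartAt 𝓘(ℝ, E) (1 : G) (f a), extChartAt 𝓘(ℝ, E) (1 : G) (g a)) := by
    rw [hf.apply_eq, hg.apply_eq]
    exact hasStrictFDerivAt_chartMul E G
  have h2 := HasStrictFDerivAt.comp a h1 (hf.strict.prodMk hg.strict)
  refine HasStrictFDerivAt.congr_of_eventuallyEq (h2.congr_fderiv ?_) ?_
  · ext; simp
  · filter_upwards [hf.eventually_symm_apply, hg.eventually_symm_apply] with x hx hx'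
    simp only [chartMul, hx, hx']

theorem HasStrictDerivAtOne.list_prod {ι : Type*} {f : ι → F → G} {f' : ι → F →L[ℝ] E} {a : F}
    (h : ∀ i, HasStrictDerivAtOne (f i) (f' i) a) (l : List ι) :
    HasStrictDerivAtOne (fun x => (l.map fun i => f i x).prod) (l.map f').sum a := by
  induction l with
  | nil => exact hasStrictDerivAtOne_const a
  | cons i l ih => simpa only [List.map_cons, List.prod_cons, List.sum_cons] using (h i).mul ih

theorem HasStrictDerivAtOne.comp {F' : Type*} [NormedAddCommGroup F'] [NormedSpace ℝ F']
    {f : F → G} {f' : F →L[ℝ] E} (L : F' →L[ℝ] F) {a : F'}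
    (h : HasStrictDerivAtOne f f' (L a)) :
    HasStrictDerivAtOne (fun x => f (L x)) (f'.comp L) a :=
  ⟨HasStrictFDerivAt.comp a h.strict L.hasStrictFDerivAt,
    ContinuousAt.comp h.continuousAt L.continuous.continuousAt, h.apply_eq⟩

theorem IsOneParam.hasDerivAt_chart {γ : ℝ → G} {X : E} (h : IsOneParam γ X) :
    HasDerivAt (fun t => extChartAt 𝓘(ℝ, E) (1 : G) (γ t)) X 0 := by
  have h1 := h.velocity.2
  have h2 : writtenInExtChartAt 𝓘(ℝ, ℝ) 𝓘(ℝ, E) 0 γ =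
      fun t => extChartAt 𝓘(ℝ, E) (1 : G) (γ t) := by
    ext t
    simp [writtenInExtChartAt, h.map_zero]
    rfl
  have h3 : HasFDerivWithinAt (writtenInExtChartAt 𝓘(ℝ, ℝ) 𝓘(ℝ, E) 0 γ)
    ((1 : ℝ →L[ℝ] ℝ).smulRight X : ℝ →L[ℝ] E) (Set.range 𝓘(ℝ, ℝ)) (extChartAt 𝓘(ℝ, ℝ) (0 : ℝ) 0) := h1
  rw [h2] at h3
  simp only [modelWithCornersSelf_coe, Set.range_id, hasFDerivWithinAt_univ, mfld_simps] at h3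
  exact h3.hasDerivAt.congr_deriv (by simp)

/-- The open mapping step needs strict differentiability. In the chart the velocity at t is
`chartLeft` of the point applied to X, which is continuous at 0. -/
theorem IsOneParam.hasStrictDerivAtOne {γ : ℝ → G} {X : E} (h : IsOneParam γ X) :
    HasStrictDerivAtOne γ ((1 : ℝ →L[ℝ] ℝ).smulRight X) 0 := by
  refine ⟨?_, h.continuous.continuousAt, h.map_zero⟩
  set c : ℝ → E := fun t => extChartAt 𝓘(ℝ, E) (1 : G) (γ t) with hc
  have hc0 : c 0 = chartOne ℝ E G := by rw [hc]; simp only [h.map_zero]; rfl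
  have hcont : Tendsto c (𝓝 0) (𝓝 (chartOne ℝ E G)) := by
    rw [← hc0]; exact h.hasDerivAt_chart.continuousAt
  have hsrc : ∀ᶠ t in 𝓝 (0 : ℝ), (extChartAt 𝓘(ℝ, E) (1 : G)).symm (c t) = γ t := by
    have h1 : (extChartAt 𝓘(ℝ, E) (1 : G)).source ∈ 𝓝 (γ 0) := by
      rw [h.map_zero]; exact extChartAt_source_mem_nhds (1 : G)
    filter_upwards [h.continuous.continuousAt.preimage_mem_nhds h1] with x hx using (extChartAt 𝓘(ℝ, E) (1 : G)).left_inv hx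
  have hder : ∀ᶠ t in 𝓝 (0 : ℝ), HasDerivAt c (chartLeft ℝ E G (c t) X) t := by
    filter_upwards [hsrc, hcont.eventually (eventually_chartMul_differentiableAt ℝ E G)]
      with t ht ⟨_, hd, _⟩
    have h0 : HasDerivAt c X (t - t) := by rw [sub_self]; exact h.hasDerivAt_chart
    have h1 : HasDerivAt (fun s => c (s - t)) X t := h0.comp_sub_const t t
    have h2 : HasDerivAt (fun s => (c t, c (s - t))) ((0 : E), X) t :=
      (hasDerivAt_const t (c t)).prodMk h1
    have h3 : HasFDerivAt (chartMul ℝ E G) (fderiv ℝ (chartMul ℝ E G) (c t, chartOne ℝ E G))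
        (c t, c (t - t)) := by
      rw [sub_self, hc0]; exact hd.hasFDerivAt
    have h4 := HasFDerivAt.comp_hasDerivAt t h3 h2
    refine HasDerivAt.congr_of_eventuallyEq h4 ?_
    have h5 : Tendsto (fun s : ℝ => s - t) (𝓝 t) (𝓝 0) := by
      have : Continuous fun s : ℝ => s - t := by fun_prop
      simpa using this.tendsto t
    filter_upwards [h5.eventually hsrc] with s hs
    simp only [Function.comp, chartMul, ht, hs]
    rw [← h.map_add, add_sub_cancel]
  have hct : ContinuousAt (fun t => chartLeft ℝ E G (c t) X) 0 := by
    have h1 : ContinuousAt (chartLeft ℝ E G) (c 0) := by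
      rw [hc0]; exact (hasFDerivAt_chartLeft ℝ E G).continuousAt
    have h2 := ContinuousAt.comp h1 h.hasDerivAt_chart.continuousAt
    exact h2.clm_apply continuousAt_const
  have h6 := hasStrictDerivAt_of_hasDerivAt_of_continuousAt hder hct
  rw [hc0, chartLeft_chartOne] at h6
  exact h6.hasStrictFDerivAt

variable [FiniteDimensional ℝ E]

theorem eq_top_of_mem_nhds_one [ConnectedSpace G] [IsTopologicalGroup G] {K : Subgroup G}
    (h : (K : Set G) ∈ 𝓝 1) : K = ⊤ := by
  have h1 : IsOpen (K : Set G) := K.isOpen_of_mem_nhds h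
  have h2 : IsClopen (K : Set G) := ⟨K.isClosed_of_isOpen h1, h1⟩
  exact SetLike.coe_injective (h2.eq_univ ⟨1, K.one_mem⟩)

/-- The product of the one-parameter subgroups along a basis has surjective derivative at 0. Its
image, contained in `K`, is thus a neighbourhood of 1, and an open subgroup of a connected group is
everything. -/
theorem eq_top_of_isOneParam_mem_of_basis [ConnectedSpace G] {K : Subgroup G} {ι : Type*}
    [Fintype ι] (b : Module.Basis ι ℝ E)
    (h : ∀ i, ∀ γ : ℝ → G, IsOneParam γ (b i) → ∀ t, γ t ∈ K) : K = ⊤ := by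
  have hG : IsTopologicalGroup G := topologicalGroup_of_lieGroup 𝓘(ℝ, E) ∞
  have hE : CompleteSpace E := FiniteDimensional.complete ℝ E
  choose γ hγ using fun X : E => exists_isOneParam G X
  have h0 : ∀ i, HasStrictDerivAtOne (fun t : ι → ℝ => γ (b i) (t i))
      (((1 : ℝ →L[ℝ] ℝ).smulRight (b i)).comp (ContinuousLinearMap.proj i)) 0 := fun i =>
    HasStrictDerivAtOne.comp (ContinuousLinearMap.proj (R := ℝ) (φ := fun _ : ι => ℝ) i)
      (hγ (b i)).hasStrictDerivAtOne
  have h1 := HasStrictDerivAtOne.list_prod h0 Finset.univ.toList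
  refine eq_top_of_mem_nhds_one ?_
  have h2 := h1.strict.map_nhds_eq_of_surj ?_
  · have h3 : {x | (extChartAt 𝓘(ℝ, E) (1 : G)).symm x ∈ K} ∈
        𝓝 (extChartAt 𝓘(ℝ, E) (1 : G) (1 : G)) := by
      rw [h1.apply_eq] at h2
      rw [← h2, Filter.mem_map]
      filter_upwards [h1.eventually_symm_apply] with x hx
      simp only [Set.mem_preimage, Set.mem_ofPred_eq, hx]
      refine Subgroup.list_prod_mem _ fun y hy => ?_
      obtain ⟨i, -, rfl⟩ := List.mem_map.1 hy
      exact h i _ (hγ _) _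
    filter_upwards [(continuousAt_extChartAt (I := 𝓘(ℝ, E)) (1 : G)).preimage_mem_nhds h3,
      extChartAt_source_mem_nhds (I := 𝓘(ℝ, E)) (1 : G)] with g hg hg'
    rw [Set.mem_preimage, Set.mem_ofPred_eq, (extChartAt 𝓘(ℝ, E) (1 : G)).left_inv hg'] at hg
    exact hg
  · rw [Finset.sum_map_toList]
    rw [LinearMap.range_eq_top]
    intro v
    refine ⟨b.equivFun v, ?_⟩
    rw [ContinuousLinearMap.coe_coe, sum_apply]
    conv_rhs => rw [← b.sum_equivFun v]
    refine Finset.sum_congr rfl fun i _ => ?_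
    simp

/-- A subgroup of a connected Lie group is everything if it contains the one-parameter subgroups
in the directions of a spanning set. -/
theorem eq_top_of_isOneParam_mem [ConnectedSpace G] {K : Subgroup G} {S : Set E}
    (hS : Submodule.span ℝ S = ⊤) (h : ∀ X ∈ S, ∀ γ : ℝ → G, IsOneParam γ X → ∀ t, γ t ∈ K) :
    K = ⊤ := by
  let b := Module.Basis.ofSpan hS.ge
  let _ : Fintype _ := FiniteDimensional.fintypeBasisIndex b
  exact eq_top_of_isOneParam_mem_of_basis b fun i =>
    h _ (Module.Basis.ofSpan_subset hS.ge ⟨i, rfl⟩)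

/-- C is generated by a nilpotent subalgebra spanning 𝔤 together with [𝔤, 𝔤]. The subgroup belonging
to [𝔤, 𝔤] is normal, connected and nilpotent, so it lies in the nilradical; normality turns the join
of the two into a product. -/
theorem exists_isNilpotentSupplement_real (E : Type*) [NormedAddCommGroup E] [NormedSpace ℝ E]
    [FiniteDimensional ℝ E] (G : Type*) [TopologicalSpace G] [ChartedSpace E G] [Group G]
    [LieGroup 𝓘(ℝ, E) ∞ G] [ConnectedSpace G] [Group.IsSolvable G] :
    ∃ C : Subgroup G, IsNilpotentSupplement C := by
  obtain ⟨F, n, hF, htop⟩ := exists_isNilFlag_sup_commutatorSpan (E := E) G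
  obtain ⟨F', n', hF', hF0⟩ := exists_isNilFlag_commutatorSpan (E := E) G
  have hN : (expSubgroup G (commutatorSpan E G)).Normal :=
    normal_expSubgroup fun g X hX => adL_mem_commutatorSpan G g hX
  have hle : expSubgroup G (commutatorSpan E G) ≤ nilradical G :=
    le_sSup ⟨hN, hF0 ▸ isNilpotent_expSubgroup hF', isConnected_expSubgroup _⟩
  refine ⟨expSubgroup G (F 0), isNilpotent_expSubgroup hF, isConnected_expSubgroup _, fun g => ?_⟩
  have hK : expSubgroup G (F 0) ⊔ expSubgroup G (commutatorSpan E G) = ⊤ := by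
    refine eq_top_of_isOneParam_mem (E := E) (S := (F 0 : Set E) ∪ (commutatorSpan E G : Set E))
      ?_ ?_
    · rw [Submodule.span_union, Submodule.span_eq, Submodule.span_eq, htop]
    · rintro X (hX | hX) γ hγ t
      · exact Subgroup.mem_sup_left (hγ.mem_expSubgroup hX t)
      · exact Subgroup.mem_sup_right (hγ.mem_expSubgroup hX t)
  have hg : g ∈ expSubgroup G (F 0) ⊔ expSubgroup G (commutatorSpan E G) := hK ▸ Subgroup.mem_top g
  obtain ⟨c, hc, d, hd, rfl⟩ := Subgroup.mem_sup_of_normal_right.1 hg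
  exact ⟨c, hc, d, hle hd, rfl⟩

end ProductMap

/-! ### Complex Lie groups as real ones. -/

section RestrictScalars

variable (E : Type*) [NormedAddCommGroup E] [NormedSpace ℂ E]
  (G : Type*) [TopologicalSpace G] [ChartedSpace E G]

theorem isManifold_real_of_complex [IsManifold 𝓘(ℂ, E) ∞ G] : IsManifold 𝓘(ℝ, E) ∞ G := by
  refine isManifold_of_contDiffOn _ _ _ fun e e' he he' => ?_
  have h := (contDiffGroupoid ∞ 𝓘(ℂ, E)).compatible he he'
  exact (mem_groupoid_of_pregroupoid.1 h).1.restrict_scalars ℝ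

theorem lieGroup_real_of_complex [Group G] [LieGroup 𝓘(ℂ, E) ∞ G] : LieGroup 𝓘(ℝ, E) ∞ G := by
  have hM := isManifold_real_of_complex E G
  have h1 := contMDiff_iff.1 (contMDiff_mul 𝓘(ℂ, E) ∞ (G := G))
  have h2 := contMDiff_iff.1 (contMDiff_inv 𝓘(ℂ, E) ∞ (G := G))
  exact
    { hM with
      contMDiff_mul := contMDiff_iff.2 ⟨h1.1, fun x y => (h1.2 x y).restrict_scalars ℝ⟩
      contMDiff_inv := contMDiff_iff.2 ⟨h2.1, fun x y => (h2.2 x y).restrict_scalars ℝ⟩ }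

/-- Nilradical and supplement depend only on the topological group, so the underlying real Lie group
decides their existence. -/
theorem exists_isNilpotentSupplement_complex [FiniteDimensional ℂ E] [Group G]
    [LieGroup 𝓘(ℂ, E) ∞ G] [ConnectedSpace G] [Group.IsSolvable G] :
    ∃ C : Subgroup G, IsNilpotentSupplement C := by
  have := lieGroup_real_of_complex E G
  have : FiniteDimensional ℝ E := FiniteDimensional.complexToReal E
  exact exists_isNilpotentSupplement_real E G

end RestrictScalars
end SolvCoh
end

theorem mainTheorem3 :
    -- the real case
    (∀ (E : Type u) [NormedAddCommGroup E] [NormedSpace ℝ E] [FiniteDimensional ℝ E]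
      (G : Type v) [TopologicalSpace G] [ChartedSpace E G] [Group G] [LieGroup 𝓘(ℝ, E) ∞ G]
      [SimplyConnectedSpace G] [Group.IsSolvable G]
      (V : Type w) [NormedAddCommGroup V] [NormedSpace ℂ V] [FiniteDimensional ℂ V]
      (ρ : G →* (V →L[ℂ] V)),
      ContMDiff 𝓘(ℝ, E) 𝓘(ℝ, V →L[ℂ] V) ∞ (fun g => ρ g) →
      (∀ n ∈ SolvCoh.nilradical G, IsNilpotent (ρ n - 1)) →
      (∃ A : ∀ p, Submodule ℂ (SolvCoh.TotalCochains ℝ E G V p),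
        SolvCoh.IsFiniteQuasiIsoSubcomplex (SolvCoh.totalDifferential ℝ E ρ) A) ∧
      (∃ C : Subgroup G, SolvCoh.IsNilpotentSupplement C) ∧
      ∀ C : Subgroup G, SolvCoh.IsNilpotentSupplement C →
        SolvCoh.IsFiniteQuasiIsoSubcomplex (SolvCoh.totalDifferential ℝ E ρ)
          (SolvCoh.invariants ℝ E ρ C)) ∧
    -- the complex (holomorphic) case
    (∀ (E : Type u) [NormedAddCommGroup E] [NormedSpace ℂ E] [FiniteDimensional ℂ E]
      (G : Type v) [TopologicalSpace G] [ChartedSpace E G] [Group G] [LieGroup 𝓘(ℂ, E) ∞ G]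
      [SimplyConnectedSpace G] [Group.IsSolvable G]
      (V : Type w) [NormedAddCommGroup V] [NormedSpace ℂ V] [FiniteDimensional ℂ V]
      (σ : G →* (V →L[ℂ] V)),
      ContMDiff 𝓘(ℂ, E) 𝓘(ℂ, V →L[ℂ] V) ∞ (fun g => σ g) →
      (∀ n ∈ SolvCoh.nilradical G, IsNilpotent (σ n - 1)) →
      (∃ B : ∀ p, Submodule ℂ (SolvCoh.TotalCochains ℂ E G V p),
        SolvCoh.IsFiniteQuasiIsoSubcomplex (SolvCoh.totalDifferential ℂ E σ) B) ∧
      (∃ C : Subgroup G, SolvCoh.IsNilpotentSupplement C) ∧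
      ∀ C : Subgroup G, SolvCoh.IsNilpotentSupplement C →
        SolvCoh.IsFiniteQuasiIsoSubcomplex (SolvCoh.totalDifferential ℂ E σ)
          (SolvCoh.invariants ℂ E σ C)) := by
  constructor
  · intro E _ _ _ G _ _ _ _ _ _ V _ _ _ ρ hρ _
    obtain ⟨C, hC⟩ := SolvCoh.exists_isNilpotentSupplement_real E G
    have key : ∀ C : Subgroup G, SolvCoh.IsNilpotentSupplement C →
        SolvCoh.IsFiniteQuasiIsoSubcomplex (SolvCoh.totalDifferential ℝ E ρ)
          (SolvCoh.invariants ℝ E ρ C) := fun C hC =>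
      SolvCoh.isFiniteQuasiIsoSubcomplex_invariants hC hρ
    exact ⟨⟨_, key C hC⟩, ⟨C, hC⟩, key⟩
  · intro E _ _ _ G _ _ _ _ _ _ V _ _ _ σ hσ _
    obtain ⟨C, hC⟩ := SolvCoh.exists_isNilpotentSupplement_complex E G
    have key : ∀ C : Subgroup G, SolvCoh.IsNilpotentSupplement C →
        SolvCoh.IsFiniteQuasiIsoSubcomplex (SolvCoh.totalDifferential ℂ E σ)
          (SolvCoh.invariants ℂ E σ C) := fun C hC =>
      SolvCoh.isFiniteQuasiIsoSubcomplex_invariants hC hσ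
    exact ⟨⟨_, key C hC⟩, ⟨C, hC⟩, key⟩
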